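/- For $\lambda\in\mathbb R$ consider the generalized inviscid Proudman–Johnson problem $$u_{xt}+uu_{xx}-\lambda u_x^2=I(t)\quad(t>0),\qquad I(t)=-(\lambda+1)\int_0^1u_x^2\,dx,\qquad u(x,0)=u_0(x),$$ with $u$ $1$-periodic in $x$. A (classical) solution on a time interval $J=[0,T)$ or $J=[0,\infty)$ is a function $u$ on $\mathbb R\times J$, $1$-periodic in $x$, with $u,u_x,u_{xx}$ continuous on $\mathbb R\times J$, $u(\cdot,0)=u_0$, for which $u_{xt}$ exists and the equation holds for $0<t\in J$; it has zero mean if $\int_0^1u(x,t)\,dx=0$ for all $t\in J$. Its characteristics are given by $\dot\gamma(\alpha,t)=u(\gamma(\alpha,t),t)$, $\gamma(\alpha,0)=\alpha\in[0,1]$, and $$M(t)=\sup_{\alpha\in[0,1]}u_x(\gamma(\alpha,t),t),\qquad m(t)=\inf_{\alpha\in[0,1]}u_x(\gamma(\alpha,t),t).$$ **Theorem.** There is a $C^\infty$, $1$-periodic function $u_0:\mathbb R\to\mathbb R$ with $\int_0^1u_0\,dx=0$, whose derivative $u_0'$ attains its maximum over $[0,1]$ only at finitely many points $\overline\alpha_i\in[0,1]$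 and its minimum only at finitely many points $\underline\alpha_j\in[0,1]$, such that the following holds. 1. For every $\lambda\in[0,1]$ there is a global solution (on $[0,\infty)$) of zero mean. If $\lambda\in(0,1)$, then for every global solution $u_x(\cdot,t)\to0$ uniformly as $t\to\infty$, and also $u(\cdot,t)\to0$ uniformly if $u$ has zero mean. If $\lambda=1$, there are a nonconstant time-independent solution $U$ of the equation and a number $c>0$ such that every zero-mean global solution satisfies $u(\cdot,t)\to U$ and $u_x(\cdot,t)\to U'$ uniformly as $t\to\infty$, and such that every global solution has characteristics on $[0,\infty)$ and satisfies $M(t)\to c$ and $u_x(\gamma(\alpha,t),t)\to-c$ for every $\alpha\in[0,1]\setminus\{\overline\alpha_i\}$. 2. For every $\lambda\in\mathbb R\setminus(-2,1]$ there is a finite $t_*>0$ such that a zero-mean solution exists on $[0,t_*)$ and every solution on $[0,t_*)$ has characteristics on $[0,t_*)$ and satisfies, as $t\uparrow t_*$: $M(t)\to+\infty$ and $m(t)\to-\infty$; $u_x(\gamma(\overline\alpha_i,t),t)\to+\infty$ and $u_x(\gamma(\underline\alpha_j,t),t)\to-\infty$ for all $i,j$; and $|u_x(\gamma(\alpha,t),t)|\to+\infty$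 for every $\alpha\in[0,1]\setminus\{\overline\alpha_i,\underline\alpha_j\}$ (two-sided, everywhere blow-up). 3. For every $\lambda\in(-2,0)$ there is a finite $t_*>0$ such that a zero-mean solution exists on $[0,t_*)$ and every solution on $[0,t_*)$ has characteristics on $[0,t_*)$ and satisfies: $m(t)\to-\infty$ as $t\uparrow t_*$, and $u_x(\gamma(\underline\alpha_j,t),t)\to-\infty$ for all $j$; while $M(t)$ stays bounded on $[0,t_*)$, and so does $u_x(\gamma(\alpha,t),t)$ for every fixed $\alpha\in[0,1]\setminus\{\underline\alpha_j\}$ (one-sided, discrete blow-up). -/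

import Mathlib

open Set Filter Topology
open scoped ContDiff

namespace ProudmanJohnson

noncomputable section

/-- The spatial derivative `u_x (x, t)` of `u : (x, t) ↦ u x t`. -/
def ux (u : ℝ → ℝ → ℝ) (x t : ℝ) : ℝ := deriv (fun y => u y t) x

/-- The second spatial derivative `u_xx (x, t)`. -/
def uxx (u : ℝ → ℝ → ℝ) (x t : ℝ) : ℝ := deriv (fun y => ux u y t) x

/-- The nonlocal term `I(t) = -(lam + 1) ∫₀¹ u_x(x,t)² dx`. -/
def nonlocalTerm (lam : ℝ) (u : ℝ → ℝ → ℝ) (t : ℝ) : ℝ :=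
  -(lam + 1) * ∫ x in (0 : ℝ)..1, ux u x t ^ 2

/-- `u` is a classical, spatially 1-periodic solution, on the time interval `J`
(`J = [0, T)` or `J = [0, ∞)`), of the initial value problem
`u_xt + u u_xx - lam u_x² = I(t)` for `t > 0`, `u(x, 0) = u₀(x)`.
The derivative `u_xt` is required to exist for `t > 0`; it is then continuous by the equation. -/
structure IsClassicalSolution (lam : ℝ) (u₀ : ℝ → ℝ) (J : Set ℝ) (u : ℝ → ℝ → ℝ) : Prop where
  periodic : ∀ t ∈ J, Function.Periodic (fun x => u x t) 1
  contDiff : ∀ t ∈ J, ContDiff ℝ 2 (fun x => u x t)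
  continuousOn : ContinuousOn (fun p : ℝ × ℝ => u p.1 p.2) (univ ×ˢ J)
  continuousOn_ux : ContinuousOn (fun p : ℝ × ℝ => ux u p.1 p.2) (univ ×ˢ J)
  continuousOn_uxx : ContinuousOn (fun p : ℝ × ℝ => uxx u p.1 p.2) (univ ×ˢ J)
  initial : ∀ x, u x 0 = u₀ x
  equation : ∀ t ∈ J, 0 < t → ∀ x,
    HasDerivAt (fun s => ux u x s)
      (nonlocalTerm lam u t - u x t * uxx u x t + lam * ux u x t ^ 2) t

/-- The spatial mean of `u(·, t)` is zero at every time of `J`. -/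
def HasZeroMean (J : Set ℝ) (u : ℝ → ℝ → ℝ) : Prop :=
  ∀ t ∈ J, ∫ x in (0 : ℝ)..1, u x t = 0

/-- `γ` is the family of characteristics of `u` on `J`, with labels in `[0, 1]`:
`∂ₜ γ(α, t) = u(γ(α, t), t)`, `γ(α, 0) = α` (the derivative is one-sided at `t = 0`). -/
def IsCharacteristicFlow (J : Set ℝ) (u γ : ℝ → ℝ → ℝ) : Prop :=
  ∀ α ∈ Icc (0 : ℝ) 1, γ α 0 = α ∧
    ∀ t ∈ J, HasDerivWithinAt (γ α) (u (γ α t) t) (Ici 0) t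

/-- `M(t)`, the supremum of `u_x(γ(α, t), t)` over `α ∈ [0, 1]`. -/
def maxSlope (u γ : ℝ → ℝ → ℝ) (t : ℝ) : ℝ :=
  sSup ((fun α => ux u (γ α t) t) '' Icc (0 : ℝ) 1)

/-- `m(t)`, the infimum of `u_x(γ(α, t), t)` over `α ∈ [0, 1]`. -/
def minSlope (u γ : ℝ → ℝ → ℝ) (t : ℝ) : ℝ :=
  sInf ((fun α => ux u (γ α t) t) '' Icc (0 : ℝ) 1)

/-- The points of `[0, 1]` at which `u₀'` attains its greatest value. -/
def maxPoints (u₀ : ℝ → ℝ) : Set ℝ :=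
  {α | α ∈ Icc (0 : ℝ) 1 ∧ IsMaxOn (deriv u₀) (Icc 0 1) α}

/-- The points of `[0, 1]` at which `u₀'` attains its least value. -/
def minPoints (u₀ : ℝ → ℝ) : Set ℝ :=
  {α | α ∈ Icc (0 : ℝ) 1 ∧ IsMinOn (deriv u₀) (Icc 0 1) α}

/-- Two-sided, everywhere blow-up of `u_x` along the characteristics `γ` as `t ↑ T`. -/
structure TwoSidedEverywhereBlowup (u₀ : ℝ → ℝ) (T : ℝ) (u γ : ℝ → ℝ → ℝ) : Prop where
  max_atTop : Tendsto (maxSlope u γ) (𝓝[<] T) atTop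
  min_atBot : Tendsto (minSlope u γ) (𝓝[<] T) atBot
  at_maxPoints : ∀ α ∈ maxPoints u₀, Tendsto (fun t => ux u (γ α t) t) (𝓝[<] T) atTop
  at_minPoints : ∀ α ∈ minPoints u₀, Tendsto (fun t => ux u (γ α t) t) (𝓝[<] T) atBot
  elsewhere : ∀ α ∈ Icc (0 : ℝ) 1, α ∉ maxPoints u₀ ∪ minPoints u₀ →
    Tendsto (fun t => |ux u (γ α t) t|) (𝓝[<] T) atTop

/-- One-sided, discrete blow-up as `t ↑ T`: only the minimum diverges, and only along the
characteristics issuing from the minimum points of `u₀'`. -/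
structure OneSidedDiscreteBlowup (u₀ : ℝ → ℝ) (T : ℝ) (u γ : ℝ → ℝ → ℝ) : Prop where
  min_atBot : Tendsto (minSlope u γ) (𝓝[<] T) atBot
  max_bounded : ∃ C : ℝ, ∀ t ∈ Ico 0 T, |maxSlope u γ t| ≤ C
  at_minPoints : ∀ α ∈ minPoints u₀, Tendsto (fun t => ux u (γ α t) t) (𝓝[<] T) atBot
  elsewhere : ∀ α ∈ Icc (0 : ℝ) 1, α ∉ minPoints u₀ →
    ∃ C : ℝ, ∀ t ∈ Ico 0 T, |ux u (γ α t) t| ≤ C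

end

end ProudmanJohnson

/-! Along a characteristic the slope g = u_x solves the Riccati equation g' = lam g² + I(t), with
the same I for every label, so differences of slopes do not see the nonlocal term. The datum has
slope f = cos³(2πα), which vanishes at α = 1/4. Integrating the difference with that label gives the
Jacobian of the flow, up to a factor independent of α, as (1 - lam η f)^(-1/lam), where η is a new
time. By periodicity the Jacobian has mean one, so the factor is 1/P(η) with P = `meanWeight lam`.
Hence dη/dt = P^(-2 lam), t = `timeScale lam η`, and u_x = P^(-2 lam) (f/(1 - lam η f) - P'/P) for
every solution, of zero mean or not (`exp_logJacobian_sub`, `exp_logJacobian_quarter`, `ux_flow`,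
`timeScale_timeChange`). Conversely these formulas define a solution, and its oddness in x gives
zero mean (`isClassicalSolution_solution`). For lam = 0, where only existence is claimed, the weight
is exponential and η = t.

For lam ≠ 0 put p = 1/lam and κ = |lam| η. Everything reduces to the behaviour of S_p(κ) = ∫ (1 - κ
cos³(2πx))^(-p) dx as κ ↑ 1. The maximum of cos³ is quadratic, so S_p stays bounded for p < 1/2,
diverges logarithmically for p = 1/2, and grows like (1-κ)^(1/2-p) for p > 1/2. The elapsed time is
a multiple of ∫ S_p^(2/p) dκ, which diverges exactly for p ≥ 1, that is for lam in (0, 1]; this is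
the dichotomy between global existence and a finite end time. P'/P is governed by S_(p+1)/S_p.

If p > 1, the factor S_p^(-2/p) beats the bound 3/(1-κ) for the bracket, and u_x tends to 0. If -1/2
≤ p < 1, the ratio S_(p+1)/S_p, weighted by S_p^(-2/p), diverges and drags every nonextremal label
to infinity, while the extremal label keeps the opposite sign because f/(1 - κ f) wins there
(`tendsto_cosSlope_atBot`, `tendsto_cosSlope_one`). If p < -1/2, then p + 1 < 1/2, the ratio is
bounded, and only the minimum points blow up.

If p = 1 the two effects balance. Replacing 1 - κ cos³ by the degree-one density 1 + 2κ - 3κ cos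
changes its reciprocal by at most 3, negligible against S_1. For this density the flow is explicit,
and the slope is three times the cosine of the transported angle (`cos_modelFlow`,
`abs_slope_sub_modelCos_le`), so u_x tends to 3 cos(2πx) in the zero-mean frame. -/

namespace ProudmanJohnson

noncomputable section

/-! ### Calculus with separate regularity in space and time -/

section Calculus

/-- Mean value theorem in the first variable, along a continuous curve. -/
theorem exists_mean_slope {F Fx : ℝ → ℝ → ℝ} {a : ℝ → ℝ} {t : ℝ} (ha : ContinuousAt a t)
    (hF : ∀ᶠ p : ℝ × ℝ in 𝓝 (a t, t), HasDerivAt (fun x => F x p.2) (Fx p.1 p.2) p.1)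
    (hFx : ContinuousAt (fun p : ℝ × ℝ => Fx p.1 p.2) (a t, t)) :
    ∃ c : ℝ → ℝ, Tendsto c (𝓝 t) (𝓝 (Fx (a t) t)) ∧
      ∀ᶠ s in 𝓝 t, F (a s) s - F (a t) s = c s * (a s - a t) := by
  -- Where `a s = a t` the required identity is 0 = 0 for any value; the partial derivative is
  -- chosen there only so that `c` still converges.
  set c : ℝ → ℝ := fun s => if a s = a t then Fx (a t) s else (F (a s) s - F (a t) s) / (a s - a t)
    with hc
  refine ⟨c, ?_, Eventually.of_forall fun s => ?_⟩
  swap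
  · by_cases h : a s = a t
    · simp [h]
    · have : a s - a t ≠ 0 := sub_ne_zero.2 h
      simp only [hc, h, if_false]; field_simp
  rw [Metric.tendsto_nhds]
  intro ε hε
  have h1 : ∀ᶠ p : ℝ × ℝ in 𝓝 (a t, t), dist (Fx p.1 p.2) (Fx (a t) t) < ε :=
    Metric.tendsto_nhds.1 hFx ε hε
  obtain ⟨δ, hδ, hball⟩ := Metric.eventually_nhds_iff.1 (hF.and h1)
  have h2 : ∀ᶠ s in 𝓝 t, dist (a s) (a t) < δ := Metric.tendsto_nhds.1 ha δ hδ
  have h3 : ∀ᶠ s in 𝓝 t, dist s t < δ := Metric.ball_mem_nhds t hδ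
  filter_upwards [h2, h3] with s hs hst
  have key : ∀ x, dist x (a t) < δ → HasDerivAt (fun x => F x s) (Fx x s) x ∧
      dist (Fx x s) (Fx (a t) t) < ε := fun x hx =>
    hball (y := (x, s)) (by rw [Prod.dist_eq]; exact max_lt hx hst)
  by_cases h : a s = a t
  · simp only [hc, h, if_true]
    exact (key _ (by simpa using hδ)).2
  · simp only [hc, h, if_false]
    rcases lt_or_gt_of_ne h with h' | h'
    · have hin : ∀ x ∈ Icc (a s) (a t), dist x (a t) < δ := fun x hx => by
        rw [Real.dist_eq, abs_sub_lt_iff] at *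
        constructor <;> linarith [hx.1, hx.2]
      obtain ⟨ξ, hξ, hξ'⟩ := exists_hasDerivAt_eq_slope (fun x => F x s) (fun x => Fx x s) h'
        (fun x hx => (key x (hin x hx)).1.continuousAt.continuousWithinAt)
        (fun x hx => (key x (hin x (Ioo_subset_Icc_self hx))).1)
      have := (key ξ (hin ξ (Ioo_subset_Icc_self hξ))).2
      rwa [hξ', ← neg_sub, ← neg_sub (a s), neg_div_neg_eq] at this
    · have hin : ∀ x ∈ Icc (a t) (a s), dist x (a t) < δ := fun x hx => by
        rw [Real.dist_eq, abs_sub_lt_iff] at *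
        constructor <;> linarith [hx.1, hx.2]
      obtain ⟨ξ, hξ, hξ'⟩ := exists_hasDerivAt_eq_slope (fun x => F x s) (fun x => Fx x s) h'
        (fun x hx => (key x (hin x hx)).1.continuousAt.continuousWithinAt)
        (fun x hx => (key x (hin x (Ioo_subset_Icc_self hx))).1)
      have := (key ξ (hin ξ (Ioo_subset_Icc_self hξ))).2
      rwa [hξ'] at this

/-- Chain rule along a curve, for a function with one continuous partial derivative. -/
theorem hasDerivAt_comp_curve {F Fx : ℝ → ℝ → ℝ} {a : ℝ → ℝ} {a' Ft t : ℝ}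
    (ha : HasDerivAt a a' t)
    (hF : ∀ᶠ p : ℝ × ℝ in 𝓝 (a t, t), HasDerivAt (fun x => F x p.2) (Fx p.1 p.2) p.1)
    (hFx : ContinuousAt (fun p : ℝ × ℝ => Fx p.1 p.2) (a t, t))
    (hFt : HasDerivAt (fun s => F (a t) s) Ft t) :
    HasDerivAt (fun s => F (a s) s) (Fx (a t) t * a' + Ft) t := by
  obtain ⟨c, hc, hc'⟩ := exists_mean_slope ha.continuousAt hF hFx
  rw [hasDerivAt_iff_tendsto_slope] at *
  refine (((hc.mono_left nhdsWithin_le_nhds).mul ha).add hFt).congr' ?_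
  filter_upwards [nhdsWithin_le_nhds hc'] with s hs
  simp only [slope_def_field]
  rw [← mul_div_assoc, ← hs]
  ring

/-- The derivative of an implicitly defined function. -/
theorem hasDerivAt_of_implicit {F Fx : ℝ → ℝ → ℝ} {a : ℝ → ℝ} {Ft t x : ℝ}
    (ha : ContinuousAt a t)
    (hF : ∀ᶠ p : ℝ × ℝ in 𝓝 (a t, t), HasDerivAt (fun x => F x p.2) (Fx p.1 p.2) p.1)
    (hFx : ContinuousAt (fun p : ℝ × ℝ => Fx p.1 p.2) (a t, t))
    (hFt : HasDerivAt (fun s => F (a t) s) Ft t) (hne : Fx (a t) t ≠ 0)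
    (hx : ∀ᶠ s in 𝓝 t, F (a s) s = x) :
    HasDerivAt a (-Ft / Fx (a t) t) t := by
  obtain ⟨c, hc, hc'⟩ := exists_mean_slope ha hF hFx
  rw [hasDerivAt_iff_tendsto_slope] at *
  have hc0 : ∀ᶠ s in 𝓝 t, c s ≠ 0 := hc.eventually_ne hne
  -- Since `F (a s) s` is constant, `c s * (a s - a t)` equals `F (a t) t - F (a t) s`; dividing by
  -- `c s` and by `s - t` gives the slope of `a`.
  refine ((hFt.neg).div (hc.mono_left nhdsWithin_le_nhds) hne).congr' ?_
  filter_upwards [nhdsWithin_le_nhds hc', nhdsWithin_le_nhds hc0, nhdsWithin_le_nhds hx,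
    self_mem_nhdsWithin] with s hs h0 hxs hst
  have hxt : F (a t) t = x := hx.self_of_nhds
  have hst' : s - t ≠ 0 := sub_ne_zero.2 hst
  simp only [slope_def_field, Pi.div_apply]
  rw [hxt, div_eq_iff h0, div_mul_eq_mul_div, mul_comm, ← hs, hxs]
  ring

/-- Differentiation under the integral sign for continuous integrands. -/
theorem hasDerivAt_intervalIntegral {F F' : ℝ → ℝ → ℝ} {Ω : Set ℝ} (hΩ : IsOpen Ω)
    (hF : ContinuousOn (fun p : ℝ × ℝ => F p.1 p.2) (univ ×ˢ Ω))
    (hF' : ContinuousOn (fun p : ℝ × ℝ => F' p.1 p.2) (univ ×ˢ Ω))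
    (hd : ∀ s, ∀ y ∈ Ω, HasDerivAt (fun y => F s y) (F' s y) y) (a b : ℝ) {y : ℝ} (hy : y ∈ Ω) :
    HasDerivAt (fun y => ∫ s in a..b, F s y) (∫ s in a..b, F' s y) y := by
  have hc : ∀ {G : ℝ → ℝ → ℝ}, ContinuousOn (fun p : ℝ × ℝ => G p.1 p.2) (univ ×ˢ Ω) →
      ∀ z ∈ Ω, Continuous fun s => G s z := fun {G} hG z hz =>
    hG.comp_continuous (f := fun s => (s, z)) (by fun_prop) (fun s => ⟨mem_univ _, hz⟩)
  obtain ⟨r, hr, hrΩ⟩ := Metric.nhds_basis_closedBall.mem_iff.1 (hΩ.mem_nhds hy)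
  obtain ⟨C, hC⟩ := (isCompact_uIcc (a := a) (b := b)).prod (isCompact_closedBall y r)
    |>.exists_bound_of_continuousOn (hF'.mono (prod_mono (subset_univ _) hrΩ))
  refine (intervalIntegral.hasDerivAt_integral_of_dominated_loc_of_deriv_le
    (F := fun y s => F s y) (F' := fun y s => F' s y) (bound := fun _ => C)
    (Metric.closedBall_mem_nhds y hr) ?_ ((hc hF y hy).intervalIntegrable _ _)
    (hc hF' y hy).aestronglyMeasurable ?_ (by simp) ?_).2
  · filter_upwards [hΩ.mem_nhds hy] with z hz using (hc hF z hz).aestronglyMeasurable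
  · exact Eventually.of_forall fun s hs z hz => hC (s, z) ⟨uIoc_subset_uIcc hs, hz⟩
  · exact Eventually.of_forall fun s _ z hz => hd s z (hrΩ hz)

/-- Joint continuity of parametric primitives. -/
theorem continuousOn_primitive {F : ℝ → ℝ → ℝ} {Ω : Set ℝ} (hΩ : IsOpen Ω)
    (hF : ContinuousOn (fun p : ℝ × ℝ => F p.1 p.2) (univ ×ˢ Ω)) :
    ContinuousOn (fun p : ℝ × ℝ => ∫ s in (0 : ℝ)..p.1, F s p.2) (univ ×ˢ Ω) := by
  rw [continuousOn_iff_continuous_domRestrict]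
  let f : (univ ×ˢ Ω : Set (ℝ × ℝ)) → ℝ → ℝ := fun p s => F s p.1.2
  have hf : Continuous f.uncurry := by
    refine hF.comp_continuous
      (f := fun q : (univ ×ˢ Ω : Set (ℝ × ℝ)) × ℝ => (q.2, q.1.1.2)) (by fun_prop) ?_
    rintro ⟨⟨p, hp⟩, s⟩
    exact ⟨mem_univ _, hp.2⟩
  have : LocallyCompactSpace (univ ×ˢ Ω : Set (ℝ × ℝ)) :=
    (isOpen_univ.prod hΩ).locallyCompactSpace
  exact intervalIntegral.continuous_parametric_intervalIntegral_of_continuous hf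
    (s := fun p => p.1.1) (by fun_prop)

end Calculus

/-! ### Time intervals and primitives in time -/

section TimeInterval

/-- The time intervals `[0, ∞)` and `[0, T)`. -/
def IsTimeInterval (J : Set ℝ) : Prop := J = Ici 0 ∨ ∃ T, 0 < T ∧ J = Ico 0 T

namespace IsTimeInterval

variable {J : Set ℝ} (hJ : IsTimeInterval J)
include hJ

theorem zero_mem : (0 : ℝ) ∈ J := by
  rcases hJ with rfl | ⟨T, hT, rfl⟩ <;> simp [*]

theorem nonneg {t : ℝ} (ht : t ∈ J) : 0 ≤ t := by
  rcases hJ with rfl | ⟨T, hT, rfl⟩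
  exacts [ht, ht.1]

theorem Icc_subset {t : ℝ} (ht : t ∈ J) : Icc 0 t ⊆ J := by
  rcases hJ with rfl | ⟨T, hT, rfl⟩
  exacts [fun s hs => hs.1, fun s hs => ⟨hs.1, hs.2.trans_lt ht.2⟩]

theorem exists_gt {t : ℝ} (ht : t ∈ J) : ∃ τ ∈ J, t < τ := by
  rcases hJ with rfl | ⟨T, hT, rfl⟩
  · exact ⟨t + 1, by simp only [mem_Ici] at *; linarith, by linarith⟩
  · exact ⟨(t + T) / 2, ⟨by linarith [ht.1, ht.2], by linarith [ht.2]⟩, by linarith [ht.2]⟩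

theorem mem_nhds {t : ℝ} (ht : t ∈ J) (h0 : 0 < t) : J ∈ 𝓝 t := by
  obtain ⟨τ, hτ, h⟩ := hJ.exists_gt ht
  exact mem_of_superset (Icc_mem_nhds h0 h) (hJ.Icc_subset hτ)

/-- The evolution equation is available only for positive times, so conserved quantities are
propagated from time 0 by continuity there. -/
theorem eq_of_hasDerivAt_zero {g : ℝ → ℝ} (hg : ContinuousOn g J)
    (hg' : ∀ t ∈ J, 0 < t → HasDerivAt g 0 t) {t : ℝ} (ht : t ∈ J) : g t = g 0 := by
  rcases (hJ.nonneg ht).eq_or_lt with rfl | h0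
  · rfl
  obtain ⟨ξ, hξ, h⟩ := exists_hasDerivAt_eq_slope g (fun _ => 0) h0
    (hg.mono (hJ.Icc_subset ht))
    (fun s hs => hg' s (hJ.Icc_subset ht (Ioo_subset_Icc_self hs)) hs.1)
  rw [eq_comm, div_eq_zero_iff] at h
  rcases h with h | h <;> linarith

theorem intervalIntegrable {g : ℝ → ℝ} (hg : ContinuousOn g J) {t : ℝ} (ht : t ∈ J) :
    IntervalIntegrable g MeasureTheory.volume 0 t :=
  (hg.mono (by rw [uIcc_of_le (hJ.nonneg ht)]; exact hJ.Icc_subset ht)).intervalIntegrable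

theorem hasDerivAt_primitive {g : ℝ → ℝ} (hg : ContinuousOn g J) {t : ℝ} (ht : t ∈ J)
    (h0 : 0 < t) : HasDerivAt (fun t => ∫ s in (0 : ℝ)..t, g s) (g t) t :=
  intervalIntegral.integral_hasDerivAt_right (hJ.intervalIntegrable hg ht)
    ((hg.mono interior_subset).stronglyMeasurableAtFilter isOpen_interior t
      (mem_interior_iff_mem_nhds.2 (hJ.mem_nhds ht h0)))
    (hg.continuousAt (hJ.mem_nhds ht h0))

theorem continuousOn_primitive {g : ℝ → ℝ} (hg : ContinuousOn g J) :
    ContinuousOn (fun t => ∫ s in (0 : ℝ)..t, g s) J := by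
  intro t ht
  obtain ⟨τ, hτ, h⟩ := hJ.exists_gt ht
  have h0 := hJ.nonneg ht
  have := intervalIntegral.continuousOn_primitive_interval (a := 0) (b := τ) (f := g)
    (μ := MeasureTheory.volume) (by
      rw [uIcc_of_le (h0.trans h.le)]
      exact (hg.mono (hJ.Icc_subset hτ)).integrableOn_Icc)
  rw [uIcc_of_le (h0.trans h.le)] at this
  refine (this t ⟨h0, h.le⟩).mono_of_mem_nhdsWithin ?_
  refine mem_nhdsWithin.2 ⟨Iio τ, isOpen_Iio, h, fun s hs => ⟨hJ.nonneg hs.2, le_of_lt hs.1⟩⟩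

end IsTimeInterval

end TimeInterval


/-! ### The datum, the weights and the normalized Jacobian -/

section Weight

/-- The initial datum, a primitive of `cos³ (2πx)`. -/
def datum (x : ℝ) : ℝ :=
  (Real.sin (2 * Real.pi * x) - Real.sin (2 * Real.pi * x) ^ 3 / 3) / (2 * Real.pi)

/-- The derivative `cos³ (2πx)` of the initial datum. -/
def datumSlope (x : ℝ) : ℝ := Real.cos (2 * Real.pi * x) ^ 3

/-- The derivative of `datumSlope`. -/
def datumCurv (x : ℝ) : ℝ :=
  -(6 * Real.pi) * Real.cos (2 * Real.pi * x) ^ 2 * Real.sin (2 * Real.pi * x)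

theorem hasDerivAt_two_pi_mul (x : ℝ) :
    HasDerivAt (fun x : ℝ => 2 * Real.pi * x) (2 * Real.pi) x := by
  simpa using (hasDerivAt_id x).const_mul (2 * Real.pi)

theorem hasDerivAt_datum (x : ℝ) : HasDerivAt datum (datumSlope x) x := by
  have h := (hasDerivAt_two_pi_mul x).sin
  refine ((h.sub ((h.pow 3).div_const 3)).div_const (2 * Real.pi)).congr_deriv ?_
  have := Real.sin_sq (2 * Real.pi * x)
  simp only [datumSlope, Nat.cast_ofNat, Nat.reduceSub, this]
  field_simp
  ring

theorem hasDerivAt_datumSlope (x : ℝ) : HasDerivAt datumSlope (datumCurv x) x := by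
  refine ((hasDerivAt_two_pi_mul x).cos.pow 3).congr_deriv ?_
  simp only [datumCurv, Nat.cast_ofNat, Nat.reduceSub]
  ring

theorem deriv_datum : deriv datum = datumSlope := funext fun x => (hasDerivAt_datum x).deriv

theorem contDiff_datum : ContDiff ℝ ∞ datum := by
  unfold datum
  fun_prop

theorem continuous_datum : Continuous datum := contDiff_datum.continuous

@[fun_prop]
theorem continuous_datumSlope : Continuous datumSlope := by
  unfold datumSlope
  fun_prop

@[fun_prop]
theorem continuous_datumCurv : Continuous datumCurv := by
  unfold datumCurv
  fun_prop

theorem datum_periodic : Function.Periodic datum 1 := fun x => by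
  simp only [datum]
  rw [mul_add, mul_one, Real.sin_add_two_pi]

theorem datumSlope_periodic : Function.Periodic datumSlope 1 := fun x => by
  simp only [datumSlope]
  rw [mul_add, mul_one, Real.cos_add_two_pi]

theorem datumSlope_neg (x : ℝ) : datumSlope (-x) = datumSlope x := by
  simp [datumSlope, Real.cos_neg]

theorem datum_zero : datum 0 = 0 := by simp [datum]

theorem datum_one : datum 1 = 0 := by simp [datum]

theorem datumSlope_zero : datumSlope 0 = 1 := by simp [datumSlope]

theorem datumSlope_half : datumSlope (1 / 2) = -1 := by
  have : 2 * Real.pi * (1 / 2) = Real.pi := by ring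
  rw [datumSlope, this, Real.cos_pi]
  norm_num

theorem datumSlope_quarter : datumSlope (1 / 4) = 0 := by
  have : 2 * Real.pi * (1 / 4) = Real.pi / 2 := by ring
  rw [datumSlope, this, Real.cos_pi_div_two]
  norm_num

theorem abs_datumSlope_le_one (x : ℝ) : |datumSlope x| ≤ 1 := by
  rw [datumSlope, abs_pow]
  exact pow_le_one₀ (abs_nonneg _) (Real.abs_cos_le_one _)

theorem datumSlope_le_one (x : ℝ) : datumSlope x ≤ 1 := (abs_le.1 (abs_datumSlope_le_one x)).2

theorem neg_one_le_datumSlope (x : ℝ) : -1 ≤ datumSlope x :=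
  (abs_le.1 (abs_datumSlope_le_one x)).1

theorem integral_datumSlope (a b : ℝ) : ∫ x in a..b, datumSlope x = datum b - datum a :=
  intervalIntegral.integral_eq_sub_of_hasDerivAt (fun x _ => hasDerivAt_datum x)
    (continuous_datumSlope.intervalIntegrable _ _)

/-- The solution `w` of `(1 - lam y) w' = w`, `w 0 = 1`. -/
def weight (lam y : ℝ) : ℝ := if lam = 0 then Real.exp y else (1 - lam * y) ^ (-1 / lam)

theorem weight_zero (lam : ℝ) : weight lam 0 = 1 := by
  unfold weight
  split_ifs <;> simp

theorem weight_pos {lam y : ℝ} (h : 0 < 1 - lam * y) : 0 < weight lam y := by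
  unfold weight
  split_ifs
  exacts [Real.exp_pos _, Real.rpow_pos_of_pos h _]

/-- The exponential and the power obey the same differential equation; after this point the
construction of the solution needs no case distinction on `lam = 0`. -/
theorem hasDerivAt_weight {lam y : ℝ} (h : 0 < 1 - lam * y) :
    HasDerivAt (weight lam) (weight lam y / (1 - lam * y)) y := by
  by_cases h0 : lam = 0
  · subst h0
    have : weight 0 = Real.exp := by ext; simp [weight]
    rw [this]
    simpa using Real.hasDerivAt_exp y
  · have : weight lam = fun y => (1 - lam * y) ^ (-1 / lam) := by ext; simp [weight, h0]
    rw [this]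
    have hd : HasDerivAt (fun y : ℝ => 1 - lam * y) (-lam) y := by
      simpa using ((hasDerivAt_id y).const_mul lam).const_sub 1
    refine (hd.rpow_const (Or.inl h.ne')).congr_deriv ?_
    rw [Real.rpow_sub_one h.ne']
    field_simp

/-- The parameter interval on which the weights `weight lam (η * datumSlope x)` are regular. -/
def weightDomain (lam : ℝ) : Set ℝ := {η | |lam * η| < 1}

theorem isOpen_weightDomain (lam : ℝ) : IsOpen (weightDomain lam) :=
  isOpen_lt (by fun_prop) continuous_const

theorem zero_mem_weightDomain (lam : ℝ) : (0 : ℝ) ∈ weightDomain lam := by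
  simp [weightDomain]

theorem den_pos {lam η : ℝ} (h : η ∈ weightDomain lam) (x : ℝ) :
    0 < 1 - lam * (η * datumSlope x) := by
  have h1 : |lam * η * datumSlope x| < 1 := by
    rw [abs_mul]
    calc _ ≤ |lam * η| * 1 := by gcongr; exact abs_datumSlope_le_one x
      _ < 1 := by rw [mul_one]; exact h
  rw [← mul_assoc]
  linarith [(abs_lt.1 h1).2]

/-- The weight at the label `x`. -/
def labelWeight (lam x η : ℝ) : ℝ := weight lam (η * datumSlope x)

/-- The logarithmic derivative in `η` of the weight at the label `x`. -/
def labelSlope (lam x η : ℝ) : ℝ := datumSlope x / (1 - lam * (η * datumSlope x))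

theorem labelWeight_pos {lam η : ℝ} (h : η ∈ weightDomain lam) (x : ℝ) :
    0 < labelWeight lam x η := weight_pos (den_pos h x)

theorem labelWeight_zero (lam x : ℝ) : labelWeight lam x 0 = 1 := by
  simp [labelWeight, weight_zero]

theorem labelSlope_zero (lam x : ℝ) : labelSlope lam x 0 = datumSlope x := by
  simp [labelSlope]

theorem hasDerivAt_labelWeight {lam η : ℝ} (h : η ∈ weightDomain lam) (x : ℝ) :
    HasDerivAt (fun η => labelWeight lam x η) (labelSlope lam x η * labelWeight lam x η) η := by
  have hd : HasDerivAt (fun η : ℝ => η * datumSlope x) (datumSlope x) η := by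
    simpa using (hasDerivAt_id η).mul_const (datumSlope x)
  refine ((hasDerivAt_weight (den_pos h x)).comp η hd).congr_deriv ?_
  rw [labelSlope, labelWeight]
  ring

/-- This is the Riccati equation of the slope along a characteristic, with the nonlocal term
removed. -/
theorem hasDerivAt_labelSlope {lam η : ℝ} (h : η ∈ weightDomain lam) (x : ℝ) :
    HasDerivAt (fun η => labelSlope lam x η) (lam * labelSlope lam x η ^ 2) η := by
  have hd : HasDerivAt (fun η : ℝ => 1 - lam * (η * datumSlope x)) (-(lam * datumSlope x)) η := by
    simpa using (((hasDerivAt_id η).mul_const (datumSlope x)).const_mul lam).const_sub 1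
  refine ((hasDerivAt_const η (datumSlope x)).div hd (den_pos h x).ne').congr_deriv ?_
  have := (den_pos h x).ne'
  rw [labelSlope]
  field_simp
  ring

theorem hasDerivAt_labelSlope_left {lam η : ℝ} (h : η ∈ weightDomain lam) (x : ℝ) :
    HasDerivAt (fun x => labelSlope lam x η)
      (datumCurv x / (1 - lam * (η * datumSlope x)) ^ 2) x := by
  have hd : HasDerivAt (fun x : ℝ => 1 - lam * (η * datumSlope x)) (-(lam * (η * datumCurv x))) x :=
    (((hasDerivAt_datumSlope x).const_mul η).const_mul lam).const_sub 1
  refine ((hasDerivAt_datumSlope x).div hd (den_pos h x).ne').congr_deriv ?_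
  congr 1
  ring

theorem continuousOn_labelWeight (lam : ℝ) :
    ContinuousOn (fun p : ℝ × ℝ => labelWeight lam p.1 p.2) (univ ×ˢ weightDomain lam) := by
  rintro ⟨x, η⟩ ⟨-, h⟩
  have h1 : ContinuousAt (fun p : ℝ × ℝ => p.2 * datumSlope p.1) (x, η) :=
    Continuous.continuousAt (by fun_prop)
  exact (ContinuousAt.comp_of_eq (hasDerivAt_weight (den_pos h x)).continuousAt h1
    rfl).continuousWithinAt

theorem continuousOn_labelSlope (lam : ℝ) :
    ContinuousOn (fun p : ℝ × ℝ => labelSlope lam p.1 p.2) (univ ×ˢ weightDomain lam) :=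
  ContinuousOn.div (by fun_prop) (by fun_prop) fun p hp => (den_pos hp.2 p.1).ne'

/-- The mean of the weight. -/
def meanWeight (lam η : ℝ) : ℝ := ∫ x in (0 : ℝ)..1, labelWeight lam x η

/-- The derivative of `meanWeight`. -/
def meanWeight₁ (lam η : ℝ) : ℝ := ∫ x in (0 : ℝ)..1, labelSlope lam x η * labelWeight lam x η

/-- The mean of `labelSlope² * labelWeight`. -/
def meanWeight₂ (lam η : ℝ) : ℝ :=
  ∫ x in (0 : ℝ)..1, labelSlope lam x η ^ 2 * labelWeight lam x η

variable {lam η : ℝ}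

theorem hasDerivAt_integral_labelWeight (h : η ∈ weightDomain lam) (a : ℝ) :
    HasDerivAt (fun η => ∫ x in (0 : ℝ)..a, labelWeight lam x η)
      (∫ x in (0 : ℝ)..a, labelSlope lam x η * labelWeight lam x η) η :=
  hasDerivAt_intervalIntegral (isOpen_weightDomain lam) (continuousOn_labelWeight lam)
    ((continuousOn_labelSlope lam).mul (continuousOn_labelWeight lam))
    (fun x _ hy => hasDerivAt_labelWeight hy x) _ _ h

theorem hasDerivAt_meanWeight (h : η ∈ weightDomain lam) :
    HasDerivAt (meanWeight lam) (meanWeight₁ lam η) η := hasDerivAt_integral_labelWeight h 1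

/-- The factor `1 + lam` collects `lam` from the Riccati equation and 1 from the logarithmic
derivative of the weight; it becomes the coefficient of the nonlocal term. -/
theorem hasDerivAt_meanWeight₁ (h : η ∈ weightDomain lam) :
    HasDerivAt (meanWeight₁ lam) ((1 + lam) * meanWeight₂ lam η) η := by
  have := hasDerivAt_intervalIntegral (isOpen_weightDomain lam)
    ((continuousOn_labelSlope lam).mul (continuousOn_labelWeight lam))
    (F' := fun x η => (1 + lam) * (labelSlope lam x η ^ 2 * labelWeight lam x η))
    (continuousOn_const.mul (((continuousOn_labelSlope lam).pow 2).mul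
      (continuousOn_labelWeight lam)))
    (fun x y hy => ((hasDerivAt_labelSlope hy x).mul (hasDerivAt_labelWeight hy x)).congr_deriv
      (by ring)) 0 1 h
  rwa [intervalIntegral.integral_const_mul] at this

theorem continuous_labelWeight_left (h : η ∈ weightDomain lam) :
    Continuous fun x => labelWeight lam x η :=
  (continuousOn_labelWeight lam).comp_continuous (f := fun x => (x, η)) (by fun_prop)
    fun _ => ⟨mem_univ _, h⟩

theorem continuous_labelSlope_left (h : η ∈ weightDomain lam) :
    Continuous fun x => labelSlope lam x η :=
  (continuousOn_labelSlope lam).comp_continuous (f := fun x => (x, η)) (by fun_prop)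
    fun _ => ⟨mem_univ _, h⟩

theorem meanWeight_pos (h : η ∈ weightDomain lam) : 0 < meanWeight lam η :=
  intervalIntegral.intervalIntegral_pos_of_pos
    ((continuous_labelWeight_left h).intervalIntegrable _ _) (fun x => labelWeight_pos h x)
    one_pos

theorem meanWeight_zero (lam : ℝ) : meanWeight lam 0 = 1 := by
  simp [meanWeight, labelWeight_zero]

theorem meanWeight₁_zero (lam : ℝ) : meanWeight₁ lam 0 = 0 := by
  simp [meanWeight₁, labelWeight_zero, labelSlope_zero, integral_datumSlope, datum_zero, datum_one]

theorem continuousOn_meanWeight (lam : ℝ) : ContinuousOn (meanWeight lam) (weightDomain lam) :=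
  fun _ h => (hasDerivAt_meanWeight h).continuousAt.continuousWithinAt

theorem continuousOn_meanWeight₁ (lam : ℝ) : ContinuousOn (meanWeight₁ lam) (weightDomain lam) :=
  fun _ h => (hasDerivAt_meanWeight₁ h).continuousAt.continuousWithinAt

/-- The Jacobian of the flow. -/
def jacobian (lam x η : ℝ) : ℝ := labelWeight lam x η / meanWeight lam η

/-- The slope of the solution along the characteristic with label `x`, up to the time change. -/
def flowSlope (lam x η : ℝ) : ℝ := labelSlope lam x η - meanWeight₁ lam η / meanWeight lam η

theorem jacobian_pos (h : η ∈ weightDomain lam) (x : ℝ) : 0 < jacobian lam x η :=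
  div_pos (labelWeight_pos h x) (meanWeight_pos h)

theorem hasDerivAt_jacobian (h : η ∈ weightDomain lam) (x : ℝ) :
    HasDerivAt (fun η => jacobian lam x η) (flowSlope lam x η * jacobian lam x η) η := by
  have h0 := (meanWeight_pos h).ne'
  refine ((hasDerivAt_labelWeight h x).div (hasDerivAt_meanWeight h) h0).congr_deriv ?_
  rw [flowSlope, jacobian]
  field_simp

theorem continuousOn_snd_of {g : ℝ → ℝ} (hg : ContinuousOn g (weightDomain lam)) :
    ContinuousOn (fun p : ℝ × ℝ => g p.2) (univ ×ˢ weightDomain lam) :=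
  hg.comp continuousOn_snd fun _ hp => hp.2

theorem continuousOn_jacobian (lam : ℝ) :
    ContinuousOn (fun p : ℝ × ℝ => jacobian lam p.1 p.2) (univ ×ˢ weightDomain lam) :=
  (continuousOn_labelWeight lam).div (continuousOn_snd_of (continuousOn_meanWeight lam))
    fun _ hp => (meanWeight_pos hp.2).ne'

theorem continuousOn_flowSlope (lam : ℝ) :
    ContinuousOn (fun p : ℝ × ℝ => flowSlope lam p.1 p.2) (univ ×ˢ weightDomain lam) :=
  (continuousOn_labelSlope lam).sub ((continuousOn_snd_of (continuousOn_meanWeight₁ lam)).div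
    (continuousOn_snd_of (continuousOn_meanWeight lam)) fun _ hp => (meanWeight_pos hp.2).ne')

theorem continuous_jacobian_left (h : η ∈ weightDomain lam) :
    Continuous fun x => jacobian lam x η :=
  (continuous_labelWeight_left h).div_const _

theorem continuous_flowSlope_left (h : η ∈ weightDomain lam) :
    Continuous fun x => flowSlope lam x η :=
  (continuous_labelSlope_left h).sub continuous_const

/-- This normalization makes the flow map commute with translation by one period. -/
theorem integral_jacobian (h : η ∈ weightDomain lam) :
    ∫ x in (0 : ℝ)..1, jacobian lam x η = 1 := by
  have : (fun x => jacobian lam x η) = fun x => labelWeight lam x η / meanWeight lam η := rfl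
  rw [this, intervalIntegral.integral_div, ← meanWeight, div_self (meanWeight_pos h).ne']

theorem integral_flowSlope_mul_jacobian (h : η ∈ weightDomain lam) :
    ∫ x in (0 : ℝ)..1, flowSlope lam x η * jacobian lam x η = 0 := by
  have h0 := (meanWeight_pos h).ne'
  have : (fun x => flowSlope lam x η * jacobian lam x η) = fun x =>
      labelSlope lam x η * labelWeight lam x η / meanWeight lam η
        - meanWeight₁ lam η / meanWeight lam η * jacobian lam x η := by
    ext x
    rw [flowSlope, jacobian]
    ring
  rw [this, intervalIntegral.integral_sub, intervalIntegral.integral_div,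
    intervalIntegral.integral_const_mul, integral_jacobian h, ← meanWeight₁]
  · ring
  · exact (((continuous_labelSlope_left h).mul
      (continuous_labelWeight_left h)).div_const _).intervalIntegrable _ _
  · exact (continuous_const.mul (continuous_jacobian_left h)).intervalIntegrable _ _

/-- A variance identity: `jacobian` is a probability density on a period, and `flowSlope` is
`labelSlope` minus its mean for that density. -/
theorem integral_flowSlope_sq_mul_jacobian (h : η ∈ weightDomain lam) :
    ∫ x in (0 : ℝ)..1, flowSlope lam x η ^ 2 * jacobian lam x η =
      meanWeight₂ lam η / meanWeight lam η - (meanWeight₁ lam η / meanWeight lam η) ^ 2 := by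
  set k := meanWeight₁ lam η / meanWeight lam η with hk
  have : (fun x => flowSlope lam x η ^ 2 * jacobian lam x η) = fun x =>
      labelSlope lam x η ^ 2 * labelWeight lam x η / meanWeight lam η
        - k * (2 * (flowSlope lam x η * jacobian lam x η) + k * jacobian lam x η) := by
    ext x
    rw [flowSlope, jacobian, ← hk]
    ring
  have c1 := continuous_jacobian_left h
  have c2 := continuous_flowSlope_left h
  have c3 := continuous_labelSlope_left h
  have c4 := continuous_labelWeight_left h
  rw [this, intervalIntegral.integral_sub, intervalIntegral.integral_div,
    intervalIntegral.integral_const_mul, intervalIntegral.integral_add,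
    intervalIntegral.integral_const_mul, intervalIntegral.integral_const_mul,
    integral_flowSlope_mul_jacobian h, integral_jacobian h, ← meanWeight₂]
  · ring
  all_goals exact Continuous.intervalIntegrable (by fun_prop) _ _

theorem labelWeight_periodic (lam η : ℝ) : Function.Periodic (fun x => labelWeight lam x η) 1 :=
  fun x => by simp only [labelWeight, datumSlope_periodic x]

theorem labelSlope_periodic (lam η : ℝ) : Function.Periodic (fun x => labelSlope lam x η) 1 :=
  fun x => by simp only [labelSlope, datumSlope_periodic x]

theorem jacobian_periodic (lam η : ℝ) : Function.Periodic (fun x => jacobian lam x η) 1 :=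
  fun x => by simp only [jacobian, labelWeight_periodic lam η x]

theorem flowSlope_periodic (lam η : ℝ) : Function.Periodic (fun x => flowSlope lam x η) 1 :=
  fun x => by simp only [flowSlope, labelSlope_periodic lam η x]

/-- Evenness in the label makes the flow and the velocity odd, which is the source of the zero mean
and of the fixed point at the origin. -/
theorem jacobian_neg (lam x η : ℝ) : jacobian lam (-x) η = jacobian lam x η := by
  simp [jacobian, labelWeight, datumSlope_neg]

theorem flowSlope_neg (lam x η : ℝ) : flowSlope lam (-x) η = flowSlope lam x η := by
  simp [flowSlope, labelSlope, datumSlope_neg]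

end Weight


/-! ### The flow map, its inverse and the explicit solution -/

section FlowMap

/-- The flow map, in the parameter `η`. -/
def flowMap (lam a η : ℝ) : ℝ := ∫ x in (0 : ℝ)..a, jacobian lam x η

/-- The derivative of the flow map in the parameter `η`. -/
def flowVel (lam a η : ℝ) : ℝ := ∫ x in (0 : ℝ)..a, flowSlope lam x η * jacobian lam x η

variable {lam η : ℝ}

theorem hasDerivAt_flowMap (h : η ∈ weightDomain lam) (a : ℝ) :
    HasDerivAt (fun η => flowMap lam a η) (flowVel lam a η) η :=
  hasDerivAt_intervalIntegral (isOpen_weightDomain lam) (continuousOn_jacobian lam)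
    ((continuousOn_flowSlope lam).mul (continuousOn_jacobian lam))
    (fun x _ hy => hasDerivAt_jacobian hy x) _ _ h

theorem hasDerivAt_flowMap_left (h : η ∈ weightDomain lam) (a : ℝ) :
    HasDerivAt (fun a => flowMap lam a η) (jacobian lam a η) a :=
  (continuous_jacobian_left h).integral_hasStrictDerivAt 0 a |>.hasDerivAt

theorem hasDerivAt_flowVel_left (h : η ∈ weightDomain lam) (a : ℝ) :
    HasDerivAt (fun a => flowVel lam a η) (flowSlope lam a η * jacobian lam a η) a :=
  ((continuous_flowSlope_left h).mul
    (continuous_jacobian_left h)).integral_hasStrictDerivAt 0 a |>.hasDerivAt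

theorem continuousOn_flowVel (lam : ℝ) :
    ContinuousOn (fun p : ℝ × ℝ => flowVel lam p.1 p.2) (univ ×ˢ weightDomain lam) :=
  continuousOn_primitive (F := fun x η => flowSlope lam x η * jacobian lam x η)
    (isOpen_weightDomain lam) ((continuousOn_flowSlope lam).mul (continuousOn_jacobian lam))

theorem primitive_add_one {g : ℝ → ℝ} (hg : Continuous g) (hp : Function.Periodic g 1) (a : ℝ) :
    ∫ x in (0 : ℝ)..(a + 1), g x = (∫ x in (0 : ℝ)..a, g x) + ∫ x in (0 : ℝ)..1, g x := by
  rw [← intervalIntegral.integral_add_adjacent_intervals (hg.intervalIntegrable 0 a)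
    (hg.intervalIntegrable a (a + 1)), hp.intervalIntegral_add_eq a 0, zero_add]

theorem primitive_neg {g : ℝ → ℝ} (hp : ∀ x, g (-x) = g x) (a : ℝ) :
    ∫ x in (0 : ℝ)..(-a), g x = -∫ x in (0 : ℝ)..a, g x := by
  have := intervalIntegral.integral_comp_neg (a := 0) (b := a) g
  simp only [hp, neg_zero] at this
  rw [this, intervalIntegral.integral_symm]

theorem flowMap_add_one (h : η ∈ weightDomain lam) (a : ℝ) :
    flowMap lam (a + 1) η = flowMap lam a η + 1 := by
  rw [flowMap, primitive_add_one (continuous_jacobian_left h) (jacobian_periodic lam η),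
    integral_jacobian h, flowMap]

theorem flowVel_add_one (h : η ∈ weightDomain lam) (a : ℝ) :
    flowVel lam (a + 1) η = flowVel lam a η := by
  rw [flowVel, primitive_add_one (g := fun x => flowSlope lam x η * jacobian lam x η)
    ((continuous_flowSlope_left h).mul (continuous_jacobian_left h))
    ((flowSlope_periodic lam η).mul (jacobian_periodic lam η)),
    integral_flowSlope_mul_jacobian h, flowVel, add_zero]

theorem flowMap_neg (lam a η : ℝ) : flowMap lam (-a) η = -flowMap lam a η :=
  primitive_neg (fun x => jacobian_neg lam x η) a

theorem flowVel_neg (lam a η : ℝ) : flowVel lam (-a) η = -flowVel lam a η :=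
  primitive_neg (fun x => by rw [jacobian_neg, flowSlope_neg]) a

theorem flowMap_zero_left (lam η : ℝ) : flowMap lam 0 η = 0 := by simp [flowMap]

theorem flowMap_zero_right (lam a : ℝ) : flowMap lam a 0 = a := by
  simp [flowMap, jacobian, labelWeight_zero, meanWeight_zero]

theorem flowVel_zero_right (lam a : ℝ) : flowVel lam a 0 = datum a := by
  simp [flowVel, jacobian, flowSlope, labelSlope_zero, labelWeight_zero, meanWeight_zero,
    meanWeight₁_zero, integral_datumSlope, datum_zero]

theorem strictMono_flowMap (h : η ∈ weightDomain lam) : StrictMono fun a => flowMap lam a η :=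
  strictMono_of_hasDerivAt_pos (fun a => hasDerivAt_flowMap_left h a) (fun a => jacobian_pos h a)

/-- The displacement is periodic and vanishes at 0, so integers are fixed; the intermediate value
theorem fills the gaps between consecutive integers. -/
theorem surjective_flowMap (h : η ∈ weightDomain lam) :
    Function.Surjective fun a => flowMap lam a η := by
  intro x
  have hp : Function.Periodic (fun a => flowMap lam a η - a) 1 := fun a => by
    simp only [flowMap_add_one h]
    ring
  have hn : ∀ n : ℤ, flowMap lam n η = n := fun n => by
    have := hp.int_mul n 0
    simp only [zero_add, mul_one, flowMap_zero_left] at this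
    linarith
  have hc : ContinuousOn (fun a => flowMap lam a η) (Icc (⌊x⌋ : ℝ) ((⌊x⌋ + 1 : ℤ) : ℝ)) :=
    fun a _ => (hasDerivAt_flowMap_left h a).continuousAt.continuousWithinAt
  obtain ⟨a, -, ha⟩ := intermediate_value_Icc (by push_cast; linarith) hc
    (show x ∈ _ by
      simp only [hn]
      push_cast
      exact ⟨Int.floor_le x, (Int.lt_floor_add_one x).le⟩)
  exact ⟨a, ha⟩

/-- The label of the particle at position `x`: the inverse of the flow map. -/
def label (lam x η : ℝ) : ℝ := Function.invFun (fun a => flowMap lam a η) x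

theorem flowMap_label (h : η ∈ weightDomain lam) (x : ℝ) : flowMap lam (label lam x η) η = x :=
  Function.invFun_eq (f := fun a => flowMap lam a η) (surjective_flowMap h x)

theorem label_flowMap (h : η ∈ weightDomain lam) (a : ℝ) : label lam (flowMap lam a η) η = a :=
  (strictMono_flowMap h).injective (flowMap_label h _)

theorem label_eq (h : η ∈ weightDomain lam) {x a : ℝ} (ha : flowMap lam a η = x) :
    label lam x η = a := by rw [← ha, label_flowMap h]

theorem label_add_one (h : η ∈ weightDomain lam) (x : ℝ) :
    label lam (x + 1) η = label lam x η + 1 :=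
  label_eq h (by rw [flowMap_add_one h, flowMap_label h])

theorem label_neg (h : η ∈ weightDomain lam) (x : ℝ) :
    label lam (-x) η = -label lam x η :=
  label_eq h (by rw [flowMap_neg, flowMap_label h])

theorem label_zero_right (lam x : ℝ) : label lam x 0 = x :=
  label_eq (zero_mem_weightDomain lam) (flowMap_zero_right lam x)

theorem isOpen_univ_prod_weightDomain (lam : ℝ) :
    IsOpen ((univ : Set ℝ) ×ˢ weightDomain lam) := isOpen_univ.prod (isOpen_weightDomain lam)

/-- By strict monotonicity in the label, comparing `label lam x η` with a number `b` amounts to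
comparing `x` with `flowMap lam b η`, and this strict inequality is open in `(x, η)`. -/
theorem continuousOn_label (lam : ℝ) :
    ContinuousOn (fun p : ℝ × ℝ => label lam p.1 p.2) (univ ×ˢ weightDomain lam) := by
  rintro ⟨x, η⟩ ⟨-, h⟩
  have hU : weightDomain lam ∈ 𝓝 η := (isOpen_weightDomain lam).mem_nhds h
  have hev : ∀ᶠ p : ℝ × ℝ in 𝓝 (x, η), p.2 ∈ weightDomain lam :=
    continuous_snd.continuousAt.preimage_mem_nhds hU
  have hc : ∀ a, ContinuousAt (fun p : ℝ × ℝ => flowMap lam a p.2 - p.1) (x, η) := fun a =>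
    (ContinuousAt.comp_of_eq (hasDerivAt_flowMap h a).continuousAt continuousAt_snd rfl).sub
      continuousAt_fst
  refine ContinuousAt.continuousWithinAt (tendsto_order.2 ⟨fun b hb => ?_, fun b hb => ?_⟩)
  · have : flowMap lam b η - x < 0 := by
      have := strictMono_flowMap h hb
      simp only [flowMap_label h] at this
      linarith
    filter_upwards [hev, (hc b).eventually_lt_const this] with p hp hlt
    refine (strictMono_flowMap hp).lt_iff_lt.1 ?_
    simp only [flowMap_label hp]
    linarith
  · have : 0 < flowMap lam b η - x := by
      have := strictMono_flowMap h hb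
      simp only [flowMap_label h] at this
      linarith
    filter_upwards [hev, (hc b).eventually_const_lt this] with p hp hlt
    refine (strictMono_flowMap hp).lt_iff_lt.1 ?_
    simp only [flowMap_label hp]
    linarith

theorem continuous_label_left (h : η ∈ weightDomain lam) : Continuous fun x => label lam x η :=
  (continuousOn_label lam).comp_continuous (f := fun x => (x, η)) (by fun_prop)
    fun _ => ⟨mem_univ _, h⟩

theorem hasDerivAt_label_left (h : η ∈ weightDomain lam) (x : ℝ) :
    HasDerivAt (fun x => label lam x η) (jacobian lam (label lam x η) η)⁻¹ x :=
  (hasDerivAt_flowMap_left h _).of_local_left_inverse (continuous_label_left h).continuousAt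
    (jacobian_pos h _).ne' (Eventually.of_forall fun y => flowMap_label h y)

theorem hasDerivAt_label_right (h : η ∈ weightDomain lam) (x : ℝ) :
    HasDerivAt (fun η => label lam x η)
      (-flowVel lam (label lam x η) η / jacobian lam (label lam x η) η) η := by
  have hU : weightDomain lam ∈ 𝓝 η := (isOpen_weightDomain lam).mem_nhds h
  have hn : ∀ y, univ ×ˢ weightDomain lam ∈ 𝓝 (y, η) := fun y =>
    (isOpen_univ_prod_weightDomain lam).mem_nhds ⟨mem_univ _, h⟩
  refine hasDerivAt_of_implicit (F := flowMap lam) (Fx := jacobian lam) (x := x) ?_ ?_ ?_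
    (hasDerivAt_flowMap h _) (jacobian_pos h _).ne' ?_
  · exact ContinuousAt.comp_of_eq ((continuousOn_label lam).continuousAt (hn x))
      (f := fun η => (x, η)) (by fun_prop) rfl
  · filter_upwards [hn (label lam x η)] with p hp using hasDerivAt_flowMap_left hp.2 _
  · exact (continuousOn_jacobian lam).continuousAt (hn _)
  · filter_upwards [hU] with s hs using flowMap_label hs x

/-- The solution in the parameter `η`, up to the time change. -/
def baseVel (lam x η : ℝ) : ℝ := flowVel lam (label lam x η) η

/-- The spatial derivative of `baseVel`. -/
def baseSlope (lam x η : ℝ) : ℝ := flowSlope lam (label lam x η) η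

/-- The second spatial derivative of `baseVel`. -/
def baseCurv (lam x η : ℝ) : ℝ :=
  datumCurv (label lam x η) / (1 - lam * (η * datumSlope (label lam x η))) ^ 2
    / jacobian lam (label lam x η) η

theorem hasDerivAt_baseVel (h : η ∈ weightDomain lam) (x : ℝ) :
    HasDerivAt (fun x => baseVel lam x η) (baseSlope lam x η) x := by
  have h0 := (jacobian_pos h (label lam x η)).ne'
  refine ((hasDerivAt_flowVel_left h _).comp x (hasDerivAt_label_left h x)).congr_deriv ?_
  rw [baseSlope]
  field_simp

theorem hasDerivAt_flowSlope_left (h : η ∈ weightDomain lam) (a : ℝ) :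
    HasDerivAt (fun a => flowSlope lam a η)
      (datumCurv a / (1 - lam * (η * datumSlope a)) ^ 2) a :=
  (hasDerivAt_labelSlope_left h a).sub_const _

theorem hasDerivAt_baseSlope (h : η ∈ weightDomain lam) (x : ℝ) :
    HasDerivAt (fun x => baseSlope lam x η) (baseCurv lam x η) x := by
  refine ((hasDerivAt_flowSlope_left h _).comp x (hasDerivAt_label_left h x)).congr_deriv ?_
  rw [baseCurv]
  ring

theorem continuousOn_comp_label {g : ℝ → ℝ → ℝ}
    (hg : ContinuousOn (fun p : ℝ × ℝ => g p.1 p.2) (univ ×ˢ weightDomain lam)) :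
    ContinuousOn (fun p : ℝ × ℝ => g (label lam p.1 p.2) p.2) (univ ×ˢ weightDomain lam) :=
  hg.comp (f := fun p : ℝ × ℝ => (label lam p.1 p.2, p.2))
    ((continuousOn_label lam).prodMk continuousOn_snd) fun _ hp => ⟨mem_univ _, hp.2⟩

theorem continuousOn_flowCurv (lam : ℝ) :
    ContinuousOn (fun p : ℝ × ℝ => datumCurv p.1 / (1 - lam * (p.2 * datumSlope p.1)) ^ 2)
      (univ ×ˢ weightDomain lam) :=
  ContinuousOn.div (by fun_prop) (by fun_prop) fun p hp => (pow_pos (den_pos hp.2 p.1) 2).ne'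

theorem continuousOn_baseVel (lam : ℝ) :
    ContinuousOn (fun p : ℝ × ℝ => baseVel lam p.1 p.2) (univ ×ˢ weightDomain lam) :=
  continuousOn_comp_label (continuousOn_flowVel lam)

theorem continuousOn_baseSlope (lam : ℝ) :
    ContinuousOn (fun p : ℝ × ℝ => baseSlope lam p.1 p.2) (univ ×ˢ weightDomain lam) :=
  continuousOn_comp_label (continuousOn_flowSlope lam)

theorem continuousOn_baseCurv (lam : ℝ) :
    ContinuousOn (fun p : ℝ × ℝ => baseCurv lam p.1 p.2) (univ ×ˢ weightDomain lam) :=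
  continuousOn_comp_label (g := fun a η => datumCurv a / (1 - lam * (η * datumSlope a)) ^ 2
    / jacobian lam a η) ((continuousOn_flowCurv lam).div (continuousOn_jacobian lam)
      fun p hp => (jacobian_pos hp.2 p.1).ne')

theorem baseVel_periodic (h : η ∈ weightDomain lam) :
    Function.Periodic (fun x => baseVel lam x η) 1 := fun x => by
  simp only [baseVel, label_add_one h, flowVel_add_one h]

theorem baseVel_neg (h : η ∈ weightDomain lam) (x : ℝ) :
    baseVel lam (-x) η = -baseVel lam x η := by
  rw [baseVel, label_neg h, flowVel_neg, baseVel]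

theorem baseVel_zero_right (lam x : ℝ) : baseVel lam x 0 = datum x := by
  rw [baseVel, label_zero_right, flowVel_zero_right]

/-- Periodicity moves the integral to the symmetric interval from -1/2 to 1/2, where an odd function
integrates to zero. -/
theorem integral_baseVel (h : η ∈ weightDomain lam) :
    ∫ x in (0 : ℝ)..1, baseVel lam x η = 0 := by
  have h1 := (baseVel_periodic h).intervalIntegral_add_eq (-(1 / 2)) 0
  rw [show (0 : ℝ) + 1 = 1 by norm_num, show -(1 / 2 : ℝ) + 1 = 1 / 2 by norm_num] at h1
  have h2 := intervalIntegral.integral_comp_neg (a := -(1 / 2)) (b := 1 / 2)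
    fun x => baseVel lam x η
  simp only [baseVel_neg h, neg_neg, intervalIntegral.integral_neg] at h2
  linarith

theorem integral_baseSlope_sq (h : η ∈ weightDomain lam) :
    ∫ x in (0 : ℝ)..1, baseSlope lam x η ^ 2 =
      meanWeight₂ lam η / meanWeight lam η - (meanWeight₁ lam η / meanWeight lam η) ^ 2 := by
  rw [← integral_flowSlope_sq_mul_jacobian h]
  have h1 := intervalIntegral.integral_comp_mul_deriv (a := 0) (b := 1)
    (f := fun a => flowMap lam a η) (f' := fun a => jacobian lam a η)
    (g := fun x => baseSlope lam x η ^ 2) (fun a _ => hasDerivAt_flowMap_left h a)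
    (continuous_jacobian_left h).continuousOn
    (((continuousOn_baseSlope lam).comp_continuous (f := fun x => (x, η)) (by fun_prop)
      fun _ => ⟨mem_univ _, h⟩).pow 2)
  have h2 := flowMap_add_one h 0
  rw [zero_add, flowMap_zero_left, zero_add] at h2
  rw [h2, flowMap_zero_left] at h1
  rw [← h1]
  refine intervalIntegral.integral_congr fun a _ => ?_
  simp only [Function.comp, baseSlope, label_flowMap h]

/-- The label at a fixed position moves, which produces the convective term. The Riccati equation
for `labelSlope`, rewritten for the centred slope, leaves a linear term with coefficient `2 * lam *
(meanWeight₁ / meanWeight)`; the time change is designed to cancel it. -/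
theorem hasDerivAt_baseSlope_right (h : η ∈ weightDomain lam) (x : ℝ) :
    HasDerivAt (fun η => baseSlope lam x η)
      (lam * baseSlope lam x η ^ 2
        + 2 * lam * (meanWeight₁ lam η / meanWeight lam η) * baseSlope lam x η
        - (1 + lam) * (meanWeight₂ lam η / meanWeight lam η
          - (meanWeight₁ lam η / meanWeight lam η) ^ 2)
        - baseVel lam x η * baseCurv lam x η) η := by
  have hn : univ ×ˢ weightDomain lam ∈ 𝓝 (label lam x η, η) :=
    (isOpen_univ_prod_weightDomain lam).mem_nhds ⟨mem_univ _, h⟩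
  have h1 := hasDerivAt_comp_curve (F := labelSlope lam) (hasDerivAt_label_right h x)
    (Fx := fun a η => datumCurv a / (1 - lam * (η * datumSlope a)) ^ 2)
    (by filter_upwards [hn] with p hp using hasDerivAt_labelSlope_left hp.2 _)
    ((continuousOn_flowCurv lam).continuousAt hn) (hasDerivAt_labelSlope h _)
  have h0 := (meanWeight_pos h).ne'
  have hj := (jacobian_pos h (label lam x η)).ne'
  have hd := (den_pos h (label lam x η)).ne'
  refine (h1.sub ((hasDerivAt_meanWeight₁ h).div (hasDerivAt_meanWeight h) h0)).congr_deriv ?_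
  have hb : labelSlope lam (label lam x η) η =
      baseSlope lam x η + meanWeight₁ lam η / meanWeight lam η := by
    rw [baseSlope, flowSlope]
    ring
  rw [hb, baseVel, baseCurv]
  field_simp
  ring

/-- The solution obtained from the time change `θ`. -/
def solution (lam : ℝ) (θ : ℝ → ℝ) (x t : ℝ) : ℝ :=
  meanWeight lam (θ t) ^ (-(2 * lam)) * baseVel lam x (θ t)

variable {θ : ℝ → ℝ} {t : ℝ}

theorem ux_solution (h : θ t ∈ weightDomain lam) (x : ℝ) :
    ux (solution lam θ) x t = meanWeight lam (θ t) ^ (-(2 * lam)) * baseSlope lam x (θ t) :=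
  ((hasDerivAt_baseVel h x).const_mul _).deriv

theorem uxx_solution (h : θ t ∈ weightDomain lam) (x : ℝ) :
    uxx (solution lam θ) x t = meanWeight lam (θ t) ^ (-(2 * lam)) * baseCurv lam x (θ t) := by
  have : (fun y => ux (solution lam θ) y t) =
      fun y => meanWeight lam (θ t) ^ (-(2 * lam)) * baseSlope lam y (θ t) :=
    funext fun y => ux_solution h y
  rw [uxx, this]
  exact ((hasDerivAt_baseSlope h x).const_mul _).deriv

theorem isClassicalSolution_solution {J : Set ℝ} (hJ : IsTimeInterval J)
    (hθ : ∀ t ∈ J, θ t ∈ weightDomain lam) (hθ0 : θ 0 = 0) (hθc : ContinuousOn θ J)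
    (hθd : ∀ t ∈ J, 0 < t → HasDerivAt θ (meanWeight lam (θ t) ^ (-(2 * lam))) t) :
    IsClassicalSolution lam datum J (solution lam θ) ∧ HasZeroMean J (solution lam θ) := by
  have hmap : MapsTo (fun p : ℝ × ℝ => (p.1, θ p.2)) (univ ×ˢ J) (univ ×ˢ weightDomain lam) :=
    fun p hp => ⟨mem_univ _, hθ _ hp.2⟩
  have hθc' : ContinuousOn (fun p : ℝ × ℝ => θ p.2) (univ ×ˢ J) :=
    hθc.comp continuousOn_snd fun _ hp => hp.2
  have hcm : ContinuousOn (fun p : ℝ × ℝ => (p.1, θ p.2)) (univ ×ˢ J) :=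
    continuousOn_fst.prodMk hθc'
  have hρ : ContinuousOn (fun p : ℝ × ℝ => meanWeight lam (θ p.2) ^ (-(2 * lam)))
      (univ ×ˢ J) :=
    ContinuousOn.rpow_const ((continuousOn_meanWeight lam).comp hθc' fun p hp => hθ _ hp.2)
      fun p hp => Or.inl (meanWeight_pos (hθ _ hp.2)).ne'
  have hux : ∀ t ∈ J, (fun y => ux (solution lam θ) y t) =
      fun y => meanWeight lam (θ t) ^ (-(2 * lam)) * baseSlope lam y (θ t) :=
    fun t ht => funext fun y => ux_solution (hθ t ht) y
  have hc : ∀ {g : ℝ → ℝ → ℝ},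
      ContinuousOn (fun p : ℝ × ℝ => g p.1 p.2) (univ ×ˢ weightDomain lam) →
      ContinuousOn (fun p : ℝ × ℝ => meanWeight lam (θ p.2) ^ (-(2 * lam)) * g p.1 (θ p.2))
        (univ ×ˢ J) := fun {g} hg =>
    hρ.mul (ContinuousOn.comp (g := fun p : ℝ × ℝ => g p.1 p.2) hg hcm hmap)
  refine ⟨⟨fun t ht x => ?_, fun t ht => ?_, ?_, ?_, ?_, fun x => ?_, fun t ht h0 x => ?_⟩,
    fun t ht => ?_⟩
  · simp only [solution, baseVel_periodic (hθ t ht) x]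
  · rw [show (2 : WithTop ℕ∞) = 1 + 1 by norm_num, contDiff_succ_iff_deriv]
    refine ⟨fun x => ((hasDerivAt_baseVel (hθ t ht) x).const_mul _).differentiableAt, by simp, ?_⟩
    have : deriv (fun x => solution lam θ x t) =
        fun y => meanWeight lam (θ t) ^ (-(2 * lam)) * baseSlope lam y (θ t) := hux t ht
    rw [this, contDiff_one_iff_deriv]
    refine ⟨fun x => ((hasDerivAt_baseSlope (hθ t ht) x).const_mul _).differentiableAt, ?_⟩
    have : deriv (fun y => meanWeight lam (θ t) ^ (-(2 * lam)) * baseSlope lam y (θ t)) =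
        fun y => meanWeight lam (θ t) ^ (-(2 * lam)) * baseCurv lam y (θ t) :=
      funext fun x => ((hasDerivAt_baseSlope (hθ t ht) x).const_mul _).deriv
    rw [this]
    exact continuous_const.mul ((continuousOn_baseCurv lam).comp_continuous
      (f := fun x => (x, θ t)) (by fun_prop) fun _ => ⟨mem_univ _, hθ t ht⟩)
  · exact hc (continuousOn_baseVel lam)
  · exact (hc (continuousOn_baseSlope lam)).congr fun p hp => ux_solution (hθ p.2 hp.2) p.1
  · exact (hc (continuousOn_baseCurv lam)).congr fun p hp => uxx_solution (hθ p.2 hp.2) p.1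
  · rw [solution, hθ0, meanWeight_zero, Real.one_rpow, one_mul, baseVel_zero_right]
  · have hd := hθ t ht
    have hP := meanWeight_pos hd
    have hθt := hθd t ht h0
    set ρ := meanWeight lam (θ t) ^ (-(2 * lam)) with hρt
    -- The derivative of the amplitude factor supplies exactly the opposite of the linear term in
    -- `hasDerivAt_baseSlope_right`; the remaining terms all carry `ρ ^ 2`, as the quadratic
    -- equation demands.
    have hm : HasDerivAt (fun s => meanWeight lam (θ s) ^ (-(2 * lam)))
        (meanWeight₁ lam (θ t) * ρ * -(2 * lam) * (ρ / meanWeight lam (θ t))) t :=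
      (((hasDerivAt_meanWeight hd).comp t hθt).rpow_const (Or.inl hP.ne')).congr_deriv
        (by rw [Function.comp_apply, Real.rpow_sub_one hP.ne'])
    have hs : HasDerivAt (fun s => baseSlope lam x (θ s)) _ t :=
      (hasDerivAt_baseSlope_right hd x).comp t hθt
    refine ((hm.mul hs).congr_of_eventuallyEq ?_).congr_deriv ?_
    · filter_upwards [hJ.mem_nhds ht h0] with s hs using ux_solution (hθ s hs) x
    · rw [nonlocalTerm, ux_solution hd, uxx_solution hd, solution]
      simp only [ux_solution hd, mul_pow]
      rw [intervalIntegral.integral_const_mul, integral_baseSlope_sq hd, ← hρt]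
      clear_value ρ
      field_simp
      ring
  · simp only [solution]
    rw [intervalIntegral.integral_const_mul, integral_baseVel (hθ t ht), mul_zero]

end FlowMap


/-! ### Characteristics of an arbitrary solution and their dependence on the label -/

section Characteristics

/-- A single characteristic curve of `u` on `J`. -/
def IsCharacteristic (J : Set ℝ) (u : ℝ → ℝ → ℝ) (c : ℝ → ℝ) : Prop :=
  ∀ t ∈ J, HasDerivWithinAt c (u (c t) t) (Ici 0) t

namespace IsCharacteristic

variable {J : Set ℝ} {u : ℝ → ℝ → ℝ} {c : ℝ → ℝ}

theorem continuousOn (hJ : IsTimeInterval J) (hc : IsCharacteristic J u c) : ContinuousOn c J :=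
  fun t ht => (hc t ht).continuousWithinAt.mono fun _ hs => hJ.nonneg hs

theorem hasDerivAt (hc : IsCharacteristic J u c) {t : ℝ} (ht : t ∈ J) (h0 : 0 < t) :
    HasDerivAt c (u (c t) t) t := (hc t ht).hasDerivAt (Ici_mem_nhds h0)

theorem hasDerivWithinAt_Ici (hJ : IsTimeInterval J) (hc : IsCharacteristic J u c) {t : ℝ}
    (ht : t ∈ J) : HasDerivWithinAt c (u (c t) t) (Ici t) t :=
  (hc t ht).mono (Ici_subset_Ici.2 (hJ.nonneg ht))

end IsCharacteristic

namespace IsClassicalSolution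

variable {lam : ℝ} {u₀ : ℝ → ℝ} {J : Set ℝ} {u : ℝ → ℝ → ℝ}

theorem hasDerivAt_ux (hu : IsClassicalSolution lam u₀ J u) {t : ℝ} (ht : t ∈ J) (x : ℝ) :
    HasDerivAt (fun y => u y t) (ux u x t) x :=
  ((hu.contDiff t ht).differentiable (by norm_num) x).hasDerivAt

theorem hasDerivAt_uxx (hu : IsClassicalSolution lam u₀ J u) {t : ℝ} (ht : t ∈ J) (x : ℝ) :
    HasDerivAt (fun y => ux u y t) (uxx u x t) x := by
  have h := hu.contDiff t ht
  rw [show (2 : WithTop ℕ∞) = 1 + 1 by norm_num, contDiff_succ_iff_deriv] at h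
  exact (h.2.2.differentiable (by norm_num) x).hasDerivAt

theorem periodic_deriv {g : ℝ → ℝ} (hg : Function.Periodic g 1) :
    Function.Periodic (deriv g) 1 := fun x => by
  rw [← deriv_comp_add_const, hg.funext]

theorem periodic_ux (hu : IsClassicalSolution lam u₀ J u) {t : ℝ} (ht : t ∈ J) :
    Function.Periodic (fun x => ux u x t) 1 := periodic_deriv (hu.periodic t ht)

theorem periodic_uxx (hu : IsClassicalSolution lam u₀ J u) {t : ℝ} (ht : t ∈ J) :
    Function.Periodic (fun x => uxx u x t) 1 := periodic_deriv (hu.periodic_ux ht)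

theorem exists_bound_of_periodic (hJ : IsTimeInterval J) {g : ℝ → ℝ → ℝ}
    (hg : ContinuousOn (fun p : ℝ × ℝ => g p.1 p.2) (univ ×ˢ J))
    (hp : ∀ t ∈ J, Function.Periodic (fun x => g x t) 1) {τ : ℝ} (hτ : τ ∈ J) :
    ∃ C, 0 ≤ C ∧ ∀ x, ∀ t ∈ Icc 0 τ, |g x t| ≤ C := by
  obtain ⟨C, hC⟩ := (isCompact_Icc (a := (0 : ℝ)) (b := 1)).prod (isCompact_Icc (a := 0) (b := τ))
    |>.exists_bound_of_continuousOn (hg.mono (prod_mono (subset_univ _) (hJ.Icc_subset hτ)))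
  refine ⟨|C|, abs_nonneg _, fun x t ht => ?_⟩
  obtain ⟨y, hy, hxy⟩ := (hp t (hJ.Icc_subset hτ ht)).exists_mem_Ico₀ one_pos x
  rw [hxy]
  exact (hC (y, t) ⟨Ico_subset_Icc_self hy, ht⟩).trans (le_abs_self C)

theorem exists_bound_u (hJ : IsTimeInterval J) (hu : IsClassicalSolution lam u₀ J u) {τ : ℝ}
    (hτ : τ ∈ J) : ∃ C, 0 ≤ C ∧ ∀ x, ∀ t ∈ Icc 0 τ, |u x t| ≤ C :=
  exists_bound_of_periodic hJ hu.continuousOn hu.periodic hτ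

theorem exists_bound_ux (hJ : IsTimeInterval J) (hu : IsClassicalSolution lam u₀ J u) {τ : ℝ}
    (hτ : τ ∈ J) : ∃ C, 0 ≤ C ∧ ∀ x, ∀ t ∈ Icc 0 τ, |ux u x t| ≤ C :=
  exists_bound_of_periodic hJ hu.continuousOn_ux (fun _ ht => hu.periodic_ux ht) hτ

theorem exists_bound_uxx (hJ : IsTimeInterval J) (hu : IsClassicalSolution lam u₀ J u) {τ : ℝ}
    (hτ : τ ∈ J) : ∃ C, 0 ≤ C ∧ ∀ x, ∀ t ∈ Icc 0 τ, |uxx u x t| ≤ C :=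
  exists_bound_of_periodic hJ hu.continuousOn_uxx (fun _ ht => hu.periodic_uxx ht) hτ

theorem abs_sub_le_of_deriv_le {g g' : ℝ → ℝ} {C : ℝ} (hg : ∀ x, HasDerivAt g (g' x) x)
    (hC : ∀ x, |g' x| ≤ C) (x y : ℝ) : |g y - g x| ≤ C * |y - x| := by
  simpa using convex_univ.norm_image_sub_le_of_norm_hasDerivWithin_le (f := g) (f' := g')
    (fun x _ => (hg x).hasDerivWithinAt) (fun x _ => hC x) (mem_univ x) (mem_univ y)

theorem abs_sub_sub_le_of_deriv_le {g g' g'' : ℝ → ℝ} {C : ℝ} (hg : ∀ x, HasDerivAt g (g' x) x)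
    (hg' : ∀ x, HasDerivAt g' (g'' x) x) (hC : ∀ x, |g'' x| ≤ C) (x y : ℝ) :
    |g y - g x - g' x * (y - x)| ≤ C * |y - x| ^ 2 := by
  have hC0 : 0 ≤ C := (abs_nonneg _).trans (hC 0)
  have h := (convex_uIcc x y).norm_image_sub_le_of_norm_hasDerivWithin_le
    (f := fun z => g z - g' x * z) (f' := fun z => g' z - g' x) (C := C * |y - x|)
    (fun z _ => ((hg z).sub (by simpa using (hasDerivAt_id z).const_mul (g' x))).hasDerivWithinAt)
    (fun z hz => (abs_sub_le_of_deriv_le hg' hC x z).trans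
      (mul_le_mul_of_nonneg_left (abs_sub_left_of_mem_uIcc hz) hC0))
    left_mem_uIcc right_mem_uIcc
  simp only [Real.norm_eq_abs] at h
  calc _ = |g y - g' x * y - (g x - g' x * x)| := by congr 1; ring
    _ ≤ _ := h
    _ = _ := by ring

theorem exists_lipschitz (hJ : IsTimeInterval J) (hu : IsClassicalSolution lam u₀ J u) {τ : ℝ}
    (hτ : τ ∈ J) : ∃ K : NNReal, ∀ t ∈ Icc 0 τ, LipschitzWith K fun x => u x t := by
  obtain ⟨C, hC0, hC⟩ := hu.exists_bound_ux hJ hτ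
  refine ⟨⟨C, hC0⟩, fun t ht => LipschitzWith.of_dist_le_mul fun x y => ?_⟩
  exact abs_sub_le_of_deriv_le (hu.hasDerivAt_ux (hJ.Icc_subset hτ ht)) (fun x => hC x t ht) y x

/-- Gronwall's inequality; the constant depends on the horizon alone, so the estimate is uniform in
the labels. -/
theorem dist_characteristic_le (hJ : IsTimeInterval J) (hu : IsClassicalSolution lam u₀ J u)
    {τ : ℝ} (hτ : τ ∈ J) : ∃ L, 0 ≤ L ∧ ∀ c₁ c₂ : ℝ → ℝ, IsCharacteristic J u c₁ →
      IsCharacteristic J u c₂ → ∀ t ∈ Icc 0 τ, |c₁ t - c₂ t| ≤ L * |c₁ 0 - c₂ 0| := by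
  obtain ⟨K, hK⟩ := hu.exists_lipschitz hJ hτ
  refine ⟨Real.exp (K * τ), (Real.exp_pos _).le, fun c₁ c₂ h₁ h₂ t ht => ?_⟩
  have hs := hJ.Icc_subset hτ
  have := dist_le_of_trajectories_ODE_of_mem (v := fun t x => u x t) (s := fun _ => univ)
    (a := 0) (b := τ) (δ := |c₁ 0 - c₂ 0|)
    (fun t ht => (hK t (Ico_subset_Icc_self ht)).lipschitzOnWith)
    ((h₁.continuousOn hJ).mono hs)
    (fun t ht => h₁.hasDerivWithinAt_Ici hJ (hs (Ico_subset_Icc_self ht))) (fun _ _ => mem_univ _)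
    ((h₂.continuousOn hJ).mono hs)
    (fun t ht => h₂.hasDerivWithinAt_Ici hJ (hs (Ico_subset_Icc_self ht))) (fun _ _ => mem_univ _)
    le_rfl t ht
  rw [Real.dist_eq, mul_comm, sub_zero] at this
  refine this.trans ?_
  gcongr
  exact ht.2

theorem exists_local_characteristic (hJ : IsTimeInterval J)
    (hu : IsClassicalSolution lam u₀ J u) (α : ℝ) {τ : ℝ} (hτ : τ ∈ J) :
    ∃ c : ℝ → ℝ, c 0 = α ∧ ∀ t ∈ Icc 0 τ, HasDerivWithinAt c (u (c t) t) (Icc 0 τ) t := by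
  obtain ⟨K, hK⟩ := hu.exists_lipschitz hJ hτ
  obtain ⟨C, hC0, hC⟩ := hu.exists_bound_u hJ hτ
  have hτ0 := hJ.nonneg hτ
  -- By periodicity `u` is bounded by `C` on the whole strip, so the ball of radius `C * τ` cannot
  -- be left before time `τ` and one application covers the full interval.
  have : IsPicardLindelof (fun t x => u x t) (⟨0, le_rfl, hτ0⟩ : Icc 0 τ) α
      (⟨C * τ, by positivity⟩ : NNReal) 0 ⟨C, hC0⟩ K :=
    { lipschitzOnWith := fun t ht => (hK t ht).lipschitzOnWith
      continuousOn := fun x _ => hu.continuousOn.comp (f := fun t => (x, t)) (by fun_prop)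
        fun t ht => ⟨mem_univ _, hJ.Icc_subset hτ ht⟩
      norm_le := fun t ht x _ => hC x t ht
      mul_max_le := by
        simp only [sub_zero, sub_self, max_eq_left hτ0, NNReal.coe_zero]
        exact le_rfl }
  exact this.exists_eq_forall_mem_Icc_hasDerivWithinAt₀

theorem exists_characteristic (hJ : IsTimeInterval J) (hu : IsClassicalSolution lam u₀ J u)
    (α : ℝ) : ∃ c : ℝ → ℝ, c 0 = α ∧ IsCharacteristic J u c := by
  choose c hc0 hc using fun τ : J => hu.exists_local_characteristic hJ α τ.2
  have hagree : ∀ τ₁ τ₂ : J, τ₁ ≤ τ₂ → ∀ t ∈ Icc 0 τ₁.1, c τ₁ t = c τ₂ t := by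
    intro τ₁ τ₂ h
    obtain ⟨K, hK⟩ := hu.exists_lipschitz hJ τ₁.2
    have hsub : Icc 0 τ₁.1 ⊆ Icc 0 τ₂.1 := Icc_subset_Icc_right h
    refine ODE_solution_unique_of_mem_Icc_right (v := fun t x => u x t) (s := fun _ => univ)
      (fun t ht => (hK t (Ico_subset_Icc_self ht)).lipschitzOnWith)
      (fun t ht => (hc τ₁ t ht).continuousWithinAt)
      (fun t ht => (hc τ₁ t (Ico_subset_Icc_self ht)).mono_of_mem_nhdsWithin ?_)
      (fun _ _ => mem_univ _)
      (fun t ht => (hc τ₂ t (hsub ht)).continuousWithinAt.mono hsub)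
      (fun t ht => (hc τ₂ t (hsub (Ico_subset_Icc_self ht))).mono_of_mem_nhdsWithin ?_)
      (fun _ _ => mem_univ _) (by rw [hc0, hc0])
    · exact mem_of_superset (Icc_mem_nhdsGE ht.2) (Icc_subset_Icc_left ht.1)
    · exact mem_of_superset (Icc_mem_nhdsGE ht.2) (Icc_subset_Icc ht.1 h)
  have hagree' : ∀ τ₁ τ₂ : J, ∀ t ∈ Icc 0 τ₁.1, t ∈ Icc 0 τ₂.1 → c τ₁ t = c τ₂ t := by
    intro τ₁ τ₂ t h1 h2
    rcases le_total τ₁ τ₂ with h | h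
    exacts [hagree _ _ h t h1, (hagree _ _ h t h2).symm]
  classical
  -- The value at `t` comes from the local solution with horizon `t` itself; agreement of the local
  -- solutions makes any longer horizon equivalent.
  let d : ℝ → ℝ := fun t => if h : t ∈ J then c ⟨t, h⟩ t else 0
  have hd : ∀ τ : J, ∀ t ∈ Icc 0 τ.1, d t = c τ t := fun τ t ht => by
    have htJ := hJ.Icc_subset τ.2 ht
    simp only [d, htJ, dif_pos]
    exact hagree' ⟨t, htJ⟩ τ t ⟨ht.1, le_rfl⟩ ht
  refine ⟨d, ?_, fun t ht => ?_⟩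
  · rw [hd ⟨0, hJ.zero_mem⟩ 0 ⟨le_rfl, le_rfl⟩, hc0]
  · obtain ⟨τ, hτ, hlt⟩ := hJ.exists_gt ht
    have htm : t ∈ Icc 0 τ := ⟨hJ.nonneg ht, hlt.le⟩
    have h1 := (hc ⟨τ, hτ⟩ t htm).congr (fun s hs => hd ⟨τ, hτ⟩ s hs) (hd ⟨τ, hτ⟩ t htm)
    rw [← hd ⟨τ, hτ⟩ t htm] at h1
    refine h1.mono_of_mem_nhdsWithin ?_
    exact mem_nhdsWithin.2 ⟨Iio τ, isOpen_Iio, hlt, fun s hs => ⟨hs.2, le_of_lt hs.1⟩⟩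

theorem exists_characteristicFlow (hJ : IsTimeInterval J)
    (hu : IsClassicalSolution lam u₀ J u) : ∃ γ, IsCharacteristicFlow J u γ := by
  choose γ h0 h using hu.exists_characteristic hJ
  exact ⟨γ, fun α _ => ⟨h0 α, h α⟩⟩

theorem characteristic_add_one (hJ : IsTimeInterval J) (hu : IsClassicalSolution lam u₀ J u)
    {c₁ c₂ : ℝ → ℝ} (h₁ : IsCharacteristic J u c₁) (h₂ : IsCharacteristic J u c₂)
    (h : c₂ 0 = c₁ 0 + 1) {t : ℝ} (ht : t ∈ J) : c₂ t = c₁ t + 1 := by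
  obtain ⟨L, -, hL⟩ := hu.dist_characteristic_le hJ ht
  have h₃ : IsCharacteristic J u fun t => c₁ t + 1 := fun s hs => by
    have hp : u (c₁ s + 1) s = u (c₁ s) s := hu.periodic s hs (c₁ s)
    rw [hp]
    exact (h₁ s hs).add_const 1
  have := hL _ _ h₂ h₃ t ⟨hJ.nonneg ht, le_rfl⟩
  rw [h, sub_self, abs_zero, mul_zero] at this
  exact sub_eq_zero.1 (abs_nonpos_iff.1 this)

theorem continuousOn_ux_characteristic (hJ : IsTimeInterval J)
    (hu : IsClassicalSolution lam u₀ J u) {c : ℝ → ℝ} (hc : IsCharacteristic J u c) :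
    ContinuousOn (fun t => ux u (c t) t) J :=
  hu.continuousOn_ux.comp (f := fun t => (c t, t)) ((hc.continuousOn hJ).prodMk continuousOn_id)
    fun _ ht => ⟨mem_univ _, ht⟩

/-- The convective term cancels the transport of `u_x`, leaving the Riccati equation. Joint
differentiability of `u_x` is not needed: the chain rule along the curve uses a continuous `u_xx`
and the mere existence of `u_xt`. -/
theorem hasDerivAt_ux_characteristic (hJ : IsTimeInterval J)
    (hu : IsClassicalSolution lam u₀ J u) {c : ℝ → ℝ} (hc : IsCharacteristic J u c) {t : ℝ}
    (ht : t ∈ J) (h0 : 0 < t) :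
    HasDerivAt (fun t => ux u (c t) t) (lam * ux u (c t) t ^ 2 + nonlocalTerm lam u t) t := by
  have hn : univ ×ˢ J ∈ 𝓝 (c t, t) := prod_mem_nhds univ_mem (hJ.mem_nhds ht h0)
  refine (hasDerivAt_comp_curve (F := ux u) (Fx := uxx u) (hc.hasDerivAt ht h0) ?_
    (hu.continuousOn_uxx.continuousAt hn) (hu.equation t ht h0 (c t))).congr_deriv (by ring)
  filter_upwards [hn] with p hp using hu.hasDerivAt_uxx hp.2 p.1

/-- The logarithm of the Jacobian along a characteristic. -/
def logJacobian (u : ℝ → ℝ → ℝ) (c : ℝ → ℝ) (t : ℝ) : ℝ := ∫ s in (0 : ℝ)..t, ux u (c s) s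

theorem hasDerivAt_logJacobian (hJ : IsTimeInterval J)
    (hu : IsClassicalSolution lam u₀ J u) {c : ℝ → ℝ} (hc : IsCharacteristic J u c) {t : ℝ}
    (ht : t ∈ J) (h0 : 0 < t) : HasDerivAt (logJacobian u c) (ux u (c t) t) t :=
  hJ.hasDerivAt_primitive (hu.continuousOn_ux_characteristic hJ hc) ht h0

theorem continuousOn_logJacobian (hJ : IsTimeInterval J)
    (hu : IsClassicalSolution lam u₀ J u) {c : ℝ → ℝ} (hc : IsCharacteristic J u c) :
    ContinuousOn (logJacobian u c) J :=
  hJ.continuousOn_primitive (hu.continuousOn_ux_characteristic hJ hc)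

theorem logJacobian_zero (u : ℝ → ℝ → ℝ) (c : ℝ → ℝ) : logJacobian u c 0 = 0 := by
  simp [logJacobian]

theorem exists_abs_logJacobian_le (hJ : IsTimeInterval J)
    (hu : IsClassicalSolution lam u₀ J u) {τ : ℝ} (hτ : τ ∈ J) :
    ∃ C, 0 ≤ C ∧ ∀ c, IsCharacteristic J u c → ∀ t ∈ Icc 0 τ, |logJacobian u c t| ≤ C := by
  obtain ⟨K, hK0, hK⟩ := hu.exists_bound_ux hJ hτ
  refine ⟨K * τ, mul_nonneg hK0 (hJ.nonneg hτ), fun c _ t ht => ?_⟩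
  have := intervalIntegral.norm_integral_le_of_norm_le_const (a := 0) (b := t) (C := K)
    (f := fun s => ux u (c s) s) fun s hs => by
      rw [uIoc_of_le ht.1] at hs
      exact hK _ s ⟨hs.1.le, hs.2.trans ht.2⟩
  rw [sub_zero, abs_of_nonneg ht.1] at this
  exact this.trans (mul_le_mul_of_nonneg_left ht.2 hK0)

theorem exists_abs_logJacobian_sub_le (hJ : IsTimeInterval J)
    (hu : IsClassicalSolution lam u₀ J u) {τ : ℝ} (hτ : τ ∈ J) :
    ∃ C, 0 ≤ C ∧ ∀ c₁ c₂, IsCharacteristic J u c₁ → IsCharacteristic J u c₂ →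
      |logJacobian u c₁ τ - logJacobian u c₂ τ| ≤ C * |c₁ 0 - c₂ 0| := by
  obtain ⟨K, hK0, hK⟩ := hu.exists_bound_uxx hJ hτ
  obtain ⟨L, hL0, hL⟩ := hu.dist_characteristic_le hJ hτ
  have hτ0 := hJ.nonneg hτ
  refine ⟨K * L * τ, by positivity, fun c₁ c₂ h₁ h₂ => ?_⟩
  rw [logJacobian, logJacobian, ← intervalIntegral.integral_sub
    (hJ.intervalIntegrable (hu.continuousOn_ux_characteristic hJ h₁) hτ)
    (hJ.intervalIntegrable (hu.continuousOn_ux_characteristic hJ h₂) hτ)]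
  have := intervalIntegral.norm_integral_le_of_norm_le_const (a := 0) (b := τ)
    (C := K * (L * |c₁ 0 - c₂ 0|)) (f := fun s => ux u (c₁ s) s - ux u (c₂ s) s) fun s hs => by
      rw [uIoc_of_le hτ0] at hs
      have hs' : s ∈ Icc 0 τ := ⟨hs.1.le, hs.2⟩
      exact (abs_sub_le_of_deriv_le (hu.hasDerivAt_uxx (hJ.Icc_subset hτ hs'))
        (fun x => hK x s hs') _ _).trans (mul_le_mul_of_nonneg_left (hL _ _ h₁ h₂ s hs') hK0)
  rw [sub_zero, abs_of_nonneg hτ0] at this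
  exact this.trans_eq (by ring)

/-- Second order estimate for the dependence of the flow on the label. -/
theorem exists_abs_flow_sub_le (hJ : IsTimeInterval J)
    (hu : IsClassicalSolution lam u₀ J u) {τ : ℝ} (hτ : τ ∈ J) :
    ∃ C, 0 ≤ C ∧ ∀ c₁ c₂, IsCharacteristic J u c₁ → IsCharacteristic J u c₂ →
      |c₂ τ - c₁ τ - Real.exp (logJacobian u c₁ τ) * (c₂ 0 - c₁ 0)| ≤ C * |c₂ 0 - c₁ 0| ^ 2 := by
  obtain ⟨K, hK0, hK⟩ := hu.exists_bound_uxx hJ hτ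
  obtain ⟨L, hL0, hL⟩ := hu.dist_characteristic_le hJ hτ
  obtain ⟨B, hB0, hB⟩ := hu.exists_abs_logJacobian_le hJ hτ
  have hτ0 := hJ.nonneg hτ
  refine ⟨Real.exp B * (Real.exp B * (K * L ^ 2) * τ), by positivity, fun c₁ c₂ h₁ h₂ => ?_⟩
  set D := |c₂ 0 - c₁ 0| with hD
  -- The separation divided by the linearized flow has as time derivative a second order Taylor
  -- remainder of `u`, hence is constant up to a quadratic error.
  have main : |(c₂ τ - c₁ τ) * Real.exp (-logJacobian u c₁ τ) - (c₂ 0 - c₁ 0)| ≤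
      Real.exp B * (K * L ^ 2) * τ * D ^ 2 := by
    rcases hτ0.eq_or_lt with h0 | h0
    · rw [← h0, logJacobian_zero]
      simp
    have hsub := hJ.Icc_subset hτ
    obtain ⟨ξ, hξ, hξ'⟩ := exists_hasDerivAt_eq_slope
      (fun t => (c₂ t - c₁ t) * Real.exp (-logJacobian u c₁ t))
      (fun t => (u (c₂ t) t - u (c₁ t) t) * Real.exp (-logJacobian u c₁ t)
        + (c₂ t - c₁ t) * (Real.exp (-logJacobian u c₁ t) * -ux u (c₁ t) t)) h0
      ((((h₂.continuousOn hJ).sub (h₁.continuousOn hJ)).mul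
        (Real.continuous_exp.comp_continuousOn
          (hu.continuousOn_logJacobian hJ h₁).neg)).mono hsub)
      (fun t ht => by
        have htJ := hsub (Ioo_subset_Icc_self ht)
        exact ((h₂.hasDerivAt htJ ht.1).sub (h₁.hasDerivAt htJ ht.1)).mul
          (hu.hasDerivAt_logJacobian hJ h₁ htJ ht.1).neg.exp)
    have hξI := Ioo_subset_Icc_self hξ
    rw [logJacobian_zero, neg_zero, Real.exp_zero, mul_one, sub_zero, eq_div_iff h0.ne'] at hξ'
    rw [← hξ', abs_mul, abs_of_pos h0, mul_right_comm _ τ]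
    gcongr
    calc _ = |u (c₂ ξ) ξ - u (c₁ ξ) ξ - ux u (c₁ ξ) ξ * (c₂ ξ - c₁ ξ)|
          * Real.exp (-logJacobian u c₁ ξ) := by
          rw [← abs_of_pos (Real.exp_pos (-logJacobian u c₁ ξ)), ← abs_mul,
            abs_of_pos (Real.exp_pos (-logJacobian u c₁ ξ))]
          congr 1
          ring
      _ ≤ (K * |c₂ ξ - c₁ ξ| ^ 2) * Real.exp B := by
          gcongr
          · exact abs_sub_sub_le_of_deriv_le (hu.hasDerivAt_ux (hsub hξI))
              (hu.hasDerivAt_uxx (hsub hξI)) (fun x => hK x ξ hξI) _ _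
          · linarith [neg_abs_le (logJacobian u c₁ ξ), hB c₁ h₁ ξ hξI]
      _ ≤ (K * (L * D) ^ 2) * Real.exp B := by
          gcongr
          exact hL _ _ h₂ h₁ ξ hξI
      _ = _ := by ring
  calc _ = Real.exp (logJacobian u c₁ τ)
        * |(c₂ τ - c₁ τ) * Real.exp (-logJacobian u c₁ τ) - (c₂ 0 - c₁ 0)| := by
        rw [← abs_of_pos (Real.exp_pos (logJacobian u c₁ τ)), ← abs_mul,
          abs_of_pos (Real.exp_pos (logJacobian u c₁ τ)), Real.exp_neg]
        congr 1
        field_simp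
    _ ≤ Real.exp B * (Real.exp B * (K * L ^ 2) * τ * D ^ 2) := by
        gcongr
        exact (le_abs_self _).trans (hB c₁ h₁ τ ⟨hτ0, le_rfl⟩)
    _ = _ := by ring

variable {γ : ℝ → ℝ → ℝ}

theorem _root_.ProudmanJohnson.IsCharacteristicFlow.isCharacteristic
    (hγ : IsCharacteristicFlow J u γ) {α : ℝ} (hα : α ∈ Icc (0 : ℝ) 1) :
    IsCharacteristic J u (γ α) := (hγ α hα).2

theorem hasDerivWithinAt_flow (hJ : IsTimeInterval J) (hu : IsClassicalSolution lam u₀ J u)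
    (hγ : IsCharacteristicFlow J u γ) {t : ℝ} (ht : t ∈ J) {α : ℝ} (hα : α ∈ Icc (0 : ℝ) 1) :
    HasDerivWithinAt (fun α => γ α t) (Real.exp (logJacobian u (γ α) t)) (Icc 0 1) α := by
  obtain ⟨C, hC0, hC⟩ := hu.exists_abs_flow_sub_le hJ ht
  rw [hasDerivWithinAt_iff_isLittleO]
  have h1 : (fun β => γ β t - γ α t - (β - α) • Real.exp (logJacobian u (γ α) t)) =O[𝓝[Icc 0 1] α]
      fun β => |β - α| ^ 2 := by
    refine Asymptotics.IsBigO.of_bound C ?_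
    filter_upwards [self_mem_nhdsWithin] with β hβ
    have := hC _ _ (hγ.isCharacteristic hα) (hγ.isCharacteristic hβ)
    rw [(hγ α hα).1, (hγ β hβ).1] at this
    simpa [mul_comm] using this
  refine h1.trans_isLittleO ?_
  have h2 : (fun β : ℝ => |β - α| ^ 2) =o[𝓝 α] fun β => β - α := by
    have h3 : (fun x : ℝ => x ^ 2) =o[𝓝 0] fun x => x := by
      simpa using Asymptotics.isLittleO_pow_pow (𝕜 := ℝ) (show 1 < 2 by norm_num)
    have h4 : Tendsto (fun β : ℝ => β - α) (𝓝 α) (𝓝 0) := by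
      have : Continuous fun β : ℝ => β - α := by fun_prop
      simpa using this.tendsto α
    simpa [Function.comp_def, sq_abs] using h3.comp_tendsto h4
  exact h2.mono nhdsWithin_le_nhds

theorem continuousOn_logJacobian_label (hJ : IsTimeInterval J)
    (hu : IsClassicalSolution lam u₀ J u) (hγ : IsCharacteristicFlow J u γ) {t : ℝ} (ht : t ∈ J) :
    ContinuousOn (fun α => logJacobian u (γ α) t) (Icc 0 1) := by
  obtain ⟨C, hC0, hC⟩ := hu.exists_abs_logJacobian_sub_le hJ ht
  refine (LipschitzOnWith.of_dist_le_mul (K := ⟨C, hC0⟩) fun α hα β hβ => ?_).continuousOn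
  have := hC _ _ (hγ.isCharacteristic hα) (hγ.isCharacteristic hβ)
  rwa [(hγ α hα).1, (hγ β hβ).1] at this

/-- With right endpoint 1 this yields the normalization of the Jacobian that determines the
remaining factor. -/
theorem flow_sub_eq_integral (hJ : IsTimeInterval J)
    (hu : IsClassicalSolution lam u₀ J u) (hγ : IsCharacteristicFlow J u γ) {t : ℝ} (ht : t ∈ J)
    {β : ℝ} (hβ : β ∈ Icc (0 : ℝ) 1) :
    ∫ α in (0 : ℝ)..β, Real.exp (logJacobian u (γ α) t) = γ β t - γ 0 t := by
  have hsub : Icc 0 β ⊆ Icc (0 : ℝ) 1 := Icc_subset_Icc_right hβ.2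
  refine intervalIntegral.integral_eq_sub_of_hasDerivAt_of_le hβ.1
    (f := fun α => γ α t)
    (fun α hα => (hu.hasDerivWithinAt_flow hJ hγ ht (hsub hα)).continuousWithinAt.mono hsub)
    (fun α hα => (hu.hasDerivWithinAt_flow hJ hγ ht
      (hsub (Ioo_subset_Icc_self hα))).hasDerivAt
        (Icc_mem_nhds hα.1 (hα.2.trans_le hβ.2))) ?_
  refine ContinuousOn.intervalIntegrable ?_
  rw [uIcc_of_le hβ.1]
  exact Real.continuous_exp.comp_continuousOn
    ((hu.continuousOn_logJacobian_label hJ hγ ht).mono hsub)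

end IsClassicalSolution

end Characteristics


/-! ### Representation formula for every solution issued from the datum -/

namespace IsClassicalSolution

variable {lam : ℝ} {J : Set ℝ} {u : ℝ → ℝ → ℝ} {γ : ℝ → ℝ → ℝ}

/-- The nonlocal term drops out of the difference d of two slopes: d' = lam (g₁ + g₂) d, a linear
equation integrated by the factor made of both Jacobians. -/
theorem slope_sub_eq {u₀ : ℝ → ℝ} (hJ : IsTimeInterval J) (hu : IsClassicalSolution lam u₀ J u)
    {c₁ c₂ : ℝ → ℝ} (h₁ : IsCharacteristic J u c₁) (h₂ : IsCharacteristic J u c₂) {t : ℝ}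
    (ht : t ∈ J) :
    ux u (c₂ t) t - ux u (c₁ t) t = (ux u (c₂ 0) 0 - ux u (c₁ 0) 0)
      * Real.exp (lam * (logJacobian u c₂ t + logJacobian u c₁ t)) := by
  have hG₁ := hu.continuousOn_logJacobian hJ h₁
  have hG₂ := hu.continuousOn_logJacobian hJ h₂
  have hg₁ := hu.continuousOn_ux_characteristic hJ h₁
  have hg₂ := hu.continuousOn_ux_characteristic hJ h₂
  have h := hJ.eq_of_hasDerivAt_zero
    (g := fun t => (ux u (c₂ t) t - ux u (c₁ t) t)
      * Real.exp (-(lam * (logJacobian u c₂ t + logJacobian u c₁ t))))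
    ((hg₂.sub hg₁).mul (Real.continuous_exp.comp_continuousOn
      (continuousOn_const.mul (hG₂.add hG₁)).neg))
    (fun t ht h0 => by
      refine (((hu.hasDerivAt_ux_characteristic hJ h₂ ht h0).sub
        (hu.hasDerivAt_ux_characteristic hJ h₁ ht h0)).mul
          (((hu.hasDerivAt_logJacobian hJ h₂ ht h0).add
            (hu.hasDerivAt_logJacobian hJ h₁ ht h0)).const_mul lam).neg.exp).congr_deriv ?_
      simp only [Pi.add_apply, Pi.sub_apply, Pi.neg_apply]
      ring) ht
  simp only [logJacobian_zero, add_zero, mul_zero, neg_zero, Real.exp_zero, mul_one] at h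
  rw [← h, mul_assoc, ← Real.exp_add, neg_add_cancel, Real.exp_zero, mul_one]

/-- The time change attached to a solution. -/
def timeChange (lam : ℝ) (u γ : ℝ → ℝ → ℝ) (t : ℝ) : ℝ :=
  ∫ s in (0 : ℝ)..t, Real.exp (2 * lam * logJacobian u (γ (1 / 4)) s)

theorem quarter_mem : (1 / 4 : ℝ) ∈ Icc (0 : ℝ) 1 := by constructor <;> norm_num

theorem half_mem : (1 / 2 : ℝ) ∈ Icc (0 : ℝ) 1 := by constructor <;> norm_num

variable (hJ : IsTimeInterval J) (hu : IsClassicalSolution lam datum J u)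
  (hγ : IsCharacteristicFlow J u γ)
include hJ hu hγ

omit hJ in
theorem ux_flow_zero {α : ℝ} (hα : α ∈ Icc (0 : ℝ) 1) : ux u (γ α 0) 0 = datumSlope α := by
  have : (fun y => u y 0) = datum := funext hu.initial
  rw [(hγ α hα).1, ux, this, deriv_datum]

theorem continuousOn_timeChange_integrand :
    ContinuousOn (fun t => Real.exp (2 * lam * logJacobian u (γ (1 / 4)) t)) J :=
  Real.continuous_exp.comp_continuousOn (continuousOn_const.mul
    (hu.continuousOn_logJacobian hJ (hγ.isCharacteristic quarter_mem)))

/-- The reference label 1/4 has initial slope 0, so by `slope_sub_eq` the left side has derivative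
`-lam * datumSlope α` times the integrand of `timeChange`. -/
theorem exp_logJacobian_sub {α t : ℝ} (hα : α ∈ Icc (0 : ℝ) 1) (ht : t ∈ J) :
    Real.exp (-(lam * (logJacobian u (γ α) t - logJacobian u (γ (1 / 4)) t))) =
      1 - lam * (timeChange lam u γ t * datumSlope α) := by
  have hc := continuousOn_timeChange_integrand hJ hu hγ
  have hq := hγ.isCharacteristic quarter_mem
  have ha := hγ.isCharacteristic hα
  have h := hJ.eq_of_hasDerivAt_zero
    (g := fun t => Real.exp (-(lam * (logJacobian u (γ α) t - logJacobian u (γ (1 / 4)) t)))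
      + lam * (timeChange lam u γ t * datumSlope α))
    ((Real.continuous_exp.comp_continuousOn (continuousOn_const.mul
        ((hu.continuousOn_logJacobian hJ ha).sub (hu.continuousOn_logJacobian hJ hq))).neg).add
      (continuousOn_const.mul ((hJ.continuousOn_primitive hc).mul continuousOn_const)))
    (fun t ht h0 => by
      have h1 := hu.slope_sub_eq hJ hq ha ht
      rw [ux_flow_zero hu hγ hα, ux_flow_zero hu hγ quarter_mem, datumSlope_quarter,
        sub_zero] at h1
      refine (((((hu.hasDerivAt_logJacobian hJ ha ht h0).sub
        (hu.hasDerivAt_logJacobian hJ hq ht h0)).const_mul lam).neg.exp).add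
        (((hJ.hasDerivAt_primitive hc ht h0).mul_const _).const_mul lam)).congr_deriv ?_
      have h2 : Real.exp (2 * lam * logJacobian u (γ (1 / 4)) t) =
          Real.exp (-(lam * (logJacobian u (γ α) t - logJacobian u (γ (1 / 4)) t)))
            * Real.exp (lam * (logJacobian u (γ α) t + logJacobian u (γ (1 / 4)) t)) := by
        rw [← Real.exp_add]
        congr 1
        ring
      simp only [Pi.sub_apply, Pi.neg_apply]
      rw [h1, h2]
      ring) ht
  simp only [logJacobian_zero, sub_zero, mul_zero, neg_zero, Real.exp_zero, timeChange,
    intervalIntegral.integral_same, zero_mul, add_zero] at h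
  rw [timeChange]
  exact eq_sub_of_add_eq h

/-- An exponential is positive; `exp_logJacobian_sub` at the labels 0 and 1/2, where the datum slope
is 1 and -1, gives both inequalities. -/
theorem timeChange_mem {t : ℝ} (ht : t ∈ J) : timeChange lam u γ t ∈ weightDomain lam := by
  have h1 := exp_logJacobian_sub hJ hu hγ (left_mem_Icc.2 zero_le_one) ht
  have h2 := exp_logJacobian_sub hJ hu hγ half_mem ht
  rw [datumSlope_zero] at h1
  rw [datumSlope_half] at h2
  have h3 := Real.exp_pos (-(lam * (logJacobian u (γ 0) t - logJacobian u (γ (1 / 4)) t)))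
  have h4 := Real.exp_pos (-(lam * (logJacobian u (γ (1 / 2)) t - logJacobian u (γ (1 / 4)) t)))
  rw [h1] at h3
  rw [h2] at h4
  change |lam * timeChange lam u γ t| < 1
  exact abs_lt.2 ⟨by linarith, by linarith⟩

theorem exp_logJacobian_eq_mul (h0 : lam ≠ 0) {α t : ℝ} (hα : α ∈ Icc (0 : ℝ) 1) (ht : t ∈ J) :
    Real.exp (logJacobian u (γ α) t) = Real.exp (logJacobian u (γ (1 / 4)) t)
      * labelWeight lam α (timeChange lam u γ t) := by
  rw [labelWeight, weight, if_neg h0, ← exp_logJacobian_sub hJ hu hγ hα ht, ← Real.exp_mul,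
    ← Real.exp_add]
  congr 1
  field_simp
  ring

/-- The characteristics with labels 0 and 1 stay one period apart, so the Jacobian has mean one and
the common factor must be the inverse mean of the weights. -/
theorem exp_logJacobian_quarter (h0 : lam ≠ 0) {t : ℝ} (ht : t ∈ J) :
    Real.exp (logJacobian u (γ (1 / 4)) t) = (meanWeight lam (timeChange lam u γ t))⁻¹ := by
  have h1 := hu.flow_sub_eq_integral hJ hγ ht (right_mem_Icc.2 zero_le_one)
  have hz : (0 : ℝ) ∈ Icc (0 : ℝ) 1 := left_mem_Icc.2 zero_le_one
  have ho : (1 : ℝ) ∈ Icc (0 : ℝ) 1 := right_mem_Icc.2 zero_le_one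
  rw [hu.characteristic_add_one hJ (hγ.isCharacteristic hz) (hγ.isCharacteristic ho)
    (by rw [(hγ 1 ho).1, (hγ 0 hz).1, zero_add]) ht, add_sub_cancel_left] at h1
  have h2 : ∫ α in (0 : ℝ)..1, Real.exp (logJacobian u (γ α) t) =
      ∫ α in (0 : ℝ)..1, Real.exp (logJacobian u (γ (1 / 4)) t)
        * labelWeight lam α (timeChange lam u γ t) :=
    intervalIntegral.integral_congr fun α hα => by
      rw [uIcc_of_le zero_le_one] at hα
      exact exp_logJacobian_eq_mul hJ hu hγ h0 hα ht
  rw [h1, intervalIntegral.integral_const_mul, ← meanWeight] at h2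
  exact eq_inv_of_mul_eq_one_left h2.symm

theorem exp_logJacobian (h0 : lam ≠ 0) {α t : ℝ} (hα : α ∈ Icc (0 : ℝ) 1) (ht : t ∈ J) :
    Real.exp (logJacobian u (γ α) t) = jacobian lam α (timeChange lam u γ t) := by
  rw [exp_logJacobian_eq_mul hJ hu hγ h0 hα ht, exp_logJacobian_quarter hJ hu hγ h0 ht, jacobian,
    div_eq_inv_mul]

omit hJ hu hγ in
theorem timeChange_zero : timeChange lam u γ 0 = 0 := by simp [timeChange]

theorem continuousOn_timeChange : ContinuousOn (timeChange lam u γ) J :=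
  hJ.continuousOn_primitive (continuousOn_timeChange_integrand hJ hu hγ)

theorem hasDerivAt_timeChange (h0 : lam ≠ 0) {t : ℝ} (ht : t ∈ J) (htp : 0 < t) :
    HasDerivAt (timeChange lam u γ)
      (meanWeight lam (timeChange lam u γ t) ^ (-(2 * lam))) t := by
  refine (hJ.hasDerivAt_primitive
    (continuousOn_timeChange_integrand hJ hu hγ) ht htp).congr_deriv ?_
  have hP := meanWeight_pos (timeChange_mem hJ hu hγ ht)
  rw [Real.rpow_neg hP.le, ← Real.inv_rpow hP.le, ← exp_logJacobian_quarter hJ hu hγ h0 ht,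
    ← Real.exp_mul]
  congr 1
  ring

/-- The slope along a characteristic. -/
theorem ux_flow (h0 : lam ≠ 0) {α t : ℝ} (hα : α ∈ Icc (0 : ℝ) 1) (ht : t ∈ J) :
    ux u (γ α t) t = meanWeight lam (timeChange lam u γ t) ^ (-(2 * lam))
      * flowSlope lam α (timeChange lam u γ t) := by
  rcases (hJ.nonneg ht).eq_or_lt with rfl | htp
  · rw [ux_flow_zero hu hγ hα, timeChange_zero, meanWeight_zero, Real.one_rpow, one_mul,
      flowSlope, meanWeight₁_zero, zero_div, sub_zero, labelSlope_zero]
  have hm := timeChange_mem hJ hu hγ ht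
  have hj := jacobian_pos hm α
  have h1 := (hu.hasDerivAt_logJacobian hJ (hγ.isCharacteristic hα) ht htp).exp
  have h2 := (hasDerivAt_jacobian hm α).comp t (hasDerivAt_timeChange hJ hu hγ h0 ht htp)
  -- The slope is the logarithmic derivative of the Jacobian, and two expressions for the Jacobian
  -- are known.
  have h3 := h1.unique (h2.congr_of_eventuallyEq (by
    filter_upwards [hJ.mem_nhds ht htp] with s hs using exp_logJacobian hJ hu hγ h0 hα hs))
  rw [exp_logJacobian hJ hu hγ h0 hα ht] at h3
  refine mul_left_cancel₀ hj.ne' (h3.trans (by ring))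

/-- Without zero mean the flow is determined only up to a translation depending on time, carried by
`γ 0 t`. -/
theorem flow_sub_eq_flowMap (h0 : lam ≠ 0) {α t : ℝ} (hα : α ∈ Icc (0 : ℝ) 1) (ht : t ∈ J) :
    γ α t - γ 0 t = flowMap lam α (timeChange lam u γ t) := by
  rw [← hu.flow_sub_eq_integral hJ hγ ht hα, flowMap]
  refine intervalIntegral.integral_congr fun β hβ => ?_
  rw [uIcc_of_le hα.1] at hβ
  exact exp_logJacobian hJ hu hγ h0 ⟨hβ.1, hβ.2.trans hα.2⟩ ht

end IsClassicalSolution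


/-! ### Integrals of powers of 1 - κ cos³ -/

section CosMean

/-- The mean of `(1 - κ cos³ (2πx)) ^ (-p)`. -/
def cosMean (p κ : ℝ) : ℝ := ∫ x in (0 : ℝ)..1, (1 - κ * datumSlope x) ^ (-p)

variable {p a κ : ℝ}

theorem one_sub_mul_pos (h : |κ| < 1) (x : ℝ) : 0 < 1 - κ * datumSlope x := by
  have h1 : |κ * datumSlope x| < 1 := by
    rw [abs_mul]
    calc _ ≤ |κ| * 1 := by gcongr; exact abs_datumSlope_le_one x
      _ < 1 := by rwa [mul_one]
  linarith [(abs_lt.1 h1).2]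

theorem abs_lt_one_of_mem (h : κ ∈ Ico (0 : ℝ) 1) : |κ| < 1 := by rw [abs_of_nonneg h.1]; exact h.2

theorem one_sub_mul_pos' (h : κ ∈ Ico (0 : ℝ) 1) (x : ℝ) : 0 < 1 - κ * datumSlope x :=
  one_sub_mul_pos (abs_lt_one_of_mem h) x

theorem one_sub_le (h : κ ∈ Ico (0 : ℝ) 1) (x : ℝ) : 1 - κ ≤ 1 - κ * datumSlope x := by
  nlinarith [h.1, datumSlope_le_one x]

theorem one_sub_mul_le_two (h : κ ∈ Ico (0 : ℝ) 1) (x : ℝ) : 1 - κ * datumSlope x ≤ 2 := by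
  nlinarith [h.1, h.2, neg_one_le_datumSlope x]

theorem continuous_rpow_one_sub (h : |κ| < 1) (p : ℝ) :
    Continuous fun x => (1 - κ * datumSlope x) ^ p :=
  Continuous.rpow_const (by fun_prop) fun x => Or.inl (one_sub_mul_pos h x).ne'

theorem intervalIntegrable_rpow_one_sub (h : |κ| < 1) (p a b : ℝ) :
    IntervalIntegrable (fun x => (1 - κ * datumSlope x) ^ p) MeasureTheory.volume a b :=
  (continuous_rpow_one_sub h p).intervalIntegrable _ _

theorem cosMean_pos (h : |κ| < 1) (p : ℝ) : 0 < cosMean p κ :=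
  intervalIntegral.intervalIntegral_pos_of_pos (intervalIntegrable_rpow_one_sub h _ _ _)
    (fun x => Real.rpow_pos_of_pos (one_sub_mul_pos h x) _) one_pos

theorem datumSlope_add_half (x : ℝ) : datumSlope (x + 1 / 2) = -datumSlope x := by
  have : 2 * Real.pi * (x + 1 / 2) = 2 * Real.pi * x + Real.pi := by ring
  rw [datumSlope, datumSlope, this, Real.cos_add_pi]
  ring

/-- A shift by half a period changes the sign of the cosine; this lets both signs of `lam` be
treated with κ in [0, 1). -/
theorem cosMean_neg (p κ : ℝ) : cosMean p (-κ) = cosMean p κ := by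
  have hp : Function.Periodic (fun x => (1 - κ * datumSlope x) ^ (-p)) 1 := fun x => by
    simp only [datumSlope_periodic x]
  have h1 := intervalIntegral.integral_comp_add_right (a := 0) (b := 1)
    (fun x => (1 - κ * datumSlope x) ^ (-p)) (1 / 2)
  simp only [datumSlope_add_half] at h1
  rw [show (1 : ℝ) + 1 / 2 = 0 + 1 / 2 + 1 by norm_num,
    hp.intervalIntegral_add_eq (0 + 1 / 2) 0, zero_add] at h1
  rw [cosMean, cosMean, ← h1]
  refine intervalIntegral.integral_congr fun x _ => ?_
  simp only [neg_mul, mul_neg]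

theorem cosMean_abs (p κ : ℝ) : cosMean p |κ| = cosMean p κ := by
  rcases abs_choice κ with h | h <;> rw [h]
  exact cosMean_neg p κ

theorem mul_integral_datumSlope_mul (h : |κ| < 1) (p : ℝ) :
    κ * ∫ x in (0 : ℝ)..1, datumSlope x * (1 - κ * datumSlope x) ^ (-p) =
      cosMean p κ - cosMean (p - 1) κ := by
  rw [← intervalIntegral.integral_const_mul, cosMean, cosMean,
    ← intervalIntegral.integral_sub (intervalIntegrable_rpow_one_sub h _ _ _)
      (intervalIntegrable_rpow_one_sub h _ _ _)]
  refine intervalIntegral.integral_congr fun x _ => ?_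
  have hx := one_sub_mul_pos h x
  rw [show -(p - 1) = -p + 1 by ring, Real.rpow_add_one hx.ne']
  ring

/-- The density `-datum * datumCurv`. -/
def curvWeight (x : ℝ) : ℝ := -(datum x * datumCurv x)

theorem curvWeight_eq (x : ℝ) : curvWeight x = Real.sin (2 * Real.pi * x) ^ 2 *
    Real.cos (2 * Real.pi * x) ^ 2 * (3 - Real.sin (2 * Real.pi * x) ^ 2) := by
  rw [curvWeight, datum, datumCurv]
  field_simp
  ring

theorem curvWeight_nonneg (x : ℝ) : 0 ≤ curvWeight x := by
  rw [curvWeight_eq]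
  have := Real.sin_sq_le_one (2 * Real.pi * x)
  exact mul_nonneg (by positivity) (by linarith)

/-- The difference of the two sides is exactly the fourth power of the sine. -/
theorem curvWeight_le (x : ℝ) : curvWeight x ≤ 1 - datumSlope x ^ 2 := by
  rw [curvWeight_eq, datumSlope, Real.sin_sq]
  have h1 := Real.cos_sq_le_one (2 * Real.pi * x)
  nlinarith [pow_two_nonneg (1 - Real.cos (2 * Real.pi * x) ^ 2)]

/-- The mean of `curvWeight * (1 - κ * datumSlope) ^ (-(p + 1))`. -/
def curvMean (p κ : ℝ) : ℝ :=
  ∫ x in (0 : ℝ)..1, curvWeight x * (1 - κ * datumSlope x) ^ (-(p + 1))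

theorem continuous_curvWeight : Continuous curvWeight :=
  (continuous_datum.mul continuous_datumCurv).neg

theorem curvMean_nonneg (h : |κ| < 1) (p : ℝ) : 0 ≤ curvMean p κ :=
  intervalIntegral.integral_nonneg zero_le_one fun x _ =>
    mul_nonneg (curvWeight_nonneg x) (Real.rpow_nonneg (one_sub_mul_pos h x).le _)

/-- With D = 1 - κ f one has κ² (1 - f²) = κ² - 1 + 2 D - D²; the three terms shift the exponent by
0, 1 and 2. -/
theorem sq_mul_curvMean_le (h : |κ| < 1) (p : ℝ) :
    κ ^ 2 * curvMean p κ ≤ (κ ^ 2 - 1) * cosMean (p + 1) κ + 2 * cosMean p κ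
      - cosMean (p - 1) κ := by
  have hi := fun q => intervalIntegrable_rpow_one_sub h q 0 1
  simp only [curvMean, cosMean, ← intervalIntegral.integral_const_mul]
  rw [← intervalIntegral.integral_add ((hi _).const_mul _) ((hi _).const_mul _),
    ← intervalIntegral.integral_sub (((hi _).const_mul _).add ((hi _).const_mul _)) (hi _)]
  refine intervalIntegral.integral_mono_on zero_le_one
    ((continuous_const.mul (continuous_curvWeight.mul
      (continuous_rpow_one_sub h _))).intervalIntegrable _ _)
    ((((hi _).const_mul _).add ((hi _).const_mul _)).sub (hi _)) fun x _ => ?_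
  have hx := one_sub_mul_pos h x
  have e1 := Real.rpow_add_one hx.ne' (-(p + 1))
  have e2 := Real.rpow_add_one hx.ne' (-p)
  rw [show -(p + 1) + 1 = -p by ring] at e1
  rw [show -p + 1 = -(p - 1) by ring, e1] at e2
  rw [e2, e1]
  have h1 := mul_le_mul_of_nonneg_left (mul_le_mul_of_nonneg_right (curvWeight_le x)
    (Real.rpow_nonneg hx.le (-(p + 1)))) (sq_nonneg κ)
  refine h1.trans_eq ?_
  ring

/-- Integration by parts, `datumSlope` being the derivative of `datum`, which vanishes at both ends.
-/
theorem integral_datumSlope_mul_rpow (h : |κ| < 1) (p : ℝ) :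
    ∫ x in (0 : ℝ)..1, datumSlope x * (1 - κ * datumSlope x) ^ (-p) = p * κ * curvMean p κ := by
  have hd : ∀ x, HasDerivAt (fun x => datum x * (1 - κ * datumSlope x) ^ (-p))
      (datumSlope x * (1 - κ * datumSlope x) ^ (-p) - p * κ *
        (curvWeight x * (1 - κ * datumSlope x) ^ (-(p + 1)))) x := fun x => by
    have h1 : HasDerivAt (fun x => 1 - κ * datumSlope x) (-(κ * datumCurv x)) x :=
      ((hasDerivAt_datumSlope x).const_mul κ).const_sub 1
    refine ((hasDerivAt_datum x).mul
      (h1.rpow_const (p := -p) (Or.inl (one_sub_mul_pos h x).ne'))).congr_deriv ?_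
    rw [show -p - 1 = -(p + 1) by ring, curvWeight]
    ring
  have c1 : Continuous fun x => datumSlope x * (1 - κ * datumSlope x) ^ (-p) :=
    continuous_datumSlope.mul (continuous_rpow_one_sub h _)
  have c2 : Continuous fun x => p * κ *
      (curvWeight x * (1 - κ * datumSlope x) ^ (-(p + 1))) :=
    continuous_const.mul (continuous_curvWeight.mul (continuous_rpow_one_sub h _))
  have h2 := intervalIntegral.integral_eq_sub_of_hasDerivAt (a := 0) (b := 1)
    (fun x _ => hd x) ((c1.sub c2).intervalIntegrable _ _)
  rw [intervalIntegral.integral_sub (c1.intervalIntegrable _ _) (c2.intervalIntegrable _ _),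
    datum_zero, datum_one, intervalIntegral.integral_const_mul] at h2
  rw [curvMean]
  linarith

theorem cosMean_sub_eq (h : |κ| < 1) (p : ℝ) :
    cosMean p κ - cosMean (p - 1) κ = p * (κ ^ 2 * curvMean p κ) := by
  rw [← mul_integral_datumSlope_mul h, integral_datumSlope_mul_rpow h]
  ring

/-- The pointwise bound would only give 1/(1-κ), the same size as the leading term of the slope at
the maximum. Integration by parts gains the factor 1/(1+κ), which leaves a definite positive part in
`one_div_le_cosSlope_one`. -/
theorem cosMean_succ_le (h : |κ| < 1) (h0 : 0 < p) (h1 : p ≤ 1) :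
    cosMean (p + 1) κ ≤ cosMean p κ / (1 - κ ^ 2) := by
  have h2 := mul_le_mul_of_nonneg_left (sq_mul_curvMean_le h p) h0.le
  have h3 := cosMean_sub_eq h p
  have h4 : 0 ≤ p * (κ ^ 2 * curvMean p κ) :=
    mul_nonneg h0.le (mul_nonneg (sq_nonneg _) (curvMean_nonneg h p))
  have h5 : 0 < 1 - κ ^ 2 := by
    have := sq_lt_one_iff_abs_lt_one κ |>.2 h
    linarith
  rw [le_div_iff₀ h5]
  refine le_of_mul_le_mul_left ?_ h0
  nlinarith

theorem cosMean_le_of_le {C : ℝ} (h : |κ| < 1)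
    (hC : ∀ x, (1 - κ * datumSlope x) ^ (-p) ≤ C * (1 - κ * datumSlope x) ^ (-a)) :
    cosMean p κ ≤ C * cosMean a κ := by
  rw [cosMean, cosMean, ← intervalIntegral.integral_const_mul]
  exact intervalIntegral.integral_mono_on zero_le_one (intervalIntegrable_rpow_one_sub h _ _ _)
    ((intervalIntegrable_rpow_one_sub h _ _ _).const_mul _) fun x _ => hC x

theorem cosMean_zero (κ : ℝ) : cosMean 0 κ = 1 := by simp [cosMean]

theorem cosMean_le_rpow_mul (h : κ ∈ Ico (0 : ℝ) 1) (hap : a ≤ p) :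
    cosMean p κ ≤ (1 - κ) ^ (-(p - a)) * cosMean a κ := by
  refine cosMean_le_of_le (abs_lt_one_of_mem h) fun x => ?_
  have hx := one_sub_mul_pos' h x
  rw [show -p = -(p - a) + -a by ring, Real.rpow_add hx]
  gcongr ?_ * _
  exact Real.rpow_le_rpow_of_nonpos (by linarith [h.2]) (one_sub_le h x) (by linarith)

theorem rpow_mul_cosMean_le (h : κ ∈ Ico (0 : ℝ) 1) (hap : a ≤ p) :
    cosMean a κ ≤ 2 ^ (p - a) * cosMean p κ := by
  refine cosMean_le_of_le (abs_lt_one_of_mem h) fun x => ?_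
  have hx := one_sub_mul_pos' h x
  rw [show -a = (p - a) + -p by ring, Real.rpow_add hx]
  gcongr ?_ * _
  exact Real.rpow_le_rpow hx.le (one_sub_mul_le_two h x) (by linarith)

theorem le_cosMean_of_nonneg (h : κ ∈ Ico (0 : ℝ) 1) (hp : 0 ≤ p) : 2 ^ (-p) ≤ cosMean p κ := by
  have := rpow_mul_cosMean_le h hp
  rw [cosMean_zero, sub_zero] at this
  rw [Real.rpow_neg zero_le_two]
  exact (inv_le_iff_one_le_mul₀' (by positivity)).2 this

theorem cosMean_le_of_nonpos (h : κ ∈ Ico (0 : ℝ) 1) (hp : p ≤ 0) : cosMean p κ ≤ 2 ^ (-p) := by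
  have := rpow_mul_cosMean_le h hp
  rwa [cosMean_zero, zero_sub, mul_one] at this

/-- On the middle half of the period the cosine is nonpositive, so the integrand is at least 1. -/
theorem half_le_cosMean (h : κ ∈ Ico (0 : ℝ) 1) (hp : p ≤ 0) : 1 / 2 ≤ cosMean p κ := by
  have hi := intervalIntegrable_rpow_one_sub (abs_lt_one_of_mem h) (-p)
  calc (1 / 2 : ℝ) = ∫ _ in (1 / 4 : ℝ)..(3 / 4), (1 : ℝ) := by norm_num
    _ ≤ ∫ x in (1 / 4 : ℝ)..(3 / 4), (1 - κ * datumSlope x) ^ (-p) := by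
        refine intervalIntegral.integral_mono_on (by norm_num) (by simp) (hi _ _) fun x hx => ?_
        have h1 : datumSlope x ≤ 0 := Odd.pow_nonpos (by decide)
          (Real.cos_nonpos_of_pi_div_two_le_of_le (by nlinarith [Real.pi_pos, hx.1])
            (by nlinarith [Real.pi_pos, hx.2]))
        exact Real.one_le_rpow (by nlinarith [h.1]) (by linarith)
    _ ≤ cosMean p κ := by
        refine intervalIntegral.integral_mono_interval (by norm_num) (by norm_num) (by norm_num)
          (Eventually.of_forall fun x => ?_) (hi _ _)
        exact Real.rpow_nonneg (one_sub_mul_pos' h x).le _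

theorem half_one_sub_cos_le (h : κ ∈ Ico (0 : ℝ) 1) (x : ℝ) :
    (1 - Real.cos (2 * Real.pi * x)) / 2 ≤ 1 - κ * datumSlope x := by
  rw [datumSlope]
  have h1 := Real.neg_one_le_cos (2 * Real.pi * x)
  have h2 := Real.cos_le_one (2 * Real.pi * x)
  set c := Real.cos (2 * Real.pi * x)
  rcases le_total 0 c with h3 | h3
  · have h4 : c ^ 3 ≤ c := pow_le_of_le_one h3 h2 (by norm_num)
    have h5 : 0 ≤ c ^ 3 := by positivity
    nlinarith [h.1, h.2]
  · have h4 : c ^ 3 ≤ 0 := Odd.pow_nonpos (by decide) h3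
    nlinarith [h.1, h.2]

/-- Half of 1 - cos(2πx) is sin²(πx), and Jordan's inequality gives sin(πx) ≥ 2x; the bound does not
degenerate as κ ↑ 1. -/
theorem four_mul_sq_le (h : κ ∈ Ico (0 : ℝ) 1) {x : ℝ} (hx : x ∈ Icc (0 : ℝ) (1 / 2)) :
    4 * x ^ 2 ≤ 1 - κ * datumSlope x := by
  have h1 : 1 - Real.cos (2 * Real.pi * x) = 2 * Real.sin (Real.pi * x) ^ 2 := by
    rw [mul_assoc, Real.cos_two_mul, Real.sin_sq]
    ring
  have h2 : 2 * x ≤ Real.sin (Real.pi * x) := by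
    have := Real.mul_le_sin (x := Real.pi * x) (by nlinarith [Real.pi_pos, hx.1])
      (by nlinarith [Real.pi_pos, hx.2])
    calc 2 * x = 2 / Real.pi * (Real.pi * x) := by field_simp
      _ ≤ _ := this
  refine le_trans ?_ (half_one_sub_cos_le h x)
  rw [h1]
  nlinarith [hx.1]

theorem cosMean_eq_two_mul (h : |κ| < 1) (p : ℝ) :
    cosMean p κ = 2 * ∫ x in (0 : ℝ)..(1 / 2), (1 - κ * datumSlope x) ^ (-p) := by
  have h1 := intervalIntegral.integral_comp_sub_left (a := 0) (b := 1 / 2)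
    (fun x => (1 - κ * datumSlope x) ^ (-p)) 1
  have h2 : ∀ x, datumSlope (1 - x) = datumSlope x := fun x => by
    rw [← datumSlope_neg, neg_sub, datumSlope_periodic.sub_eq]
  simp only [h2, sub_zero] at h1
  rw [show (1 - 1 / 2 : ℝ) = 1 / 2 by norm_num] at h1
  rw [cosMean, ← intervalIntegral.integral_add_adjacent_intervals
    (intervalIntegrable_rpow_one_sub h (-p) 0 (1 / 2))
    (intervalIntegrable_rpow_one_sub h (-p) (1 / 2) 1), ← h1]
  ring

/-- The quadratic lower bound dominates the integrand by a multiple of x^(-2a), integrable at 0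
because 2a < 1. -/
theorem exists_cosMean_le (ha0 : 0 ≤ a) (ha : a < 1 / 2) :
    ∃ C, 0 < C ∧ ∀ κ ∈ Ico (0 : ℝ) 1, cosMean a κ ≤ C := by
  refine ⟨max 1 (2 * ∫ x in (0 : ℝ)..(1 / 2), 4 ^ (-a) * x ^ (-(2 * a))), by positivity,
    fun κ h => le_max_of_le_right ?_⟩
  rw [cosMean_eq_two_mul (abs_lt_one_of_mem h)]
  gcongr 2 * ?_
  refine intervalIntegral.integral_mono_on_of_le_Ioo (by norm_num)
    (intervalIntegrable_rpow_one_sub (abs_lt_one_of_mem h) _ _ _)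
    ((intervalIntegral.intervalIntegrable_rpow' (by linarith)).const_mul _) fun x hx => ?_
  calc _ ≤ (4 * x ^ 2) ^ (-a) := Real.rpow_le_rpow_of_nonpos (by have := hx.1; positivity)
        (four_mul_sq_le h (Ioo_subset_Icc_self hx)) (by linarith)
    _ = _ := by
      rw [Real.mul_rpow (by norm_num) (sq_nonneg x), ← Real.rpow_natCast,
        ← Real.rpow_mul hx.1.le]
      norm_num

/-- The constant is 3 · 20: 1 - c³ ≤ 3 (1 - c), and 1 - cos(2πx) ≤ 2π² x² ≤ 20 x². -/
theorem one_sub_mul_le (h : κ ∈ Ico (0 : ℝ) 1) (x : ℝ) :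
    1 - κ * datumSlope x ≤ 1 - κ + 60 * x ^ 2 := by
  have h1 : 1 - (2 * Real.pi * x) ^ 2 / 2 ≤ Real.cos (2 * Real.pi * x) :=
    Real.one_sub_sq_div_two_le_cos
  have h2 : Real.pi ^ 2 ≤ 10 := by nlinarith [Real.pi_lt_d2, Real.pi_pos]
  have h3 : 1 - Real.cos (2 * Real.pi * x) ≤ 20 * x ^ 2 := by nlinarith [sq_nonneg x]
  have h4 : 1 - datumSlope x ≤ 3 * (1 - Real.cos (2 * Real.pi * x)) := by
    rw [datumSlope]
    nlinarith [mul_nonneg (sq_nonneg (1 - Real.cos (2 * Real.pi * x)))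
      (show 0 ≤ 2 + Real.cos (2 * Real.pi * x) by linarith [Real.neg_one_le_cos (2 * Real.pi * x)])]
  nlinarith [h.1, h.2, datumSlope_le_one x]

/-- On the boundary layer 0 ≤ x ≤ √(1-κ) the base is at most 61 (1-κ); only this layer is
integrated. -/
theorem le_cosMean (h : κ ∈ Ico (0 : ℝ) 1) (hp : 0 ≤ p) :
    61 ^ (-p) * (1 - κ) ^ (1 / 2 - p) ≤ cosMean p κ := by
  have hε : 0 < 1 - κ := by linarith [h.2]
  have hi := intervalIntegrable_rpow_one_sub (abs_lt_one_of_mem h) (-p)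
  have hs : √(1 - κ) ≤ 1 := Real.sqrt_le_one.2 (by linarith [h.1])
  calc _ = ∫ _ in (0 : ℝ)..√(1 - κ), (61 * (1 - κ)) ^ (-p) := by
        rw [intervalIntegral.integral_const, sub_zero, smul_eq_mul, Real.sqrt_eq_rpow,
          Real.mul_rpow (by norm_num) hε.le, sub_eq_add_neg (1 / 2 : ℝ), Real.rpow_add hε]
        ring
    _ ≤ ∫ x in (0 : ℝ)..√(1 - κ), (1 - κ * datumSlope x) ^ (-p) := by
        refine intervalIntegral.integral_mono_on (Real.sqrt_nonneg _) (by simp) (hi _ _)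
          fun x hx => ?_
        refine Real.rpow_le_rpow_of_nonpos (one_sub_mul_pos' h x) ?_ (by linarith)
        have : x ^ 2 ≤ 1 - κ := by
          have := pow_le_pow_left₀ hx.1 hx.2 2
          rwa [Real.sq_sqrt hε.le] at this
        linarith [one_sub_mul_le h x]
    _ ≤ cosMean p κ := by
        refine intervalIntegral.integral_mono_interval le_rfl (Real.sqrt_nonneg _) hs
          (Eventually.of_forall fun x => ?_) (hi _ _)
        exact Real.rpow_nonneg (one_sub_mul_pos' h x).le _

theorem tendsto_one_sub : Tendsto (fun κ : ℝ => 1 - κ) (𝓝[<] 1) (𝓝[>] 0) := by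
  refine tendsto_nhdsWithin_iff.2 ⟨?_, ?_⟩
  · have : Continuous fun κ : ℝ => 1 - κ := by fun_prop
    simpa using (this.tendsto 1).mono_left nhdsWithin_le_nhds
  · filter_upwards [self_mem_nhdsWithin] with κ hκ
    simpa using hκ

/-- The borderline exponent diverges logarithmically: with s = √(1-κ) the base is at most s² + 60 x²
≤ (s + 8x)². -/
theorem tendsto_cosMean_half : Tendsto (cosMean (1 / 2)) (𝓝[<] 1) atTop := by
  have h1 : Tendsto (fun κ : ℝ => 1 / 8 * Real.log (8 / √(1 - κ))) (𝓝[<] 1) atTop := by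
    refine Tendsto.const_mul_atTop (by norm_num) (Real.tendsto_log_atTop.comp ?_)
    have h2 : Tendsto (fun ε : ℝ => √ε) (𝓝[>] 0) (𝓝[>] 0) := by
      refine tendsto_nhdsWithin_iff.2 ⟨?_, ?_⟩
      · simpa using (Real.continuous_sqrt.tendsto 0).mono_left nhdsWithin_le_nhds
      · filter_upwards [self_mem_nhdsWithin] with ε hε using Real.sqrt_pos.2 hε
    have h3 := (tendsto_inv_nhdsGT_zero.comp (h2.comp tendsto_one_sub)).const_mul_atTop
      (show (0 : ℝ) < 8 by norm_num)
    simpa [Function.comp_def, div_eq_mul_inv] using h3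
  refine tendsto_atTop_mono' _ ?_ h1
  filter_upwards [Ico_mem_nhdsLT (show (0 : ℝ) < 1 by norm_num)] with κ h
  have hε : 0 < 1 - κ := by linarith [h.2]
  set s := √(1 - κ) with hs
  have hs0 : 0 < s := Real.sqrt_pos.2 hε
  have hd : ∀ x ∈ uIcc (0 : ℝ) 1, HasDerivAt (fun x => 1 / 8 * Real.log (s + 8 * x))
      (s + 8 * x)⁻¹ x := fun x hx => by
    rw [uIcc_of_le zero_le_one] at hx
    have h1 : HasDerivAt (fun x : ℝ => s + 8 * x) 8 x := by
      simpa using ((hasDerivAt_id x).const_mul 8).const_add s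
    have h2 : s + 8 * x ≠ 0 := by linarith [hx.1]
    refine ((h1.log h2).const_mul (1 / 8)).congr_deriv ?_
    field_simp
  have hc : ContinuousOn (fun x => (s + 8 * x)⁻¹) (uIcc (0 : ℝ) 1) := by
    refine ContinuousOn.inv₀ (by fun_prop) fun x hx => ?_
    rw [uIcc_of_le zero_le_one] at hx
    linarith [hx.1]
  have h4 := intervalIntegral.integral_eq_sub_of_hasDerivAt hd hc.intervalIntegrable
  calc 1 / 8 * Real.log (8 / s) ≤ ∫ x in (0 : ℝ)..1, (s + 8 * x)⁻¹ := by
        rw [h4, mul_zero, add_zero, mul_one, ← mul_sub, ← Real.log_div (by positivity) hs0.ne']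
        gcongr
        linarith
    _ ≤ cosMean (1 / 2) κ := by
        refine intervalIntegral.integral_mono_on zero_le_one hc.intervalIntegrable
          (intervalIntegrable_rpow_one_sub (abs_lt_one_of_mem h) _ _ _) fun x hx => ?_
        have h5 : 0 < s + 8 * x := by linarith [hx.1]
        have hx' := one_sub_mul_pos' h x
        rw [Real.rpow_neg hx'.le, ← Real.sqrt_eq_rpow]
        refine inv_anti₀ (Real.sqrt_pos.2 hx') ((Real.sqrt_le_left h5.le).2 ?_)
        have := one_sub_mul_le h x
        have h6 : s ^ 2 = 1 - κ := Real.sq_sqrt hε.le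
        nlinarith [hx.1]

theorem tendsto_cosMean_of_half_le (hp : 1 / 2 ≤ p) : Tendsto (cosMean p) (𝓝[<] 1) atTop := by
  have h1 := tendsto_cosMean_half.const_mul_atTop
    (show (0 : ℝ) < (2 ^ (p - 1 / 2))⁻¹ by positivity)
  refine tendsto_atTop_mono' _ ?_ h1
  filter_upwards [Ico_mem_nhdsLT (show (0 : ℝ) < 1 by norm_num)] with κ h
  exact (inv_mul_le_iff₀ (by positivity)).2 (rpow_mul_cosMean_le h hp)

theorem tendsto_rpow_one_sub_atTop {r : ℝ} (hr : r < 0) :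
    Tendsto (fun κ : ℝ => (1 - κ) ^ r) (𝓝[<] 1) atTop :=
  (tendsto_rpow_neg_nhdsGT_zero hr).comp tendsto_one_sub

theorem tendsto_rpow_one_sub_zero {r : ℝ} (hr : 0 < r) :
    Tendsto (fun κ : ℝ => (1 - κ) ^ r) (𝓝[<] 1) (𝓝 0) := by
  have := (Real.continuousAt_rpow_const 0 r (Or.inr hr.le)).tendsto
  rw [Real.zero_rpow hr.ne'] at this
  exact (this.mono_left nhdsWithin_le_nhds).comp tendsto_one_sub

/-- The slope in terms of `cosMean`, without the time change. -/
def cosSlope (p f κ : ℝ) : ℝ :=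
  f / (1 - κ * f) - (cosMean (p + 1) κ - cosMean p κ) / (κ * cosMean p κ)

theorem cosSlope_eq {κ : ℝ} (h : κ ∈ Ioo (0 : ℝ) 1) (p f : ℝ) :
    cosSlope p f κ = f / (1 - κ * f) - (cosMean (p + 1) κ / cosMean p κ - 1) / κ := by
  have h1 := cosMean_pos (abs_lt_one_of_mem (Ioo_subset_Ico_self h)) p
  have h2 := h.1
  rw [cosSlope]
  congr 1
  field_simp

theorem div_le_of_lt_one {f : ℝ} (hκ : κ ∈ Ico (0 : ℝ) 1) (hf : f < 1) :
    f / (1 - κ * f) ≤ 1 / (1 - f) := by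
  have h1 : 0 < 1 - f := by linarith
  have h2 : 0 < 1 - κ * f := by nlinarith [hκ.1, hκ.2]
  rw [div_le_div_iff₀ h2 h1]
  nlinarith [hκ.1, hκ.2, mul_nonneg (sub_nonneg.2 hκ.2.le) (sq_nonneg f), sq_nonneg (1 - f)]

end CosMean


/-! ### Asymptotics of the slopes as κ ↑ 1 -/

section Asymptotics

variable {p f κ : ℝ}

theorem eventually_half_lt : ∀ᶠ κ : ℝ in 𝓝[<] 1, κ ∈ Ioo (1 / 2 : ℝ) 1 :=
  Ioo_mem_nhdsLT (by norm_num)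

/-- A slightly lossy exponent `s` above max(0, p - 1/2) handles p below, at and above 1/2 together,
by pulling (1-κ)^(-s) out of S_p and leaving S_(p-s) with p - s < 1/2. The room for both side
conditions is precisely p < 1. They serve the divergence at the maximum and the finiteness of time,
and the divergence of the weighted ratio S_(p+1)/S_p. -/
theorem exists_cosMean_growth (h0 : 0 < p) (h1 : p < 1) :
    ∃ s C : ℝ, 0 < C ∧ 2 / p * s < 1 ∧ (2 / p + 1) * s < p + 1 / 2 ∧
      ∀ κ ∈ Ico (0 : ℝ) 1, cosMean p κ ≤ C * (1 - κ) ^ (-s) := by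
  have hlt : max 0 (p - 1 / 2) < p * (p + 1 / 2) / (p + 2) := by
    refine max_lt (by positivity) ?_
    rw [lt_div_iff₀ (by linarith)]
    nlinarith
  obtain ⟨s, hs1, hs2⟩ := exists_between hlt
  have hs0 : 0 < s := (le_max_left _ _).trans_lt hs1
  have hsp : p - 1 / 2 < s := (le_max_right _ _).trans_lt hs1
  rw [lt_div_iff₀ (by linarith)] at hs2
  have hs3 : s < p / 2 := by
    by_contra hcon
    nlinarith
  obtain ⟨C, hC0, hC⟩ := exists_cosMean_le (a := p - s) (by linarith) (by linarith)
  refine ⟨s, C, hC0, ?_, ?_, fun κ h => ?_⟩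
  · rw [div_mul_eq_mul_div, div_lt_one h0]
    linarith
  · rw [div_add_one h0.ne', div_mul_eq_mul_div, div_lt_iff₀ h0]
    linarith
  · have := cosMean_le_rpow_mul h (show p - s ≤ p by linarith)
    rw [sub_sub_cancel] at this
    rw [mul_comm]
    exact this.trans (mul_le_mul_of_nonneg_left (hC κ h)
      (Real.rpow_nonneg (by linarith [h.2]) _))

theorem one_div_le_cosSlope_one (h0 : 0 < p) (h1 : p ≤ 1) (h : κ ∈ Ioo (0 : ℝ) 1) :
    1 / (1 - κ ^ 2) ≤ cosSlope p 1 κ := by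
  have hκ := abs_lt_one_of_mem (Ioo_subset_Ico_self h)
  have hS := cosMean_pos hκ p
  have hR : cosMean (p + 1) κ / cosMean p κ ≤ 1 / (1 - κ ^ 2) := by
    rw [div_le_iff₀ hS, div_mul_eq_mul_div, one_mul]
    exact cosMean_succ_le hκ h0 h1
  have h2 : 0 < 1 - κ := by linarith [h.2]
  have h3 : 0 < 1 + κ := by linarith [h.1]
  have h4 := h.1
  rw [cosSlope_eq h]
  have h5 : (cosMean (p + 1) κ / cosMean p κ - 1) / κ ≤ (1 / (1 - κ ^ 2) - 1) / κ := by gcongr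
  have h6 : 1 / (1 - κ * 1) - (1 / (1 - κ ^ 2) - 1) / κ = 1 / (1 - κ ^ 2) := by
    rw [show (1 - κ ^ 2) = (1 - κ) * (1 + κ) by ring, mul_one]
    field_simp
    ring
  linarith

theorem tendsto_cosSlope_one_of_pos (h0 : 0 < p) (h1 : p < 1) :
    Tendsto (fun κ => cosMean p κ ^ (-(2 / p)) * cosSlope p 1 κ) (𝓝[<] 1) atTop := by
  obtain ⟨s, C, hC0, hs, -, hC⟩ := exists_cosMean_growth h0 h1
  have hp2 : 0 < 2 / p := by positivity
  have h2 := (tendsto_rpow_one_sub_atTop (r := 2 / p * s - 1) (by linarith)).const_mul_atTop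
    (show 0 < C ^ (-(2 / p)) / 2 by positivity)
  refine tendsto_atTop_mono' _ ?_ h2
  filter_upwards [eventually_half_lt] with κ h
  have hI : κ ∈ Ioo (0 : ℝ) 1 := ⟨by linarith [h.1], h.2⟩
  have hε : 0 < 1 - κ := by linarith [h.2]
  have h3 : C ^ (-(2 / p)) * (1 - κ) ^ (2 / p * s) ≤ cosMean p κ ^ (-(2 / p)) := by
    calc _ = (C * (1 - κ) ^ (-s)) ^ (-(2 / p)) := by
          rw [Real.mul_rpow hC0.le (by positivity), ← Real.rpow_mul hε.le]
          ring_nf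
      _ ≤ _ := Real.rpow_le_rpow_of_nonpos (cosMean_pos (abs_lt_one_of_mem
          (Ioo_subset_Ico_self hI)) p) (hC κ (Ioo_subset_Ico_self hI)) (by linarith)
  have h4 : (1 - κ)⁻¹ / 2 ≤ cosSlope p 1 κ := by
    refine le_trans ?_ (one_div_le_cosSlope_one h0 h1.le hI)
    rw [div_eq_mul_inv, ← mul_inv, one_div]
    refine inv_anti₀ ?_ ?_ <;> nlinarith [h.1]
  calc _ = (C ^ (-(2 / p)) * (1 - κ) ^ (2 / p * s)) * ((1 - κ)⁻¹ / 2) := by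
        rw [Real.rpow_sub hε, Real.rpow_one]
        ring
    _ ≤ _ := mul_le_mul h3 h4 (by positivity) (le_trans (by positivity) h3)

/-- S_p lies above 2^(-p) for p > 0 and below it for p < 0; raised to the power -2/p both bounds
become 4. -/
theorem cosMean_rpow_le_four (h : κ ∈ Ico (0 : ℝ) 1) (hp : p ≠ 0) :
    cosMean p κ ^ (-(2 / p)) ≤ 4 := by
  have hS := cosMean_pos (abs_lt_one_of_mem h) p
  have h4 : (2 ^ (-p) : ℝ) ^ (-(2 / p)) = 4 := by
    rw [← Real.rpow_mul zero_le_two, show -p * -(2 / p) = (2 : ℕ) by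
      push_cast
      field_simp, Real.rpow_natCast]
    norm_num
  rw [← h4]
  rcases lt_or_gt_of_ne hp with h0 | h0
  · have : 2 / p < 0 := div_neg_of_pos_of_neg two_pos h0
    exact Real.rpow_le_rpow hS.le (cosMean_le_of_nonpos h h0.le) (by linarith)
  · have : 0 < 2 / p := by positivity
    exact Real.rpow_le_rpow_of_nonpos (by positivity) (le_cosMean_of_nonneg h h0.le)
      (by linarith)

theorem le_cosMean_rpow (h : κ ∈ Ico (0 : ℝ) 1) (hp : p < 0) :
    (1 / 2 : ℝ) ^ (-(2 / p)) ≤ cosMean p κ ^ (-(2 / p)) := by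
  have : 2 / p < 0 := div_neg_of_pos_of_neg two_pos hp
  exact Real.rpow_le_rpow (by norm_num) (half_le_cosMean h hp.le) (by linarith)

theorem exists_cosMean_succ_le (hp : p < 0) :
    ∃ b C : ℝ, 0 < C ∧ b < 1 ∧ ∀ κ ∈ Ico (0 : ℝ) 1, cosMean (p + 1) κ ≤ C * (1 - κ) ^ (-b) := by
  rcases le_total 0 (p + 1) with h | h
  · refine ⟨p + 1, 1, one_pos, by linarith, fun κ hκ => ?_⟩
    have := cosMean_le_rpow_mul hκ h
    rwa [cosMean_zero, mul_one, sub_zero, ← one_mul ((1 - κ) ^ _)] at this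
  · refine ⟨0, 2 ^ (-(p + 1)), by positivity, one_pos, fun κ hκ => ?_⟩
    rw [neg_zero, Real.rpow_zero, mul_one]
    exact cosMean_le_of_nonpos hκ h

theorem tendsto_cosSlope_one_of_neg (hp : p < 0) :
    Tendsto (fun κ => cosMean p κ ^ (-(2 / p)) * cosSlope p 1 κ) (𝓝[<] 1) atTop := by
  obtain ⟨b, C, hC0, hb, hC⟩ := exists_cosMean_succ_le hp
  have h1 : Tendsto (fun κ : ℝ => (1 - κ) ^ (-1 : ℝ) * (1 - 4 * C * (1 - κ) ^ (1 - b)))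
      (𝓝[<] 1) atTop := by
    refine (tendsto_rpow_one_sub_atTop (by norm_num)).atTop_mul_pos (C := 1) one_pos ?_
    simpa using ((tendsto_rpow_one_sub_zero (r := 1 - b) (by linarith)).const_mul
      (4 * C)).const_sub 1
  have h2 : Tendsto (cosSlope p 1) (𝓝[<] 1) atTop := by
    refine tendsto_atTop_mono' _ ?_ h1
    filter_upwards [eventually_half_lt] with κ h
    have hI : κ ∈ Ico (0 : ℝ) 1 := ⟨by linarith [h.1], h.2⟩
    have hε : 0 < 1 - κ := by linarith [h.2]
    have hS := half_le_cosMean hI hp.le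
    have hS1 := cosMean_pos (abs_lt_one_of_mem hI) (p + 1)
    have h3 : (cosMean (p + 1) κ - cosMean p κ) / (κ * cosMean p κ) ≤
        4 * (C * (1 - κ) ^ (-b)) := by
      rw [div_le_iff₀ (by nlinarith [h.1])]
      have h4 : 1 ≤ 4 * (κ * cosMean p κ) := by nlinarith [h.1]
      have := hC κ hI
      have h5 : 0 ≤ C * (1 - κ) ^ (-b) := by positivity
      nlinarith
    rw [cosSlope, mul_one, mul_sub, mul_one, mul_left_comm, ← Real.rpow_add hε,
      show -1 + (1 - b) = -b by ring, Real.rpow_neg_one, one_div]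
    linarith
  refine tendsto_atTop_mono' _ ?_ (h2.const_mul_atTop
    (show (0 : ℝ) < (1 / 2) ^ (-(2 / p)) by positivity))
  filter_upwards [eventually_half_lt, h2.eventually_ge_atTop 0] with κ h hpos
  exact mul_le_mul_of_nonneg_right (le_cosMean_rpow ⟨by linarith [h.1], h.2⟩ hp) hpos

theorem tendsto_cosSlope_one (hp : p < 1) (h0 : p ≠ 0) :
    Tendsto (fun κ => cosMean p κ ^ (-(2 / p)) * cosSlope p 1 κ) (𝓝[<] 1) atTop :=
  (lt_or_gt_of_ne h0).elim tendsto_cosSlope_one_of_neg fun h => tendsto_cosSlope_one_of_pos h hp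

theorem tendsto_cosMean_ratio_of_pos (h0 : 0 < p) (h1 : p < 1) :
    Tendsto (fun κ => cosMean p κ ^ (-(2 / p)) * (cosMean (p + 1) κ / cosMean p κ)) (𝓝[<] 1)
      atTop := by
  obtain ⟨s, C, hC0, -, hs, hC⟩ := exists_cosMean_growth h0 h1
  have hp2 : 0 < 2 / p := by positivity
  have h2 := (tendsto_rpow_one_sub_atTop (r := (2 / p + 1) * s - (p + 1 / 2))
    (by linarith)).const_mul_atTop
    (show 0 < C ^ (-(2 / p + 1)) * 61 ^ (-(p + 1)) by positivity)
  refine tendsto_atTop_mono' _ ?_ h2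
  filter_upwards [eventually_half_lt] with κ h
  have hI : κ ∈ Ico (0 : ℝ) 1 := ⟨by linarith [h.1], h.2⟩
  have hε : 0 < 1 - κ := by linarith [h.2]
  have hS := cosMean_pos (abs_lt_one_of_mem hI) p
  have h3 : C ^ (-(2 / p + 1)) * (1 - κ) ^ ((2 / p + 1) * s) ≤ cosMean p κ ^ (-(2 / p + 1)) := by
    calc _ = (C * (1 - κ) ^ (-s)) ^ (-(2 / p + 1)) := by
          rw [Real.mul_rpow hC0.le (by positivity), ← Real.rpow_mul hε.le]
          ring_nf
      _ ≤ _ := Real.rpow_le_rpow_of_nonpos hS (hC κ hI) (by linarith)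
  have h4 := le_cosMean (p := p + 1) hI (by linarith)
  calc _ = (C ^ (-(2 / p + 1)) * (1 - κ) ^ ((2 / p + 1) * s))
        * (61 ^ (-(p + 1)) * (1 - κ) ^ (1 / 2 - (p + 1))) := by
        rw [show (2 / p + 1) * s - (p + 1 / 2) = (2 / p + 1) * s + (1 / 2 - (p + 1)) by ring,
          Real.rpow_add hε]
        ring
    _ ≤ cosMean p κ ^ (-(2 / p + 1)) * cosMean (p + 1) κ := by gcongr
    _ = _ := by
        rw [show -(2 / p + 1) = -(2 / p) - 1 by ring, Real.rpow_sub_one hS.ne']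
        ring

/-- Here S_p is bounded above and below while p + 1 ≥ 1/2 makes S_(p+1) diverge; the endpoint p =
-1/2, that is `lam = -2`, rests on the logarithm. -/
theorem tendsto_cosMean_ratio_of_neg (h0 : -(1 / 2) ≤ p) (h1 : p < 0) :
    Tendsto (fun κ => cosMean p κ ^ (-(2 / p)) * (cosMean (p + 1) κ / cosMean p κ)) (𝓝[<] 1)
      atTop := by
  have h2 := (tendsto_cosMean_of_half_le (p := p + 1) (by linarith)).const_mul_atTop
    (show (0 : ℝ) < (1 / 2) ^ (-(2 / p)) * (2 ^ (-p))⁻¹ by positivity)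
  refine tendsto_atTop_mono' _ ?_ h2
  filter_upwards [eventually_half_lt] with κ h
  have hI : κ ∈ Ico (0 : ℝ) 1 := ⟨by linarith [h.1], h.2⟩
  have hS := cosMean_pos (abs_lt_one_of_mem hI) p
  have hS1 := cosMean_pos (abs_lt_one_of_mem hI) (p + 1)
  rw [mul_assoc, mul_comm _⁻¹, ← div_eq_mul_inv]
  exact mul_le_mul (le_cosMean_rpow hI h1)
    (div_le_div_of_nonneg_left hS1.le hS (cosMean_le_of_nonpos hI h1.le)) (by positivity)
    (by positivity)

/-- For f < 1 the local term f/(1 - κ f) is bounded above uniformly in κ, so the diverging nonlocal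
ratio decides. -/
theorem tendsto_cosSlope_atBot (h0 : -(1 / 2) ≤ p) (h1 : p < 1) (hp : p ≠ 0) (hf : f < 1) :
    Tendsto (fun κ => cosMean p κ ^ (-(2 / p)) * cosSlope p f κ) (𝓝[<] 1) atBot := by
  have h2 : Tendsto (fun κ => cosMean p κ ^ (-(2 / p)) * (cosMean (p + 1) κ / cosMean p κ))
      (𝓝[<] 1) atTop := (lt_or_gt_of_ne hp).elim (fun h => tendsto_cosMean_ratio_of_neg h0 h)
        fun h => tendsto_cosMean_ratio_of_pos h h1
  refine tendsto_atBot_mono' _ ?_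
    (tendsto_atBot_add_const_right _ (4 * (1 / (1 - f) + 2)) (tendsto_neg_atTop_atBot.comp h2))
  filter_upwards [eventually_half_lt] with κ h
  have hI : κ ∈ Ico (0 : ℝ) 1 := ⟨by linarith [h.1], h.2⟩
  have hI' : κ ∈ Ioo (0 : ℝ) 1 := ⟨by linarith [h.1], h.2⟩
  have hS := cosMean_pos (abs_lt_one_of_mem hI) p
  have hS1 := cosMean_pos (abs_lt_one_of_mem hI) (p + 1)
  set R := cosMean (p + 1) κ / cosMean p κ with hR
  have hR0 : 0 < R := by positivity
  have hf' : 0 < 1 - f := by linarith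
  have hκ0 := hI'.1
  have h3 : R - 2 ≤ (R - 1) / κ := by
    rw [le_div_iff₀ hI'.1]
    nlinarith [h.1, h.2]
  have h4 : cosSlope p f κ ≤ (1 / (1 - f) + 2) - R := by
    rw [cosSlope_eq hI']
    linarith [div_le_of_lt_one hI hf]
  have hρ : 0 < cosMean p κ ^ (-(2 / p)) := by positivity
  have h5 := cosMean_rpow_le_four hI hp
  calc _ ≤ cosMean p κ ^ (-(2 / p)) * ((1 / (1 - f) + 2) - R) := by gcongr
    _ = -(cosMean p κ ^ (-(2 / p)) * R) + cosMean p κ ^ (-(2 / p)) * (1 / (1 - f) + 2) := by ring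
    _ ≤ _ := by
        simp only [Function.comp]
        gcongr

theorem abs_cosSlope_le (h : κ ∈ Ioo (1 / 2 : ℝ) 1) (hf : |f| ≤ 1) :
    |cosSlope p f κ| ≤ 3 / (1 - κ) := by
  have hI : κ ∈ Ico (0 : ℝ) 1 := ⟨by linarith [h.1], h.2⟩
  have hI' : κ ∈ Ioo (0 : ℝ) 1 := ⟨by linarith [h.1], h.2⟩
  have hε : 0 < 1 - κ := by linarith [h.2]
  have hS := cosMean_pos (abs_lt_one_of_mem hI) p
  have hS1 := cosMean_pos (abs_lt_one_of_mem hI) (p + 1)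
  have hκ0 := hI'.1
  have hf1 := abs_le.1 hf
  have h1 : |f / (1 - κ * f)| ≤ 1 / (1 - κ) := by
    have h2 : 0 < 1 - κ * f := by nlinarith [h.2]
    rw [abs_div, abs_of_pos h2]
    gcongr
    nlinarith
  have hR : cosMean (p + 1) κ / cosMean p κ ≤ 1 / (1 - κ) := by
    rw [div_le_iff₀ hS]
    have := cosMean_le_rpow_mul hI (show p ≤ p + 1 by linarith)
    rwa [show -(p + 1 - p) = -1 by ring, Real.rpow_neg_one, inv_eq_one_div] at this
  have hR0 : 0 < cosMean (p + 1) κ / cosMean p κ := by positivity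
  have h1ε : 1 ≤ 1 / (1 - κ) := by rw [le_div_iff₀ hε]; linarith
  have h3 : |(cosMean (p + 1) κ / cosMean p κ - 1) / κ| ≤ 2 / (1 - κ) := by
    rw [abs_div, abs_of_pos hκ0, div_le_iff₀ hκ0]
    have h4 : |cosMean (p + 1) κ / cosMean p κ - 1| ≤ 1 / (1 - κ) :=
      abs_le.2 ⟨by linarith, by linarith⟩
    have h5 : 1 / (1 - κ) ≤ 2 / (1 - κ) * κ := by
      rw [div_mul_eq_mul_div]
      gcongr
      linarith [h.1]
    exact h4.trans h5
  rw [cosSlope_eq hI']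
  refine (abs_sub _ _).trans ((add_le_add h1 h3).trans_eq ?_)
  ring

/-- The growth S_p ≥ c (1-κ)^(1/2-p) leaves the exponent (p - 1/2)(2/p) - 1 = 1 - 1/p, positive
exactly for p > 1. -/
theorem tendsto_cosMean_rpow_div (hp : 1 < p) :
    Tendsto (fun κ => cosMean p κ ^ (-(2 / p)) * (3 / (1 - κ))) (𝓝[<] 1) (𝓝 0) := by
  have hp0 : 0 < p := by linarith
  have h1 : 0 < 1 - 1 / p := by
    rw [sub_pos, div_lt_one hp0]
    exact hp
  have h2 := (tendsto_rpow_one_sub_zero h1).const_mul (3 * (61 ^ (-p)) ^ (-(2 / p)))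
  rw [mul_zero] at h2
  refine squeeze_zero' ?_ ?_ h2
  · filter_upwards [eventually_half_lt] with κ h
    have hI : κ ∈ Ico (0 : ℝ) 1 := ⟨by linarith [h.1], h.2⟩
    have hε : 0 < 1 - κ := by linarith [h.2]
    have hS := cosMean_pos (abs_lt_one_of_mem hI) p
    positivity
  · filter_upwards [eventually_half_lt] with κ h
    have hI : κ ∈ Ico (0 : ℝ) 1 := ⟨by linarith [h.1], h.2⟩
    have hε : 0 < 1 - κ := by linarith [h.2]
    have hp2 : 0 < 2 / p := by positivity
    have h3 : cosMean p κ ^ (-(2 / p)) ≤ (61 ^ (-p) * (1 - κ) ^ (1 / 2 - p)) ^ (-(2 / p)) :=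
      Real.rpow_le_rpow_of_nonpos (by positivity) (le_cosMean hI hp0.le) (by linarith)
    calc _ ≤ (61 ^ (-p) * (1 - κ) ^ (1 / 2 - p)) ^ (-(2 / p)) * (3 / (1 - κ)) := by gcongr
      _ = 3 * (61 ^ (-p)) ^ (-(2 / p)) * (1 - κ) ^ ((1 / 2 - p) * -(2 / p) - 1) := by
          rw [Real.mul_rpow (by positivity) (by positivity), ← Real.rpow_mul hε.le,
            Real.rpow_sub_one hε.ne']
          ring
      _ = _ := by
          congr 2
          field_simp
          ring

/-- Growth of the time scale for `p ≥ 1`. -/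
theorem exists_le_cosMean_rpow (hp : 1 ≤ p) :
    ∃ c, 0 < c ∧ ∀ κ ∈ Ico (0 : ℝ) 1, c * (1 - κ)⁻¹ ≤ cosMean p κ ^ (2 / p) := by
  have hp0 : 0 < p := by linarith
  refine ⟨(61 ^ (-p)) ^ (2 / p), by positivity, fun κ h => ?_⟩
  have hε : 0 < 1 - κ := by linarith [h.2]
  have h1 : (61 ^ (-p) * (1 - κ) ^ (1 / 2 - p)) ^ (2 / p) ≤ cosMean p κ ^ (2 / p) :=
    Real.rpow_le_rpow (by positivity) (le_cosMean h hp0.le) (by positivity)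
  refine le_trans ?_ h1
  rw [Real.mul_rpow (by positivity) (by positivity), ← Real.rpow_mul hε.le, ← Real.rpow_neg_one]
  gcongr ?_ * ?_
  refine Real.rpow_le_rpow_of_exponent_ge hε (by linarith [h.1]) ?_
  have : (1 / 2 - p) * (2 / p) = 1 / p - 2 := by
    field_simp
  rw [this]
  have : 1 / p ≤ 1 := (div_le_one hp0).2 hp
  linarith

/-- Growth of the time scale for `p < 1`. -/
theorem exists_cosMean_rpow_le (hp : p < 1) (h0 : p ≠ 0) :
    ∃ r C : ℝ, 0 < C ∧ r < 1 ∧ ∀ κ ∈ Ico (0 : ℝ) 1, cosMean p κ ^ (2 / p) ≤ C * (1 - κ) ^ (-r) := by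
  rcases lt_or_gt_of_ne h0 with h | h
  · refine ⟨0, (1 / 2) ^ (2 / p), by positivity, one_pos, fun κ hκ => ?_⟩
    have : 2 / p < 0 := div_neg_of_pos_of_neg two_pos h
    rw [neg_zero, Real.rpow_zero, mul_one]
    exact Real.rpow_le_rpow_of_nonpos (by norm_num) (half_le_cosMean hκ h.le) this.le
  · obtain ⟨s, C, hC0, hs, -, hC⟩ := exists_cosMean_growth h hp
    refine ⟨2 / p * s, C ^ (2 / p), by positivity, hs, fun κ hκ => ?_⟩
    have hε : 0 < 1 - κ := by linarith [hκ.2]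
    have hS := cosMean_pos (abs_lt_one_of_mem hκ) p
    calc _ ≤ (C * (1 - κ) ^ (-s)) ^ (2 / p) := by
          exact Real.rpow_le_rpow hS.le (hC κ hκ) (by positivity)
      _ = _ := by
          rw [Real.mul_rpow hC0.le (by positivity), ← Real.rpow_mul hε.le]
          ring_nf

/-- Boundedness for `p < -1/2`. -/
theorem exists_cosMean_succ_bound (hp : p < -(1 / 2)) :
    ∃ C : ℝ, 0 < C ∧ ∀ κ ∈ Ico (0 : ℝ) 1, cosMean (p + 1) κ ≤ C := by
  rcases le_total 0 (p + 1) with h | h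
  · exact exists_cosMean_le h (by linarith)
  · exact ⟨2 ^ (-(p + 1)), by positivity, fun κ hκ => cosMean_le_of_nonpos hκ h⟩

end Asymptotics


/-! ### Inverse functions and images of half-open intervals -/

section Inverse

theorem sub_le_sub_of_deriv_le {f g f' g' : ℝ → ℝ} {b : ℝ} (hb : 0 ≤ b)
    (hf : ∀ x ∈ Icc 0 b, HasDerivAt f (f' x) x) (hg : ∀ x ∈ Icc 0 b, HasDerivAt g (g' x) x)
    (h : ∀ x ∈ Icc 0 b, f' x ≤ g' x) : f b - f 0 ≤ g b - g 0 := by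
  rcases hb.eq_or_lt with rfl | hb
  · simp
  obtain ⟨ξ, hξ, hξ'⟩ := exists_hasDerivAt_eq_slope (fun x => g x - f x) (fun x => g' x - f' x) hb
    (fun x hx => ((hg x hx).sub (hf x hx)).continuousAt.continuousWithinAt)
    (fun x hx => (hg x (Ioo_subset_Icc_self hx)).sub (hf x (Ioo_subset_Icc_self hx)))
  have h1 := h ξ (Ioo_subset_Icc_self hξ)
  rw [sub_zero, eq_div_iff hb.ne'] at hξ'
  have : 0 ≤ (g' ξ - f' ξ) * b := mul_nonneg (by linarith) hb.le
  linarith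

theorem strictMonoOn_of_hasDerivAt {T T' : ℝ → ℝ} {s : Set ℝ} (hs : s.OrdConnected)
    (hT : ∀ x ∈ s, HasDerivAt T (T' x) x) (hpos : ∀ x ∈ s, 0 < T' x) : StrictMonoOn T s :=
  strictMonoOn_of_deriv_pos hs.convex (fun x hx => (hT x hx).continuousAt.continuousWithinAt)
    fun x hx => by
      rw [(hT x (interior_subset hx)).deriv]
      exact hpos x (interior_subset hx)

/-- The inverse of a function with positive derivative on an open interval. -/
theorem exists_hasDerivAt_inverse {T T' : ℝ → ℝ} {s : Set ℝ} (hso : IsOpen s)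
    (hs : s.OrdConnected) (hT : ∀ x ∈ s, HasDerivAt T (T' x) x) (hpos : ∀ x ∈ s, 0 < T' x) :
    ∃ θ : ℝ → ℝ, ∀ x ∈ s, θ (T x) = x ∧ HasDerivAt θ (T' x)⁻¹ (T x) := by
  have hmono := strictMonoOn_of_hasDerivAt hs hT hpos
  have hleft := hmono.injOn.leftInvOn_invFunOn
  have hnhds : ∀ x ∈ s, T '' s ∈ 𝓝 (T x) := fun x hx => by
    obtain ⟨r, hr, hrs⟩ := Metric.nhds_basis_closedBall.mem_iff.1 (hso.mem_nhds hx)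
    rw [Real.closedBall_eq_Icc] at hrs
    have ha : x - r ∈ s := hrs ⟨le_rfl, by linarith⟩
    have hb : x + r ∈ s := hrs ⟨by linarith, le_rfl⟩
    refine mem_of_superset (Icc_mem_nhds (hmono ha hx (by linarith)) (hmono hx hb (by linarith)))
      ((intermediate_value_Icc (by linarith) fun y hy => ?_).trans (image_mono hrs))
    exact (hT y (hrs hy)).continuousAt.continuousWithinAt
  refine ⟨Function.invFunOn T s, fun x hx => ⟨hleft hx, ?_⟩⟩
  have hmono' : StrictMonoOn (Function.invFunOn T s) (T '' s) := by
    rintro _ ⟨y, hy, rfl⟩ _ ⟨z, hz, rfl⟩ hlt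
    rw [hleft hy, hleft hz]
    exact (hmono.lt_iff_lt hy hz).1 hlt
  have hcont : ContinuousAt (Function.invFunOn T s) (T x) := by
    refine hmono'.continuousAt_of_image_mem_nhds (hnhds x hx) ?_
    rw [hleft hx, hleft.image_image]
    exact hso.mem_nhds hx
  have h1 : HasDerivAt T (T' x) (Function.invFunOn T s (T x)) := by
    rw [hleft hx]
    exact hT x hx
  refine h1.of_local_left_inverse hcont (hpos x hx).ne' ?_
  filter_upwards [hnhds x hx] with y hy
  obtain ⟨z, hz, rfl⟩ := hy
  rw [hleft hz]

theorem image_Ico_of_bddAbove {T : ℝ → ℝ} {b : ℝ} (hb : 0 < b) (hT : ContinuousOn T (Ico 0 b))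
    (hmono : StrictMonoOn T (Ico 0 b)) (h0 : T 0 = 0) (hbd : BddAbove (T '' Ico 0 b)) :
    ∃ τ, 0 < τ ∧ T '' Ico 0 b = Ico 0 τ := by
  have hz : (0 : ℝ) ∈ Ico 0 b := ⟨le_rfl, hb⟩
  have hlt : ∀ x ∈ Ico 0 b, T x < sSup (T '' Ico 0 b) := fun x hx => by
    have hm : (x + b) / 2 ∈ Ico 0 b := ⟨by linarith [hx.1, hx.2], by linarith [hx.2]⟩
    exact (hmono hx hm (by linarith [hx.2])).trans_le (le_csSup hbd ⟨_, hm, rfl⟩)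
  refine ⟨sSup (T '' Ico 0 b), h0.symm.trans_lt (hlt 0 hz), Subset.antisymm ?_ ?_⟩
  · rintro _ ⟨x, hx, rfl⟩
    exact ⟨h0.symm.trans_le (hmono.monotoneOn hz hx hx.1), hlt x hx⟩
  · rintro y ⟨hy0, hy⟩
    obtain ⟨_, ⟨x, hx, rfl⟩, hyx⟩ := exists_lt_of_lt_csSup ⟨_, mem_image_of_mem T hz⟩ hy
    have hsub : Icc 0 x ⊆ Ico 0 b := fun z hz => ⟨hz.1, hz.2.trans_lt hx.2⟩
    obtain ⟨z, hz, rfl⟩ := intermediate_value_Icc hx.1 (hT.mono hsub)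
      (show y ∈ Icc (T 0) (T x) from ⟨h0.trans_le hy0, hyx.le⟩)
    exact ⟨z, hsub hz, rfl⟩

theorem image_Ico_of_unbounded {T : ℝ → ℝ} {b : ℝ} (hb : 0 < b) (hT : ContinuousOn T (Ico 0 b))
    (hmono : StrictMonoOn T (Ico 0 b)) (h0 : T 0 = 0) (hbd : ∀ M, ∃ x ∈ Ico 0 b, M ≤ T x) :
    T '' Ico 0 b = Ici 0 := by
  have hz : (0 : ℝ) ∈ Ico 0 b := ⟨le_rfl, hb⟩
  refine Subset.antisymm ?_ fun y hy => ?_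
  · rintro _ ⟨x, hx, rfl⟩
    exact h0.symm.trans_le (hmono.monotoneOn hz hx hx.1)
  · obtain ⟨x, hx, hyx⟩ := hbd y
    have hsub : Icc 0 x ⊆ Ico 0 b := fun z hz => ⟨hz.1, hz.2.trans_lt hx.2⟩
    obtain ⟨z, hz, rfl⟩ := intermediate_value_Icc hx.1 (hT.mono hsub)
      (show y ∈ Icc (T 0) (T x) from ⟨h0.trans_le hy, hyx⟩)
    exact ⟨z, hsub hz, rfl⟩

end Inverse

/-! ### The time scale: finite or infinite, and its inverse -/

section TimeScale

variable {lam η : ℝ}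

theorem labelWeight_eq (h0 : lam ≠ 0) (x η : ℝ) :
    labelWeight lam x η = (1 - lam * η * datumSlope x) ^ (-(1 / lam)) := by
  rw [labelWeight, weight, if_neg h0, mul_assoc, neg_div]

theorem meanWeight_eq (h0 : lam ≠ 0) (η : ℝ) :
    meanWeight lam η = cosMean (1 / lam) (lam * η) := by
  simp only [meanWeight, labelWeight_eq h0, cosMean]

theorem labelSlope_mul_labelWeight (h0 : lam ≠ 0) (h : η ∈ weightDomain lam) (x : ℝ) :
    labelSlope lam x η * labelWeight lam x η =
      datumSlope x * (1 - lam * η * datumSlope x) ^ (-(1 / lam + 1)) := by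
  have hx := one_sub_mul_pos h x
  rw [labelWeight_eq h0, labelSlope, neg_add, ← sub_eq_add_neg, Real.rpow_sub_one hx.ne',
    ← mul_assoc lam]
  ring

theorem mul_meanWeight₁ (h0 : lam ≠ 0) (h : η ∈ weightDomain lam) :
    lam * η * meanWeight₁ lam η =
      cosMean (1 / lam + 1) (lam * η) - cosMean (1 / lam) (lam * η) := by
  have := mul_integral_datumSlope_mul h (1 / lam + 1)
  rw [add_sub_cancel_right] at this
  rw [← this, meanWeight₁]
  simp only [labelSlope_mul_labelWeight h0 h]

theorem abs_meanWeight₁_le (h0 : lam ≠ 0) (h : η ∈ weightDomain lam) :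
    |meanWeight₁ lam η| ≤ cosMean (1 / lam + 1) (lam * η) := by
  rw [meanWeight₁, cosMean]
  refine (intervalIntegral.abs_integral_le_integral_abs zero_le_one).trans
    (intervalIntegral.integral_mono_on zero_le_one ?_
      (intervalIntegrable_rpow_one_sub h _ _ _) fun x _ => ?_)
  · exact ((continuous_labelSlope_left h).mul
      (continuous_labelWeight_left h)).abs.intervalIntegrable _ _
  · have hx := Real.rpow_nonneg (one_sub_mul_pos h x).le (-(1 / lam + 1))
    rw [labelSlope_mul_labelWeight h0 h, abs_mul, abs_of_nonneg hx]
    exact mul_le_of_le_one_left hx (abs_datumSlope_le_one x)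

theorem mem_weightDomain_iff (h0 : lam ≠ 0) (hη : 0 ≤ η) :
    η ∈ weightDomain lam ↔ η < 1 / |lam| := by
  rw [lt_div_iff₀ (abs_pos.2 h0), mul_comm, weightDomain, mem_ofPred_eq, abs_mul, abs_of_nonneg hη]

theorem abs_mul_mem (h : η ∈ weightDomain lam) (hη : 0 ≤ η) : |lam| * η ∈ Ico (0 : ℝ) 1 := by
  refine ⟨by positivity, ?_⟩
  have : |lam * η| < 1 := h
  rwa [abs_mul, abs_of_nonneg hη] at this

theorem cosMean_abs_mul (p : ℝ) (hη : 0 ≤ η) : cosMean p (|lam| * η) = cosMean p (lam * η) := by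
  rw [← cosMean_abs p (lam * η), abs_mul, abs_of_nonneg hη]

/-- The sign of `lam`. -/
def sgn (lam : ℝ) : ℝ := lam / |lam|

theorem sgn_of_pos (h : 0 < lam) : sgn lam = 1 := by rw [sgn, abs_of_pos h, div_self h.ne']

theorem sgn_of_neg (h : lam < 0) : sgn lam = -1 := by
  rw [sgn, abs_of_neg h, div_neg, div_self h.ne]

/-- Evenness of `cosMean` in κ trades the sign of `lam` for a sign of the datum slope and an overall
sign; for negative `lam` maximum and minimum points change roles. -/
theorem slope_eq_cosSlope (h0 : lam ≠ 0) (h : η ∈ weightDomain lam) (hη : 0 < η) (x : ℝ) :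
    meanWeight lam η ^ (-(2 * lam)) * flowSlope lam x η =
      sgn lam * (cosMean (1 / lam) (|lam| * η) ^ (-(2 / (1 / lam)))
        * cosSlope (1 / lam) (sgn lam * datumSlope x) (|lam| * η)) := by
  have hm := mul_meanWeight₁ h0 h
  have hS := cosMean_pos h (1 / lam)
  have e : 2 / (1 / lam) = 2 * lam := by field_simp
  rw [cosMean_abs_mul _ hη.le, e, ← meanWeight_eq h0, flowSlope, labelSlope, cosSlope,
    cosMean_abs_mul _ hη.le, cosMean_abs_mul _ hη.le, ← hm, ← meanWeight_eq h0]
  rw [← meanWeight_eq h0] at hS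
  have hx := den_pos h x
  rcases lt_or_gt_of_ne h0 with h1 | h1
  · rw [sgn_of_neg h1, abs_of_neg h1]
    have e1 : 1 - -lam * η * (-1 * datumSlope x) = 1 - lam * (η * datumSlope x) := by ring
    rw [e1]
    field_simp
    ring
  · rw [sgn_of_pos h1, abs_of_pos h1]
    have e1 : 1 - lam * η * (1 * datumSlope x) = 1 - lam * (η * datumSlope x) := by ring
    rw [e1]
    field_simp

/-- The time as a function of the parameter `η`. -/
def timeScale (lam η : ℝ) : ℝ := ∫ s in (0 : ℝ)..η, meanWeight lam s ^ (2 * lam)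

theorem ordConnected_weightDomain (lam : ℝ) : (weightDomain lam).OrdConnected := by
  refine Convex.ordConnected fun a ha b hb s t hs ht hst => ?_
  have ha' : |lam * a| < 1 := ha
  have hb' : |lam * b| < 1 := hb
  rw [abs_lt] at ha' hb'
  change |lam * (s * a + t * b)| < 1
  rw [abs_lt]
  rcases hs.eq_or_lt with rfl | hs'
  · obtain rfl : t = 1 := by linarith
    constructor <;> linarith
  · constructor <;> nlinarith

theorem hasDerivAt_timeScale (h : η ∈ weightDomain lam) :
    HasDerivAt (timeScale lam) (meanWeight lam η ^ (2 * lam)) η := by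
  have hc : ContinuousOn (fun s => meanWeight lam s ^ (2 * lam)) (weightDomain lam) :=
    (continuousOn_meanWeight lam).rpow_const fun s hs => Or.inl (meanWeight_pos hs).ne'
  refine intervalIntegral.integral_hasDerivAt_right (ContinuousOn.intervalIntegrable
    (hc.mono ((ordConnected_weightDomain lam).uIcc_subset (zero_mem_weightDomain lam) h)))
    (hc.stronglyMeasurableAtFilter (isOpen_weightDomain lam) η h)
    (hc.continuousAt ((isOpen_weightDomain lam).mem_nhds h))

theorem timeScale_zero (lam : ℝ) : timeScale lam 0 = 0 := by simp [timeScale]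

theorem strictMonoOn_timeScale (lam : ℝ) : StrictMonoOn (timeScale lam) (weightDomain lam) :=
  strictMonoOn_of_hasDerivAt (ordConnected_weightDomain lam) (fun _ h => hasDerivAt_timeScale h)
    fun _ h => Real.rpow_pos_of_pos (meanWeight_pos h) _

theorem meanWeight_rpow_eq (h0 : lam ≠ 0) (hη : 0 ≤ η) :
    meanWeight lam η ^ (2 * lam) = cosMean (1 / lam) (|lam| * η) ^ (2 / (1 / lam)) := by
  rw [meanWeight_eq h0, cosMean_abs_mul _ hη]
  congr 1
  field_simp

theorem Ico_subset_weightDomain (h0 : lam ≠ 0) : Ico 0 (1 / |lam|) ⊆ weightDomain lam :=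
  fun _ hη => (mem_weightDomain_iff h0 hη.1).2 hη.2

theorem hasDerivAt_one_sub_abs_mul (lam η : ℝ) :
    HasDerivAt (fun s : ℝ => 1 - |lam| * s) (-|lam|) η := by
  simpa using ((hasDerivAt_id η).const_mul |lam|).const_sub 1

theorem one_div_lt_one_iff (h0 : lam ≠ 0) : 1 / lam < 1 ↔ lam ∉ Icc (0 : ℝ) 1 := by
  rcases lt_or_gt_of_ne h0 with h | h
  · have : 1 / lam < 0 := div_neg_of_pos_of_neg one_pos h
    simp only [mem_Icc, not_and_or, not_le]
    exact ⟨fun _ => Or.inl h, fun _ => by linarith⟩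
  · rw [div_lt_one h]
    simp only [mem_Icc, not_and_or, not_le, h.not_gt, false_or]

theorem exists_image_timeScale (h0 : lam ≠ 0) (h1 : lam ∉ Icc (0 : ℝ) 1) :
    ∃ τ, 0 < τ ∧ timeScale lam '' Ico 0 (1 / |lam|) = Ico 0 τ := by
  have hl := abs_pos.2 h0
  have hsub := Ico_subset_weightDomain h0
  obtain ⟨r, C, hC0, hr, hC⟩ := exists_cosMean_rpow_le ((one_div_lt_one_iff h0).2 h1)
    (one_div_ne_zero h0)
  refine image_Ico_of_bddAbove (by positivity)
    (fun η h => (hasDerivAt_timeScale (hsub h)).continuousAt.continuousWithinAt)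
    ((strictMonoOn_timeScale lam).mono hsub) (timeScale_zero lam) ?_
  have hr' : 0 < 1 - r := by linarith
  refine ⟨C / (|lam| * (1 - r)), ?_⟩
  rintro _ ⟨η, hη, rfl⟩
  have hpos : ∀ s ∈ Icc 0 η, 0 < 1 - |lam| * s := fun s hs => by
    have := (abs_mul_mem (hsub ⟨hs.1, hs.2.trans_lt hη.2⟩) hs.1).2
    linarith
  -- The speed of time is at most `C * (1 - |lam| * s) ^ (-r)` with `r < 1`, whose primitive stays
  -- bounded.
  have key := sub_le_sub_of_deriv_le hη.1 (f := timeScale lam)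
    (g := fun s => -(C / (|lam| * (1 - r))) * (1 - |lam| * s) ^ (1 - r))
    (g' := fun s => C * (1 - |lam| * s) ^ (-r))
    (fun s hs => hasDerivAt_timeScale (hsub ⟨hs.1, hs.2.trans_lt hη.2⟩))
    (fun s hs => by
      refine (((hasDerivAt_one_sub_abs_mul lam s).rpow_const
        (Or.inl (hpos s hs).ne')).const_mul _).congr_deriv ?_
      rw [show 1 - r - 1 = -r by ring]
      field_simp)
    (fun s hs => by
      rw [meanWeight_rpow_eq h0 hs.1]
      exact hC _ (abs_mul_mem (hsub ⟨hs.1, hs.2.trans_lt hη.2⟩) hs.1))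
  rw [timeScale_zero, mul_zero, sub_zero, sub_zero, Real.one_rpow] at key
  have : 0 ≤ C / (|lam| * (1 - r)) * (1 - |lam| * η) ^ (1 - r) :=
    mul_nonneg (by positivity) (Real.rpow_nonneg (hpos η ⟨hη.1, le_rfl⟩).le _)
  linarith

theorem image_timeScale_of_mem (h : lam ∈ Ioc (0 : ℝ) 1) :
    timeScale lam '' Ico 0 (1 / |lam|) = Ici 0 := by
  have h0 : lam ≠ 0 := h.1.ne'
  have hl := abs_pos.2 h0
  have hsub := Ico_subset_weightDomain h0
  obtain ⟨c, hc0, hc⟩ := exists_le_cosMean_rpow (p := 1 / lam) ((one_le_div h.1).2 h.2)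
  refine image_Ico_of_unbounded (by positivity)
    (fun η h => (hasDerivAt_timeScale (hsub h)).continuousAt.continuousWithinAt)
    ((strictMonoOn_timeScale lam).mono hsub) (timeScale_zero lam) fun M => ?_
  -- Time grows at least like `-(c / |lam|) * log (1 - |lam| * η)`; this `ε` makes that lower bound
  -- equal to `|M|`.
  set ε := Real.exp (-(|M| * |lam| / c)) with hε
  have hε0 : 0 < ε := Real.exp_pos _
  have hε1 : ε ≤ 1 := Real.exp_le_one_iff.2 (neg_nonpos.2 (by positivity))
  have hη : (1 - ε) / |lam| ∈ Ico 0 (1 / |lam|) :=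
    ⟨div_nonneg (by linarith) hl.le, by gcongr; linarith⟩
  refine ⟨_, hη, ?_⟩
  have hpos : ∀ s ∈ Icc 0 ((1 - ε) / |lam|), 0 < 1 - |lam| * s := fun s hs => by
    have := (abs_mul_mem (hsub ⟨hs.1, hs.2.trans_lt hη.2⟩) hs.1).2
    linarith
  have key := sub_le_sub_of_deriv_le hη.1 (g := timeScale lam)
    (f := fun s => -(c / |lam|) * Real.log (1 - |lam| * s))
    (f' := fun s => c * (1 - |lam| * s)⁻¹)
    (fun s hs => by
      refine (((hasDerivAt_one_sub_abs_mul lam s).log (hpos s hs).ne').const_mul _).congr_deriv ?_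
      have := (hpos s hs).ne'
      field_simp)
    (fun s hs => hasDerivAt_timeScale (hsub ⟨hs.1, hs.2.trans_lt hη.2⟩))
    (fun s hs => by
      rw [meanWeight_rpow_eq h0 hs.1]
      exact hc _ (abs_mul_mem (hsub ⟨hs.1, hs.2.trans_lt hη.2⟩) hs.1))
  have e : 1 - |lam| * ((1 - ε) / |lam|) = ε := by
    field_simp
    ring
  rw [timeScale_zero, mul_zero, sub_zero, sub_zero, Real.log_one, mul_zero, sub_zero, e, hε,
    Real.log_exp] at key
  have e2 : -(c / |lam|) * -(|M| * |lam| / c) = |M| := by field_simp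
  rw [e2] at key
  exact (le_abs_self M).trans key

/-- Existence of a zero mean solution, at rest at the origin, on the image of the time scale. -/
theorem exists_solution_of_image (h0 : lam ≠ 0) {J : Set ℝ} (hJ : IsTimeInterval J)
    (himg : timeScale lam '' Ico 0 (1 / |lam|) = J) :
    ∃ u, IsClassicalSolution lam datum J u ∧ HasZeroMean J u ∧ ∀ t ∈ J, u 0 t = 0 := by
  obtain ⟨θ, hθ⟩ := exists_hasDerivAt_inverse (isOpen_weightDomain lam)
    (ordConnected_weightDomain lam) (fun _ h => hasDerivAt_timeScale h)
    (fun _ h => Real.rpow_pos_of_pos (meanWeight_pos h) (2 * lam))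
  have hmem : ∀ t ∈ J, θ t ∈ weightDomain lam ∧
      HasDerivAt θ (meanWeight lam (θ t) ^ (-(2 * lam))) t := fun t ht => by
    rw [← himg] at ht
    obtain ⟨η, hη, rfl⟩ := ht
    have hη' := Ico_subset_weightDomain h0 hη
    obtain ⟨h1, h2⟩ := hθ η hη'
    rw [h1, Real.rpow_neg (meanWeight_pos hη').le]
    exact ⟨hη', h2⟩
  have h0 : θ 0 = 0 := by
    have := (hθ 0 (zero_mem_weightDomain lam)).1
    rwa [timeScale_zero] at this
  obtain ⟨h1, h2⟩ := isClassicalSolution_solution hJ (fun t ht => (hmem t ht).1) h0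
    (fun t ht => (hmem t ht).2.continuousAt.continuousWithinAt) fun t ht _ => (hmem t ht).2
  refine ⟨solution lam θ, h1, h2, fun t ht => ?_⟩
  have := baseVel_neg (hmem t ht).1 0
  rw [neg_zero] at this
  rw [solution, self_eq_neg.1 this, mul_zero]

theorem exists_solution_zero :
    ∃ u, IsClassicalSolution 0 datum (Ici 0) u ∧ HasZeroMean (Ici 0) u := by
  refine ⟨solution 0 id, isClassicalSolution_solution (Or.inl rfl) (fun t _ => ?_) rfl
    continuousOn_id fun t _ _ => ?_⟩
  · simp [weightDomain]
  · simpa using hasDerivAt_id t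

namespace IsClassicalSolution

variable {J : Set ℝ} {u γ : ℝ → ℝ → ℝ} (hJ : IsTimeInterval J)
  (hu : IsClassicalSolution lam datum J u) (hγ : IsCharacteristicFlow J u γ)
include hJ hu hγ

/-- The new time is thereby a function of `t` and `lam` only, the same for all solutions; uniqueness
and the uniform asymptotic statements rest on this. -/
theorem timeScale_timeChange (h0 : lam ≠ 0) {t : ℝ} (ht : t ∈ J) :
    timeScale lam (timeChange lam u γ t) = t := by
  have hc : ContinuousOn (timeScale lam) (weightDomain lam) :=
    fun η h => (hasDerivAt_timeScale h).continuousAt.continuousWithinAt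
  have h := hJ.eq_of_hasDerivAt_zero (g := fun t => timeScale lam (timeChange lam u γ t) - t)
    ((hc.comp (continuousOn_timeChange hJ hu hγ) fun t ht =>
      timeChange_mem hJ hu hγ ht).sub continuousOn_id)
    (fun t ht htp => by
      have hm := timeChange_mem hJ hu hγ ht
      refine (((hasDerivAt_timeScale hm).comp t
        (hasDerivAt_timeChange hJ hu hγ h0 ht htp)).sub (hasDerivAt_id t)).congr_deriv ?_
      rw [← Real.rpow_add (meanWeight_pos hm), add_neg_cancel, Real.rpow_zero, sub_self]) ht
  simp only [timeChange_zero, timeScale_zero, sub_zero] at h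
  linarith

theorem timeChange_pos (h0 : lam ≠ 0) {t : ℝ} (ht : t ∈ J) (htp : 0 < t) :
    0 < timeChange lam u γ t := by
  refine ((strictMonoOn_timeScale lam).lt_iff_lt (zero_mem_weightDomain lam)
    (timeChange_mem hJ hu hγ ht)).1 ?_
  rwa [timeScale_zero, timeScale_timeChange hJ hu hγ h0 ht]

theorem timeChange_nonneg (h0 : lam ≠ 0) {t : ℝ} (ht : t ∈ J) : 0 ≤ timeChange lam u γ t := by
  rcases (hJ.nonneg ht).eq_or_lt with rfl | h
  · rw [timeChange_zero]
  · exact (timeChange_pos hJ hu hγ h0 ht h).le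

/-- The parameter `|lam| * timeChange` tends to one at the end of the time interval. -/
theorem tendsto_timeChange (h0 : lam ≠ 0) {l : Filter ℝ}
    (hl : ∀ s ∈ timeScale lam '' Ico 0 (1 / |lam|), ∀ᶠ t in l, s < t ∧ t ∈ J) :
    Tendsto (fun t => |lam| * timeChange lam u γ t) l (𝓝[<] 1) := by
  have hlam := abs_pos.2 h0
  have hlt : ∀ t ∈ J, |lam| * timeChange lam u γ t < 1 := fun t ht =>
    (abs_mul_mem (timeChange_mem hJ hu hγ ht) (timeChange_nonneg hJ hu hγ h0 ht)).2
  have hz : (0 : ℝ) ∈ Ico 0 (1 / |lam|) := ⟨le_rfl, by positivity⟩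
  refine tendsto_nhdsWithin_iff.2 ⟨tendsto_order.2 ⟨fun a ha => ?_, fun a ha => ?_⟩, ?_⟩
  · have hm : max 0 (a / |lam|) ∈ Ico 0 (1 / |lam|) :=
      ⟨le_max_left _ _, max_lt hz.2 (by gcongr)⟩
    filter_upwards [hl _ ⟨_, hm, rfl⟩] with t ht
    have h1 : max 0 (a / |lam|) < timeChange lam u γ t := by
      refine ((strictMonoOn_timeScale lam).lt_iff_lt (Ico_subset_weightDomain h0 hm)
        (timeChange_mem hJ hu hγ ht.2)).1 ?_
      rw [timeScale_timeChange hJ hu hγ h0 ht.2]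
      exact ht.1
    rw [mul_comm]
    exact (div_lt_iff₀ hlam).1 ((le_max_right _ _).trans_lt h1)
  · filter_upwards [hl _ ⟨_, hz, rfl⟩] with t ht
    exact (hlt t ht.2).trans ha
  · filter_upwards [hl _ ⟨_, hz, rfl⟩] with t ht using hlt t ht.2

theorem ux_flow_eq_cosSlope (h0 : lam ≠ 0) {α t : ℝ} (hα : α ∈ Icc (0 : ℝ) 1) (ht : t ∈ J)
    (htp : 0 < t) :
    ux u (γ α t) t = sgn lam * (cosMean (1 / lam) (|lam| * timeChange lam u γ t)
      ^ (-(2 / (1 / lam))) * cosSlope (1 / lam) (sgn lam * datumSlope α)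
        (|lam| * timeChange lam u γ t)) := by
  rw [ux_flow hJ hu hγ h0 hα ht, slope_eq_cosSlope h0 (timeChange_mem hJ hu hγ ht)
    (timeChange_pos hJ hu hγ h0 ht htp)]

end IsClassicalSolution

end TimeScale


/-! ### Extreme points of the slope of the datum -/

section ExtremePoints

theorem mem_maxPoints_datum {α : ℝ} :
    α ∈ maxPoints datum ↔ α ∈ Icc (0 : ℝ) 1 ∧ datumSlope α = 1 := by
  rw [maxPoints, deriv_datum]
  refine and_congr_right fun _ => ⟨fun h => ?_, fun h β _ => ?_⟩
  · have := h (left_mem_Icc.2 zero_le_one)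
    rw [mem_ofPred_eq, datumSlope_zero] at this
    exact le_antisymm (datumSlope_le_one α) this
  · rw [mem_ofPred_eq, h]
    exact datumSlope_le_one β

theorem mem_minPoints_datum {α : ℝ} :
    α ∈ minPoints datum ↔ α ∈ Icc (0 : ℝ) 1 ∧ datumSlope α = -1 := by
  rw [minPoints, deriv_datum]
  refine and_congr_right fun _ => ⟨fun h => ?_, fun h β _ => ?_⟩
  · have := h IsClassicalSolution.half_mem
    rw [mem_ofPred_eq, datumSlope_half] at this
    exact le_antisymm this (neg_one_le_datumSlope α)
  · rw [mem_ofPred_eq, h]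
    exact neg_one_le_datumSlope β

theorem exists_int_of_cos_eq_one {α : ℝ} (h : Real.cos (2 * Real.pi * α) = 1) :
    ∃ n : ℤ, α = n := by
  obtain ⟨n, hn⟩ := (Real.cos_eq_one_iff _).1 h
  refine ⟨n, ?_⟩
  have hπ : 2 * Real.pi ≠ 0 := by positivity
  exact mul_left_cancel₀ hπ (by rw [← hn, mul_comm])

theorem datumSlope_eq_one_iff {α : ℝ} : datumSlope α = 1 ↔ Real.cos (2 * Real.pi * α) = 1 := by
  rw [datumSlope]
  exact ⟨fun h => (show Odd 3 by decide).strictMono_pow.injective (h.trans (one_pow 3).symm),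
    fun h => by rw [h, one_pow]⟩

theorem exists_int_of_datumSlope_eq_one {α : ℝ} (h : datumSlope α = 1) : ∃ n : ℤ, α = n :=
  exists_int_of_cos_eq_one (datumSlope_eq_one_iff.1 h)

theorem finite_maxPoints_datum : (maxPoints datum).Finite := by
  refine (Set.toFinite {0, 1}).subset fun α hα => ?_
  obtain ⟨⟨h0, h1⟩, h⟩ := mem_maxPoints_datum.1 hα
  obtain ⟨n, rfl⟩ := exists_int_of_datumSlope_eq_one h
  have h0' : 0 ≤ n := by exact_mod_cast h0
  have h1' : n ≤ 1 := by exact_mod_cast h1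
  interval_cases n <;> simp

theorem finite_minPoints_datum : (minPoints datum).Finite := by
  refine (Set.toFinite {1 / 2}).subset fun α hα => ?_
  obtain ⟨⟨h0, h1⟩, h⟩ := mem_minPoints_datum.1 hα
  obtain ⟨n, hn⟩ := exists_int_of_datumSlope_eq_one (α := α + 1 / 2)
    (by rw [datumSlope_add_half, h, neg_neg])
  have h0' : (0 : ℝ) < n := by linarith
  have h1' : (n : ℝ) < 2 := by linarith
  have h0'' : 0 < n := by exact_mod_cast h0'
  have h1'' : n < 2 := by exact_mod_cast h1'
  obtain rfl : n = 1 := by omega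
  push_cast at hn
  rw [mem_singleton_iff]
  linarith

end ExtremePoints

/-! ### Extremal slopes and uniqueness under zero mean -/

namespace IsClassicalSolution

variable {lam : ℝ} {J : Set ℝ} {u γ : ℝ → ℝ → ℝ}

section Label

variable (hJ : IsTimeInterval J) (hu : IsClassicalSolution lam datum J u)
  (hγ : IsCharacteristicFlow J u γ)
include hJ hu hγ

/-- The characteristics with labels in `[0, 1]` cover a period. -/
theorem exists_flow_eq (h0 : lam ≠ 0) {t : ℝ} (ht : t ∈ J) {E : Type*} {h : ℝ → E}
    (hp : Function.Periodic h 1) (x : ℝ) : ∃ α ∈ Icc (0 : ℝ) 1, h x = h (γ α t) := by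
  obtain ⟨y, hy, hxy⟩ := hp.exists_mem_Ico one_pos x (γ 0 t)
  have hm := timeChange_mem hJ hu hγ ht
  set η := timeChange lam u γ t
  have hmono := strictMono_flowMap hm
  have h1 := flowMap_add_one hm 0
  rw [zero_add, flowMap_zero_left, zero_add] at h1
  have hα : label lam (y - γ 0 t) η ∈ Icc (0 : ℝ) 1 := by
    constructor
    · refine hmono.le_iff_le.1 ?_
      simp only [flowMap_label hm, flowMap_zero_left]
      linarith [hy.1]
    · refine hmono.le_iff_le.1 ?_
      simp only [flowMap_label hm, h1]
      linarith [hy.2]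
  refine ⟨_, hα, ?_⟩
  have := flow_sub_eq_flowMap hJ hu hγ h0 hα ht
  rw [flowMap_label hm] at this
  rw [hxy]
  congr 1
  linarith

end Label

theorem le_maxSlope (hJ : IsTimeInterval J) (hu : IsClassicalSolution lam datum J u)
    {α t : ℝ} (hα : α ∈ Icc (0 : ℝ) 1) (ht : t ∈ J) :
    ux u (γ α t) t ≤ maxSlope u γ t := by
  obtain ⟨C, -, hC⟩ := hu.exists_bound_ux hJ ht
  refine le_csSup ⟨C, ?_⟩ ⟨α, hα, rfl⟩
  rintro _ ⟨β, -, rfl⟩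
  exact (le_abs_self _).trans (hC _ t ⟨hJ.nonneg ht, le_rfl⟩)

theorem minSlope_le (hJ : IsTimeInterval J) (hu : IsClassicalSolution lam datum J u)
    {α t : ℝ} (hα : α ∈ Icc (0 : ℝ) 1) (ht : t ∈ J) :
    minSlope u γ t ≤ ux u (γ α t) t := by
  obtain ⟨C, -, hC⟩ := hu.exists_bound_ux hJ ht
  refine csInf_le ⟨-C, ?_⟩ ⟨α, hα, rfl⟩
  rintro _ ⟨β, -, rfl⟩
  exact (abs_le.1 (hC _ t ⟨hJ.nonneg ht, le_rfl⟩)).1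

/-- The maximal slope at a point, if that point dominates all others. -/
theorem maxSlope_le {C t : ℝ} (h : ∀ α ∈ Icc (0 : ℝ) 1, ux u (γ α t) t ≤ C) :
    maxSlope u γ t ≤ C := by
  refine csSup_le ⟨_, 0, left_mem_Icc.2 zero_le_one, rfl⟩ ?_
  rintro _ ⟨α, hα, rfl⟩
  exact h α hα

/-- Zero mean solutions are unique. -/
theorem eq_of_hasZeroMean (h0 : lam ≠ 0) (hJ : IsTimeInterval J) {v : ℝ → ℝ → ℝ}
    (hu : IsClassicalSolution lam datum J u) (hv : IsClassicalSolution lam datum J v)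
    (hum : HasZeroMean J u) (hvm : HasZeroMean J v) {t : ℝ} (ht : t ∈ J) (x : ℝ) :
    u x t = v x t := by
  obtain ⟨γ, hγ⟩ := hu.exists_characteristicFlow hJ
  obtain ⟨δ, hδ⟩ := hv.exists_characteristicFlow hJ
  have htc : ∀ t ∈ J, timeChange lam u γ t = timeChange lam v δ t := fun t ht =>
    (strictMonoOn_timeScale lam).injOn (timeChange_mem hJ hu hγ ht) (timeChange_mem hJ hv hδ ht)
      (by rw [timeScale_timeChange hJ hu hγ h0 ht, timeScale_timeChange hJ hv hδ h0 ht])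
  have hz : (0 : ℝ) ∈ Icc (0 : ℝ) 1 := left_mem_Icc.2 zero_le_one
  -- The two flows can differ only by this translation. The shifted slopes agree, zero mean then
  -- makes the shifted velocities agree, and so the translation has zero derivative.
  set c : ℝ → ℝ := fun t => γ 0 t - δ 0 t with hc
  have hslope : ∀ t ∈ J, ∀ y, ux u (y + c t) t - ux v y t = 0 := fun t ht y => by
    have hp : Function.Periodic (fun y => ux u (y + c t) t - ux v y t) 1 :=
      ((hu.periodic_ux ht).add_const (c t)).sub (hv.periodic_ux ht)
    obtain ⟨α, hα, h⟩ := exists_flow_eq hJ hv hδ h0 ht hp y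
    have h1 := flow_sub_eq_flowMap hJ hu hγ h0 hα ht
    have h2 := flow_sub_eq_flowMap hJ hv hδ h0 hα ht
    rw [htc t ht, ← h2] at h1
    have h3 : δ α t + c t = γ α t := by
      simp only [hc]
      linarith
    rw [h, h3, ux_flow hJ hu hγ h0 hα ht, ux_flow hJ hv hδ h0 hα ht, htc t ht, sub_self]
  have hshift : ∀ t ∈ J, ∀ y, u (y + c t) t = v y t := fun t ht y => by
    have hd : ∀ y, HasDerivAt (fun y => u (y + c t) t - v y t) 0 y := fun y =>
      (((hu.hasDerivAt_ux ht (y + c t)).comp_add_const y (c t)).sub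
        (hv.hasDerivAt_ux ht y)).congr_deriv (hslope t ht y)
    have hconst : ∀ z, u (z + c t) t - v z t = u (y + c t) t - v y t := fun z =>
      is_const_of_deriv_eq_zero (fun y => (hd y).differentiableAt) (fun y => (hd y).deriv) z y
    have cu : Continuous fun z => u (z + c t) t :=
      (hu.contDiff t ht).continuous.comp (by fun_prop)
    have cv : Continuous fun z => v z t := (hv.contDiff t ht).continuous
    have hiu : ∫ z in (0 : ℝ)..1, u (z + c t) t = 0 := by
      rw [intervalIntegral.integral_comp_add_right (fun z => u z t), add_comm 1, zero_add,
        (hu.periodic t ht).intervalIntegral_add_eq (c t) 0, zero_add]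
      exact hum t ht
    have hint : ∫ z in (0 : ℝ)..1, (u (z + c t) t - v z t) = 0 := by
      rw [intervalIntegral.integral_sub (cu.intervalIntegrable _ _) (cv.intervalIntegrable _ _),
        hiu, hvm t ht, sub_zero]
    simp only [hconst, intervalIntegral.integral_const, sub_zero, one_smul] at hint
    exact sub_eq_zero.1 hint
  have hc0 : ∀ t ∈ J, c t = 0 := fun t ht => by
    have hγ0 := hγ.isCharacteristic hz
    have hδ0 := hδ.isCharacteristic hz
    have h1 := hJ.eq_of_hasDerivAt_zero (g := c)
      ((hγ0.continuousOn hJ).sub (hδ0.continuousOn hJ))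
      (fun t ht htp => ((hγ0.hasDerivAt ht htp).sub (hδ0.hasDerivAt ht htp)).congr_deriv (by
        rw [← hshift t ht (δ 0 t)]
        simp only [hc, add_sub_cancel, sub_self])) ht
    rw [h1]
    simp only [hc, (hγ 0 hz).1, (hδ 0 hz).1, sub_self]
  have := hshift t ht x
  rwa [hc0 t ht, add_zero] at this

/-- A periodic function of zero mean is bounded by its derivative. -/
theorem abs_le_of_integral_eq_zero {f f' : ℝ → ℝ} (hf : ∀ x, HasDerivAt f (f' x) x)
    (hp : Function.Periodic f 1) (h0 : ∫ x in (0 : ℝ)..1, f x = 0) {C : ℝ}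
    (hC : ∀ x, |f' x| ≤ C) (x : ℝ) : |f x| ≤ C := by
  obtain ⟨y, hy, hxy⟩ := hp.exists_mem_Ico₀ one_pos x
  have hC0 : 0 ≤ C := (abs_nonneg _).trans (hC 0)
  have hcf : Continuous f := continuous_iff_continuousAt.2 fun x => (hf x).continuousAt
  have h1 : ∫ z in (0 : ℝ)..1, (f y - f z) = f y := by
    rw [intervalIntegral.integral_sub (by simp) (hcf.intervalIntegrable _ _), h0]
    simp
  have h2 := intervalIntegral.norm_integral_le_of_norm_le_const (a := 0) (b := 1) (C := C)
    (f := fun z => f y - f z) fun z hz => by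
      rw [uIoc_of_le zero_le_one] at hz
      refine (abs_sub_le_of_deriv_le hf hC z y).trans
        (mul_le_of_le_one_right hC0 (abs_le.2 ⟨?_, ?_⟩)) <;> linarith [hy.1, hy.2, hz.1, hz.2]
  rw [h1] at h2
  simpa [hxy] using h2

end IsClassicalSolution

/-! ### Blow-up and decay in the time variable -/

section EndTime

theorem eventually_lt_of_Ico {τ : ℝ} (s : ℝ) (hs : s ∈ Ico 0 τ) :
    ∀ᶠ t in 𝓝[<] τ, s < t ∧ t ∈ Ico 0 τ := by
  filter_upwards [Ioo_mem_nhdsLT hs.2] with t ht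
  exact ⟨ht.1, hs.1.trans ht.1.le, ht.2⟩

theorem eventually_lt_of_Ici (s : ℝ) (hs : s ∈ Ici (0 : ℝ)) :
    ∀ᶠ t in atTop, s < t ∧ t ∈ Ici (0 : ℝ) := by
  filter_upwards [eventually_gt_atTop s] with t ht
  exact ⟨ht, le_trans hs ht.le⟩

end EndTime

namespace IsClassicalSolution

variable {lam : ℝ} {u γ : ℝ → ℝ → ℝ}

/-- Transfer of the asymptotics in `κ` to the time variable. -/
theorem tendsto_ux_flow {J : Set ℝ} (hJ : IsTimeInterval J)
    (hu : IsClassicalSolution lam datum J u) (hγ : IsCharacteristicFlow J u γ) (h0 : lam ≠ 0)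
    {l : Filter ℝ} (hl : ∀ s ∈ J, ∀ᶠ t in l, s < t ∧ t ∈ J)
    (himg : timeScale lam '' Ico 0 (1 / |lam|) = J) {α : ℝ} (hα : α ∈ Icc (0 : ℝ) 1)
    {m : Filter ℝ}
    (h : Tendsto (fun κ => sgn lam * (cosMean (1 / lam) κ ^ (-(2 / (1 / lam)))
      * cosSlope (1 / lam) (sgn lam * datumSlope α) κ)) (𝓝[<] 1) m) :
    Tendsto (fun t => ux u (γ α t) t) l m := by
  refine (h.comp (tendsto_timeChange hJ hu hγ h0 (himg ▸ hl))).congr' ?_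
  filter_upwards [hl 0 hJ.zero_mem] with t ht
  exact (ux_flow_eq_cosSlope hJ hu hγ h0 hα ht.2 ht.1).symm

theorem twoSidedEverywhereBlowup (hlam : lam ∉ Ioc (-2 : ℝ) 1) {τ : ℝ} (hτ : 0 < τ)
    (himg : timeScale lam '' Ico 0 (1 / |lam|) = Ico 0 τ)
    (hu : IsClassicalSolution lam datum (Ico 0 τ) u) (hγ : IsCharacteristicFlow (Ico 0 τ) u γ) :
    TwoSidedEverywhereBlowup datum τ u γ := by
  have hJ : IsTimeInterval (Ico 0 τ) := Or.inr ⟨τ, hτ, rfl⟩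
  simp only [mem_Ioc, not_and_or, not_lt, not_le] at hlam
  have h0 : lam ≠ 0 := by rintro rfl; norm_num at hlam
  have hp0 : 1 / lam ≠ 0 := one_div_ne_zero h0
  have hp1 : 1 / lam < 1 := (one_div_lt_one_iff h0).2 fun h => by
    rcases hlam with h' | h' <;> linarith [h.1, h.2]
  have hp2 : -(1 / 2) ≤ 1 / lam := by
    rcases hlam with h | h
    · rw [neg_le, ← one_div_neg_eq_neg_one_div]
      exact one_div_le_one_div_of_le two_pos (by linarith)
    · have : 0 < 1 / lam := by positivity
      linarith
  have htr := fun {α : ℝ} (hα : α ∈ Icc (0 : ℝ) 1) {m : Filter ℝ} =>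
    tendsto_ux_flow hJ hu hγ h0 eventually_lt_of_Ico himg hα (m := m)
  have htop := tendsto_cosSlope_one hp1 hp0
  have hbot := fun {f : ℝ} (hf : f < 1) => tendsto_cosSlope_atBot hp2 hp1 hp0 hf
  have hmax : ∀ α ∈ maxPoints datum, Tendsto (fun t => ux u (γ α t) t) (𝓝[<] τ) atTop := by
    intro α hα
    obtain ⟨hα, h1⟩ := mem_maxPoints_datum.1 hα
    refine htr hα ?_
    rw [h1]
    rcases lt_or_gt_of_ne h0 with h | h
    · simp only [sgn_of_neg h, neg_mul, one_mul]
      -- For negative `lam` a maximum point corresponds to f = -1 in `cosSlope`, a nonextremal value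
      -- there; the overall sign turns the divergence to -∞ into +∞.
      exact tendsto_neg_atBot_atTop.comp (hbot (by norm_num))
    · simpa only [sgn_of_pos h, one_mul] using htop
  have hmin : ∀ α ∈ minPoints datum, Tendsto (fun t => ux u (γ α t) t) (𝓝[<] τ) atBot := by
    intro α hα
    obtain ⟨hα, h1⟩ := mem_minPoints_datum.1 hα
    refine htr hα ?_
    rw [h1]
    rcases lt_or_gt_of_ne h0 with h | h
    · simp only [sgn_of_neg h, neg_mul, one_mul, neg_neg]
      exact tendsto_neg_atTop_atBot.comp htop
    · simpa only [sgn_of_pos h, one_mul] using hbot (f := -1) (by norm_num)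
  have hJev : ∀ᶠ t in 𝓝[<] τ, t ∈ Ico 0 τ := Ico_mem_nhdsLT hτ
  have hz : (0 : ℝ) ∈ maxPoints datum :=
    mem_maxPoints_datum.2 ⟨left_mem_Icc.2 zero_le_one, datumSlope_zero⟩
  have hh : (1 / 2 : ℝ) ∈ minPoints datum := mem_minPoints_datum.2 ⟨half_mem, datumSlope_half⟩
  refine ⟨tendsto_atTop_mono' _ ?_ (hmax _ hz), tendsto_atBot_mono' _ ?_ (hmin _ hh), hmax, hmin,
    fun α hα hne => ?_⟩
  · filter_upwards [hJev] with t ht using le_maxSlope hJ hu hz.1 ht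
  · filter_upwards [hJev] with t ht using minSlope_le hJ hu hh.1 ht
  · rw [mem_union, mem_maxPoints_datum, mem_minPoints_datum, not_or] at hne
    have h1 : datumSlope α < 1 := (datumSlope_le_one α).lt_of_ne fun h => hne.1 ⟨hα, h⟩
    have h2 : -1 < datumSlope α :=
      (neg_one_le_datumSlope α).lt_of_ne fun h => hne.2 ⟨hα, h.symm⟩
    rcases lt_or_gt_of_ne h0 with h | h
    · refine tendsto_abs_atTop_atTop.comp (htr hα ?_)
      simp only [sgn_of_neg h, neg_mul, one_mul]
      exact tendsto_neg_atBot_atTop.comp (hbot (by linarith))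
    · refine tendsto_abs_atBot_atTop.comp (htr hα ?_)
      simpa only [sgn_of_pos h, one_mul] using hbot h1

theorem oneSidedDiscreteBlowup (hlam : lam ∈ Ioo (-2 : ℝ) 0) {τ : ℝ} (hτ : 0 < τ)
    (himg : timeScale lam '' Ico 0 (1 / |lam|) = Ico 0 τ)
    (hu : IsClassicalSolution lam datum (Ico 0 τ) u) (hγ : IsCharacteristicFlow (Ico 0 τ) u γ) :
    OneSidedDiscreteBlowup datum τ u γ := by
  have hJ : IsTimeInterval (Ico 0 τ) := Or.inr ⟨τ, hτ, rfl⟩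
  have h0 : lam ≠ 0 := hlam.2.ne
  have hp : 1 / lam < 0 := one_div_neg.2 hlam.2
  have hp2 : 1 / lam < -(1 / 2) := by
    rw [lt_neg, ← one_div_neg_eq_neg_one_div]
    exact one_div_lt_one_div_of_lt (by linarith [hlam.2]) (by linarith [hlam.1])
  -- With p < -1/2 the integral with exponent p + 1 stays bounded, so the nonlocal part of the slope
  -- never diverges and only the local term can.
  obtain ⟨C, hC0, hC⟩ := exists_cosMean_succ_bound hp2
  have hmin : ∀ α ∈ minPoints datum, Tendsto (fun t => ux u (γ α t) t) (𝓝[<] τ) atBot := by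
    intro α hα
    obtain ⟨hα, h1⟩ := mem_minPoints_datum.1 hα
    refine tendsto_ux_flow hJ hu hγ h0 eventually_lt_of_Ico himg hα ?_
    rw [h1]
    simp only [sgn_of_neg hlam.2, neg_mul, one_mul, neg_neg]
    exact tendsto_neg_atTop_atBot.comp (tendsto_cosSlope_one_of_neg hp)
  have hJev : ∀ᶠ t in 𝓝[<] τ, t ∈ Ico 0 τ := Ico_mem_nhdsLT hτ
  have hz : (0 : ℝ) ∈ Icc (0 : ℝ) 1 := left_mem_Icc.2 zero_le_one
  have hh : (1 / 2 : ℝ) ∈ minPoints datum := mem_minPoints_datum.2 ⟨half_mem, datumSlope_half⟩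
  have hfac : ∀ t ∈ Ico 0 τ, 0 ≤ meanWeight lam (timeChange lam u γ t) ^ (-(2 * lam)) ∧
      meanWeight lam (timeChange lam u γ t) ^ (-(2 * lam)) ≤ 4 := fun t ht => by
    have hm := timeChange_mem hJ hu hγ ht
    have hn := timeChange_nonneg hJ hu hγ h0 ht
    refine ⟨Real.rpow_nonneg (meanWeight_pos hm).le _, ?_⟩
    have := cosMean_rpow_le_four (abs_mul_mem hm hn) hp.ne
    rwa [cosMean_abs_mul _ hn, ← meanWeight_eq h0, show 2 / (1 / lam) = 2 * lam by
      field_simp] at this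
  have hquot : ∀ t ∈ Ico 0 τ, |meanWeight₁ lam (timeChange lam u γ t)
      / meanWeight lam (timeChange lam u γ t)| ≤ 2 * C := fun t ht => by
    have hm := timeChange_mem hJ hu hγ ht
    have hn := timeChange_nonneg hJ hu hγ h0 ht
    have hκ := abs_mul_mem hm hn
    have h1 := half_le_cosMean hκ hp.le
    rw [cosMean_abs_mul _ hn, ← meanWeight_eq h0] at h1
    have h2 := hC _ hκ
    rw [cosMean_abs_mul _ hn] at h2
    have h3 := (abs_meanWeight₁_le h0 hm).trans h2
    rw [abs_div, abs_of_pos (meanWeight_pos hm), div_le_iff₀ (meanWeight_pos hm)]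
    nlinarith
  have hden : ∀ t ∈ Ico 0 τ, ∀ f, 0 ≤ f → 1 ≤ 1 - lam * (timeChange lam u γ t * f) :=
    fun t ht f hf => by
      have := mul_nonneg (neg_nonneg.2 hlam.2.le)
        (mul_nonneg (timeChange_nonneg hJ hu hγ h0 ht) hf)
      linarith
  have hslope : ∀ {A : ℝ}, 0 ≤ A → ∀ t ∈ Ico 0 τ, ∀ α ∈ Icc (0 : ℝ) 1,
      labelSlope lam α (timeChange lam u γ t) ≤ A → ux u (γ α t) t ≤ 4 * (A + 2 * C) := by
    intro A hA t ht α hα h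
    rw [ux_flow hJ hu hγ h0 hα ht]
    have h1 := hfac t ht
    have h2 := abs_le.1 (hquot t ht)
    calc _ ≤ meanWeight lam (timeChange lam u γ t) ^ (-(2 * lam)) * (A + 2 * C) := by
          refine mul_le_mul_of_nonneg_left ?_ h1.1
          rw [flowSlope]
          linarith
      _ ≤ _ := mul_le_mul_of_nonneg_right h1.2 (by positivity)
  have hslope' : ∀ {A : ℝ}, 0 ≤ A → ∀ t ∈ Ico 0 τ, ∀ α ∈ Icc (0 : ℝ) 1,
      -A ≤ labelSlope lam α (timeChange lam u γ t) → -(4 * (A + 2 * C)) ≤ ux u (γ α t) t := by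
    intro A hA t ht α hα h
    rw [ux_flow hJ hu hγ h0 hα ht]
    have h1 := hfac t ht
    have h2 := abs_le.1 (hquot t ht)
    calc _ = -(4 * (A + 2 * C)) := rfl
      _ ≤ -(meanWeight lam (timeChange lam u γ t) ^ (-(2 * lam)) * (A + 2 * C)) :=
          neg_le_neg (mul_le_mul_of_nonneg_right h1.2 (by positivity))
      _ = meanWeight lam (timeChange lam u γ t) ^ (-(2 * lam)) * -(A + 2 * C) := by ring
      _ ≤ _ := by
          refine mul_le_mul_of_nonneg_left ?_ h1.1
          rw [flowSlope]
          linarith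
  have hlab : ∀ t ∈ Ico 0 τ, ∀ α, labelSlope lam α (timeChange lam u γ t) ≤ 1 := by
    intro t ht α
    have hd := den_pos (timeChange_mem hJ hu hγ ht) α
    rw [labelSlope, div_le_one hd]
    rcases le_total 0 (datumSlope α) with h | h
    · exact (datumSlope_le_one α).trans (hden t ht _ h)
    · linarith
  have hup : ∀ t ∈ Ico 0 τ, ∀ α ∈ Icc (0 : ℝ) 1, ux u (γ α t) t ≤ 4 * (1 + 2 * C) :=
    fun t ht α hα => hslope zero_le_one t ht α hα (hlab t ht α)
  refine ⟨tendsto_atBot_mono' _ ?_ (hmin _ hh), ⟨4 * (1 + 2 * C), fun t ht => abs_le.2 ⟨?_, ?_⟩⟩,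
    hmin, fun α hα hne => ?_⟩
  · filter_upwards [hJev] with t ht using minSlope_le hJ hu hh.1 ht
  -- A lower bound for the supremum needs only one label with controlled slope; at label 0 the local
  -- term is nonnegative.
  · refine (hslope' zero_le_one t ht 0 hz ?_).trans (le_maxSlope hJ hu hz ht)
    have hd := den_pos (timeChange_mem hJ hu hγ ht) 0
    have : 0 ≤ labelSlope lam 0 (timeChange lam u γ t) :=
      div_nonneg (datumSlope_zero ▸ zero_le_one) hd.le
    linarith
  · exact maxSlope_le fun α hα => hup t ht α hα
  · rw [mem_minPoints_datum] at hne
    have h2 : -1 < datumSlope α :=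
      (neg_one_le_datumSlope α).lt_of_ne fun h => hne ⟨hα, h.symm⟩
    have hA : 0 < 1 / (1 + datumSlope α) := one_div_pos.2 (by linarith)
    refine ⟨4 * (1 + 1 / (1 + datumSlope α) + 2 * C), fun t ht => abs_le.2 ⟨?_, ?_⟩⟩
    · refine hslope' (by positivity) t ht α hα ?_
      have hd := den_pos (timeChange_mem hJ hu hγ ht) α
      have hκ := abs_mul_mem (timeChange_mem hJ hu hγ ht) (timeChange_nonneg hJ hu hγ h0 ht)
      -- Away from the minimum points `-datumSlope α < 1`, and the local term is bounded uniformly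
      -- in time by the reciprocal of its distance to 1.
      have h3 := div_le_of_lt_one (f := -datumSlope α) hκ (by linarith)
      rw [abs_of_neg hlam.2, show 1 - -lam * timeChange lam u γ t * -datumSlope α =
        1 - lam * (timeChange lam u γ t * datumSlope α) by ring, neg_div, sub_neg_eq_add] at h3
      rw [labelSlope]
      linarith
    · exact hslope (by positivity) t ht α hα ((hlab t ht α).trans (by linarith))

theorem exists_ux_le (hlam : lam ∈ Ioo (0 : ℝ) 1) (hu : IsClassicalSolution lam datum (Ici 0) u) :
    ∀ ε > 0, ∀ᶠ t in atTop, t ∈ Ici (0 : ℝ) ∧ ∀ x, |ux u x t| < ε := by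
  intro ε hε
  have hJ : IsTimeInterval (Ici 0) := Or.inl rfl
  obtain ⟨γ, hγ⟩ := hu.exists_characteristicFlow hJ
  have h0 : lam ≠ 0 := hlam.1.ne'
  have hp : 1 < 1 / lam := (one_lt_div hlam.1).2 hlam.2
  have htc := tendsto_timeChange hJ hu hγ h0 (l := atTop)
    (by rw [image_timeScale_of_mem ⟨hlam.1, hlam.2.le⟩]; exact eventually_lt_of_Ici)
  have hsm := htc.eventually ((tendsto_cosMean_rpow_div hp).eventually_lt_const hε)
  filter_upwards [hsm, htc.eventually eventually_half_lt, eventually_gt_atTop 0] with t h1 h2 ht0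
  have ht : t ∈ Ici (0 : ℝ) := ht0.le
  refine ⟨ht, fun x => ?_⟩
  obtain ⟨α, hα, h⟩ := exists_flow_eq hJ hu hγ h0 ht (hu.periodic_ux ht) x
  rw [h, ux_flow_eq_cosSlope hJ hu hγ h0 hα ht ht0, sgn_of_pos hlam.1, one_mul, one_mul, abs_mul]
  set κ := |lam| * timeChange lam u γ t
  have hS := Real.rpow_nonneg (cosMean_pos (abs_lt_one_of_mem
    (show κ ∈ Ico (0 : ℝ) 1 from ⟨by linarith [h2.1], h2.2⟩)) (1 / lam)).le (-(2 / (1 / lam)))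
  rw [abs_of_nonneg hS]
  exact (mul_le_mul_of_nonneg_left (abs_cosSlope_le h2 (abs_datumSlope_le_one α)) hS).trans_lt h1

end IsClassicalSolution


/-! ### The explicitly integrable model for `lam = 1` -/

section Model

/-- A trigonometric density of degree one that osculates `1 - κ cos³ (2πx)` at its minimum. -/
def modelDensity (κ x : ℝ) : ℝ := 1 + 2 * κ - 3 * κ * Real.cos (2 * Real.pi * x)

/-- The reciprocal of the mean of `(modelDensity κ)⁻¹`. -/
def modelScale (κ : ℝ) : ℝ := √((1 - κ) * (1 + 5 * κ))

/-- The cosine of the angle transported by the model flow. -/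
def modelCos (κ x : ℝ) : ℝ :=
  ((1 + 2 * κ) * Real.cos (2 * Real.pi * x) - 3 * κ) / modelDensity κ x

/-- The sine of the angle transported by the model flow. -/
def modelSin (κ x : ℝ) : ℝ := modelScale κ * Real.sin (2 * Real.pi * x) / modelDensity κ x

/-- The model flow. -/
def modelFlow (κ α : ℝ) : ℝ := ∫ x in (0 : ℝ)..α, modelScale κ * (modelDensity κ x)⁻¹

variable {κ : ℝ}

theorem one_sub_le_modelDensity (h : κ ∈ Ico (0 : ℝ) 1) (x : ℝ) : 1 - κ ≤ modelDensity κ x := by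
  rw [modelDensity]
  nlinarith [h.1, Real.cos_le_one (2 * Real.pi * x)]

theorem modelDensity_pos (h : κ ∈ Ico (0 : ℝ) 1) (x : ℝ) : 0 < modelDensity κ x :=
  (sub_pos.2 h.2).trans_le (one_sub_le_modelDensity h x)

theorem sq_modelScale (h : κ ∈ Ico (0 : ℝ) 1) : modelScale κ ^ 2 = (1 - κ) * (1 + 5 * κ) :=
  Real.sq_sqrt (mul_nonneg (by linarith [h.2]) (by linarith [h.1]))

theorem modelScale_pos (h : κ ∈ Ico (0 : ℝ) 1) : 0 < modelScale κ :=
  Real.sqrt_pos.2 (mul_pos (by linarith [h.2]) (by linarith [h.1]))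

theorem continuous_modelDensity (κ : ℝ) : Continuous (modelDensity κ) := by
  unfold modelDensity
  fun_prop

theorem continuous_inv_modelDensity (h : κ ∈ Ico (0 : ℝ) 1) :
    Continuous fun x => (modelDensity κ x)⁻¹ :=
  (continuous_modelDensity κ).inv₀ fun x => (modelDensity_pos h x).ne'

theorem hasDerivAt_modelDensity (κ x : ℝ) : HasDerivAt (modelDensity κ)
    (2 * Real.pi * (3 * κ * Real.sin (2 * Real.pi * x))) x := by
  refine (((hasDerivAt_two_pi_mul x).cos.const_mul (3 * κ)).const_sub (1 + 2 * κ)).congr_deriv ?_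
  ring

theorem hasDerivAt_modelCos (h : κ ∈ Ico (0 : ℝ) 1) (x : ℝ) : HasDerivAt (modelCos κ)
    (-(2 * Real.pi * (modelScale κ * (modelDensity κ x)⁻¹) * modelSin κ x)) x := by
  have hE := modelDensity_pos h x
  refine ((((hasDerivAt_two_pi_mul x).cos.const_mul (1 + 2 * κ)).sub_const (3 * κ)).div
    (hasDerivAt_modelDensity κ x) hE.ne').congr_deriv ?_
  have hq := sq_modelScale h
  rw [modelSin]
  field_simp
  rw [hq, modelDensity]
  ring

theorem hasDerivAt_modelSin (h : κ ∈ Ico (0 : ℝ) 1) (x : ℝ) : HasDerivAt (modelSin κ)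
    (2 * Real.pi * (modelScale κ * (modelDensity κ x)⁻¹) * modelCos κ x) x := by
  have hE := modelDensity_pos h x
  refine ((((hasDerivAt_two_pi_mul x).sin.const_mul (modelScale κ))).div
    (hasDerivAt_modelDensity κ x) hE.ne').congr_deriv ?_
  have := Real.sin_sq (2 * Real.pi * x)
  rw [modelCos]
  field_simp
  rw [this, modelDensity]
  ring

theorem hasDerivAt_modelFlow (h : κ ∈ Ico (0 : ℝ) 1) (x : ℝ) :
    HasDerivAt (modelFlow κ) (modelScale κ * (modelDensity κ x)⁻¹) x := by
  have hc : Continuous fun x => modelScale κ * (modelDensity κ x)⁻¹ :=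
    continuous_const.mul (continuous_inv_modelDensity h)
  exact intervalIntegral.integral_hasDerivAt_right (hc.intervalIntegrable _ _)
    (hc.stronglyMeasurableAtFilter _ _) hc.continuousAt

theorem modelFlow_zero (κ : ℝ) : modelFlow κ 0 = 0 := intervalIntegral.integral_same

theorem modelCos_zero (h : κ ∈ Ico (0 : ℝ) 1) : modelCos κ 0 = 1 := by
  rw [modelCos, div_eq_one_iff_eq (modelDensity_pos h 0).ne', modelDensity]
  simp

theorem modelSin_zero (κ : ℝ) : modelSin κ 0 = 0 := by simp [modelSin]

/-- The points (cos 2πφ, sin 2πφ), with φ the model flow, and (`modelCos`, `modelSin`) start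
together and rotate with the same angular speed, so their squared distance is constant, namely 0. -/
theorem cos_modelFlow (h : κ ∈ Ico (0 : ℝ) 1) (x : ℝ) :
    Real.cos (2 * Real.pi * modelFlow κ x) = modelCos κ x := by
  have hd : ∀ x, HasDerivAt (fun x => (Real.cos (2 * Real.pi * modelFlow κ x) - modelCos κ x) ^ 2
      + (Real.sin (2 * Real.pi * modelFlow κ x) - modelSin κ x) ^ 2) 0 x := fun x => by
    have h1 := (hasDerivAt_modelFlow h x).const_mul (2 * Real.pi)
    refine (((h1.cos.sub (hasDerivAt_modelCos h x)).pow 2).add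
      ((h1.sin.sub (hasDerivAt_modelSin h x)).pow 2)).congr_deriv ?_
    simp only [Nat.cast_ofNat, Pi.sub_apply]
    ring
  have h2 := is_const_of_deriv_eq_zero (fun x => (hd x).differentiableAt)
    (fun x => (hd x).deriv) x 0
  simp only [modelFlow_zero, modelCos_zero h, modelSin_zero, mul_zero, Real.cos_zero,
    Real.sin_zero, sub_self] at h2
  nlinarith [sq_nonneg (Real.cos (2 * Real.pi * modelFlow κ x) - modelCos κ x),
    sq_nonneg (Real.sin (2 * Real.pi * modelFlow κ x) - modelSin κ x)]

theorem cos_eq_one_of_modelCos (h : κ ∈ Ico (0 : ℝ) 1) {x : ℝ} (hx : modelCos κ x = 1) :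
    Real.cos (2 * Real.pi * x) = 1 := by
  rw [modelCos, div_eq_one_iff_eq (modelDensity_pos h x).ne', modelDensity] at hx
  have h0 := h.1
  have h1 : 1 + 5 * κ ≠ 0 := by positivity
  refine mul_left_cancel₀ h1 ?_
  linarith

/-- This evaluates the mean of 1/`modelDensity` without a residue or a tangent substitution. The
flow at 1 is a positive integer, and the value 1 is attained in [0, 1] at a point where the cosine
is 1, which can only be the endpoint 1. -/
theorem modelFlow_one (h : κ ∈ Ico (0 : ℝ) 1) : modelFlow κ 1 = 1 := by
  have h1 : Real.cos (2 * Real.pi * modelFlow κ 1) = 1 := by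
    rw [cos_modelFlow h, modelCos, div_eq_one_iff_eq (modelDensity_pos h 1).ne', modelDensity]
    simp
  have hmono : StrictMono (modelFlow κ) := strictMono_of_deriv_pos fun x => by
    rw [(hasDerivAt_modelFlow h x).deriv]
    exact mul_pos (modelScale_pos h) (inv_pos.2 (modelDensity_pos h x))
  have hpos : 0 < modelFlow κ 1 := modelFlow_zero κ ▸ hmono one_pos
  obtain ⟨n, hn⟩ := exists_int_of_cos_eq_one h1
  rw [hn] at hpos ⊢
  have hn0 : 0 < n := by exact_mod_cast hpos
  have hn1 : (1 : ℝ) ≤ n := by exact_mod_cast hn0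
  have hc : Continuous (modelFlow κ) :=
    continuous_iff_continuousAt.2 fun x => (hasDerivAt_modelFlow h x).continuousAt
  obtain ⟨x, hx, hx1⟩ := intermediate_value_Icc zero_le_one hc.continuousOn
    (show (1 : ℝ) ∈ Icc (modelFlow κ 0) (modelFlow κ 1) by
      rw [modelFlow_zero, hn]; exact ⟨zero_le_one, hn1⟩)
  have h2 := cos_modelFlow h x
  rw [hx1, mul_one, Real.cos_two_pi] at h2
  obtain ⟨m, rfl⟩ := exists_int_of_cos_eq_one (cos_eq_one_of_modelCos h h2.symm)
  have hm0 : 0 ≤ m := by exact_mod_cast hx.1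
  have hm1 : m ≤ 1 := by exact_mod_cast hx.2
  interval_cases m
  · rw [Int.cast_zero, modelFlow_zero] at hx1
    exact absurd hx1 zero_ne_one
  · rwa [Int.cast_one, hn] at hx1

theorem modelScale_mul_integral_inv (h : κ ∈ Ico (0 : ℝ) 1) :
    modelScale κ * ∫ x in (0 : ℝ)..1, (modelDensity κ x)⁻¹ = 1 := by
  rw [← intervalIntegral.integral_const_mul]
  exact modelFlow_one h

/-- The difference of the two integrands is the derivative of a periodic function, a multiple of the
sine divided by the density. -/
theorem sq_modelScale_mul_integral_inv_sq (h : κ ∈ Ico (0 : ℝ) 1) :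
    modelScale κ ^ 2 * ∫ x in (0 : ℝ)..1, (modelDensity κ x)⁻¹ ^ 2 =
      (1 + 2 * κ) * ∫ x in (0 : ℝ)..1, (modelDensity κ x)⁻¹ := by
  have hc := continuous_inv_modelDensity h
  have hd : ∀ x ∈ uIcc (0 : ℝ) 1,
      HasDerivAt (fun x => 3 * κ * (Real.sin (2 * Real.pi * x) / modelDensity κ x) / (2 * Real.pi))
      (modelScale κ ^ 2 * (modelDensity κ x)⁻¹ ^ 2 - (1 + 2 * κ) * (modelDensity κ x)⁻¹) x :=
    fun x _ => by
      have hE := modelDensity_pos h x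
      refine ((((hasDerivAt_two_pi_mul x).sin.div (hasDerivAt_modelDensity κ x)
        hE.ne').const_mul (3 * κ)).div_const (2 * Real.pi)).congr_deriv ?_
      have := Real.sin_sq (2 * Real.pi * x)
      rw [sq_modelScale h]
      field_simp
      rw [this, modelDensity]
      ring
  have hi1 : IntervalIntegrable (fun x => modelScale κ ^ 2 * (modelDensity κ x)⁻¹ ^ 2)
      MeasureTheory.volume 0 1 := (continuous_const.mul (hc.pow 2)).intervalIntegrable _ _
  have hi2 : IntervalIntegrable (fun x => (1 + 2 * κ) * (modelDensity κ x)⁻¹)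
      MeasureTheory.volume 0 1 := (continuous_const.mul hc).intervalIntegrable _ _
  have h1 := intervalIntegral.integral_eq_sub_of_hasDerivAt hd (hi1.sub hi2)
  rw [intervalIntegral.integral_sub hi1 hi2, intervalIntegral.integral_const_mul,
    intervalIntegral.integral_const_mul] at h1
  simp only [mul_one, Real.sin_two_pi, mul_zero, Real.sin_zero, zero_div, sub_self] at h1
  linarith

end Model

/-! ### Comparison of cos³ with the model as κ ↑ 1 -/

section Comparison

variable {κ : ℝ}

/-- The densities differ by κ (1-c)² (2+c), and each is bounded below by a multiple of κ (1-c); the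
two factors 1 - c cancel, so the singularities of the reciprocals coincide up to a bounded error. -/
theorem abs_inv_sub_inv_modelDensity_le (h : κ ∈ Ioo (1 / 2 : ℝ) 1) (x : ℝ) :
    |(1 - κ * datumSlope x)⁻¹ - (modelDensity κ x)⁻¹| ≤ 3 := by
  have hI : κ ∈ Ico (0 : ℝ) 1 := ⟨by linarith [h.1], h.2⟩
  have hD := one_sub_mul_pos' hI x
  have hE := modelDensity_pos hI x
  rw [inv_sub_inv hD.ne' hE.ne', abs_div, abs_of_pos (mul_pos hD hE),
    div_le_iff₀ (mul_pos hD hE)]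
  have hc1 := Real.neg_one_le_cos (2 * Real.pi * x)
  have hc2 := Real.cos_le_one (2 * Real.pi * x)
  have h1 : modelDensity κ x - (1 - κ * datumSlope x) =
      κ * (1 - Real.cos (2 * Real.pi * x)) ^ 2 * (2 + Real.cos (2 * Real.pi * x)) := by
    rw [modelDensity, datumSlope]
    ring
  have h2 : 3 / 4 * (κ * (1 - Real.cos (2 * Real.pi * x))) ≤ 1 - κ * datumSlope x := by
    have h3 : 0 ≤ κ * (1 - Real.cos (2 * Real.pi * x)) :=
      mul_nonneg hI.1 (sub_nonneg.2 hc2)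
    have h4 := mul_nonneg h3 (sq_nonneg (Real.cos (2 * Real.pi * x) + 1 / 2))
    rw [datumSlope]
    nlinarith [h.2]
  have h3 : 3 * (κ * (1 - Real.cos (2 * Real.pi * x))) ≤ modelDensity κ x := by
    rw [modelDensity]
    linarith [h.2]
  rw [h1]
  set c := Real.cos (2 * Real.pi * x)
  have h4 : 0 ≤ κ * (1 - c) := mul_nonneg hI.1 (sub_nonneg.2 hc2)
  have h5 : 0 ≤ κ * (1 - c) ^ 2 := mul_nonneg hI.1 (sq_nonneg _)
  rw [abs_of_nonneg (mul_nonneg h5 (by linarith))]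
  have h6 := mul_le_mul h2 h3 (by positivity) hD.le
  nlinarith [h.1]

theorem cosMean_one (κ : ℝ) :
    cosMean 1 κ = ∫ x in (0 : ℝ)..1, (1 - κ * datumSlope x)⁻¹ := by
  simp only [cosMean, Real.rpow_neg_one]

theorem cosMean_two (h : κ ∈ Ico (0 : ℝ) 1) :
    cosMean (1 + 1) κ = ∫ x in (0 : ℝ)..1, (1 - κ * datumSlope x)⁻¹ ^ 2 := by
  refine intervalIntegral.integral_congr fun x _ => ?_
  rw [Real.rpow_neg (one_sub_mul_pos' h x).le, one_add_one_eq_two, Real.rpow_two, inv_pow]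

theorem continuous_inv_one_sub (h : κ ∈ Ico (0 : ℝ) 1) :
    Continuous fun x => (1 - κ * datumSlope x)⁻¹ :=
  Continuous.inv₀ (by fun_prop) fun x => (one_sub_mul_pos' h x).ne'

theorem abs_integral_inv_sub_le (h : κ ∈ Ioo (1 / 2 : ℝ) 1) {α : ℝ} (hα : α ∈ Icc (0 : ℝ) 1) :
    |(∫ x in (0 : ℝ)..α, (1 - κ * datumSlope x)⁻¹) - ∫ x in (0 : ℝ)..α, (modelDensity κ x)⁻¹|
      ≤ 3 := by
  have hI : κ ∈ Ico (0 : ℝ) 1 := ⟨by linarith [h.1], h.2⟩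
  rw [← intervalIntegral.integral_sub ((continuous_inv_one_sub hI).intervalIntegrable _ _)
    ((continuous_inv_modelDensity hI).intervalIntegrable _ _)]
  refine (intervalIntegral.norm_integral_le_of_norm_le_const (C := 3) fun x _ =>
    (Real.norm_eq_abs _).trans_le (abs_inv_sub_inv_modelDensity_le h x)).trans ?_
  rw [sub_zero, abs_of_nonneg hα.1]
  linarith [hα.2]

theorem abs_integral_inv_sq_sub_le (h : κ ∈ Ioo (1 / 2 : ℝ) 1) :
    |cosMean (1 + 1) κ - ∫ x in (0 : ℝ)..1, (modelDensity κ x)⁻¹ ^ 2|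
      ≤ 3 * (cosMean 1 κ + ∫ x in (0 : ℝ)..1, (modelDensity κ x)⁻¹) := by
  have hI : κ ∈ Ico (0 : ℝ) 1 := ⟨by linarith [h.1], h.2⟩
  have hD := continuous_inv_one_sub hI
  have hE := continuous_inv_modelDensity hI
  have hD2 : Continuous fun x => (1 - κ * datumSlope x)⁻¹ ^ 2 := hD.pow 2
  have hE2 : Continuous fun x => (modelDensity κ x)⁻¹ ^ 2 := hE.pow 2
  have i1 := fun {f : ℝ → ℝ} (hf : Continuous f) => hf.intervalIntegrable
    (μ := MeasureTheory.volume) 0 1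
  rw [cosMean_one κ, cosMean_two hI, ← intervalIntegral.integral_sub (i1 hD2) (i1 hE2),
    ← intervalIntegral.integral_add (i1 hD) (i1 hE), ← intervalIntegral.integral_const_mul]
  refine (intervalIntegral.abs_integral_le_integral_abs zero_le_one).trans
    (intervalIntegral.integral_mono_on zero_le_one (i1 (hD2.sub hE2).abs)
      (i1 (continuous_const.mul (hD.add hE))) fun x _ => ?_)
  rw [sq_sub_sq, mul_comm, abs_mul, abs_of_pos (add_pos (inv_pos.2 (one_sub_mul_pos' hI x))
    (inv_pos.2 (modelDensity_pos hI x)))]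
  exact mul_le_mul_of_nonneg_right (abs_inv_sub_inv_modelDensity_le h x)
    (add_pos (inv_pos.2 (one_sub_mul_pos' hI x)) (inv_pos.2 (modelDensity_pos hI x))).le

/-- The ratio of the model mean to the mean. -/
def meanRatio (κ : ℝ) : ℝ := (modelScale κ * cosMean 1 κ)⁻¹

theorem abs_meanRatio_sub_one_le (h : κ ∈ Ioo (1 / 2 : ℝ) 1) :
    |meanRatio κ - 1| ≤ 3 * (cosMean 1 κ)⁻¹ := by
  have hI : κ ∈ Ico (0 : ℝ) 1 := ⟨by linarith [h.1], h.2⟩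
  have hP := cosMean_pos (abs_lt_one_of_mem hI) 1
  have h1 := abs_integral_inv_sub_le h (right_mem_Icc.2 zero_le_one)
  rw [← cosMean_one κ, eq_inv_of_mul_eq_one_right (modelScale_mul_integral_inv hI)] at h1
  have h2 : meanRatio κ - 1 = ((modelScale κ)⁻¹ - cosMean 1 κ) * (cosMean 1 κ)⁻¹ := by
    rw [meanRatio, mul_inv, sub_mul, mul_inv_cancel₀ hP.ne']
  rw [h2, abs_mul, abs_sub_comm, abs_of_pos (inv_pos.2 hP)]
  exact mul_le_mul_of_nonneg_right h1 (inv_pos.2 hP).le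

/-- The model flow is close to the rescaled flow. -/
theorem abs_flow_sub_modelFlow_le (h : κ ∈ Ioo (1 / 2 : ℝ) 1) {α : ℝ} (hα : α ∈ Icc (0 : ℝ) 1) :
    |(cosMean 1 κ)⁻¹ * (∫ x in (0 : ℝ)..α, (1 - κ * datumSlope x)⁻¹) - modelFlow κ α|
      ≤ 6 * (cosMean 1 κ)⁻¹ := by
  have hI : κ ∈ Ico (0 : ℝ) 1 := ⟨by linarith [h.1], h.2⟩
  have hP := inv_pos.2 (cosMean_pos (abs_lt_one_of_mem hI) 1)
  have hq := modelScale_pos hI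
  have h1 := abs_integral_inv_sub_le h hα
  have h2 := abs_meanRatio_sub_one_le h
  have hmono : Monotone (modelFlow κ) := monotone_of_deriv_nonneg
    (fun x => (hasDerivAt_modelFlow hI x).differentiableAt) fun x => by
      rw [(hasDerivAt_modelFlow hI x).deriv]
      exact mul_nonneg hq.le (inv_pos.2 (modelDensity_pos hI x)).le
  have h3 : |modelFlow κ α| ≤ 1 := by
    rw [abs_of_nonneg (modelFlow_zero κ ▸ hmono hα.1)]
    exact modelFlow_one hI ▸ hmono hα.2
  have h4 : (cosMean 1 κ)⁻¹ * (∫ x in (0 : ℝ)..α, (1 - κ * datumSlope x)⁻¹) - modelFlow κ α =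
      (cosMean 1 κ)⁻¹ * ((∫ x in (0 : ℝ)..α, (1 - κ * datumSlope x)⁻¹)
        - ∫ x in (0 : ℝ)..α, (modelDensity κ x)⁻¹) + (meanRatio κ - 1) * modelFlow κ α := by
    rw [modelFlow, intervalIntegral.integral_const_mul, meanRatio, mul_inv]
    field_simp
    ring
  rw [h4]
  calc _ ≤ (cosMean 1 κ)⁻¹ * 3 + 3 * (cosMean 1 κ)⁻¹ * 1 := by
        refine (abs_add_le _ _).trans (add_le_add ?_ ?_)
        · rw [abs_mul, abs_of_pos hP]
          exact mul_le_mul_of_nonneg_left h1 hP.le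
        · rw [abs_mul]
          exact mul_le_mul h2 h3 (abs_nonneg _) (by positivity)
    _ = _ := by ring

/-- A bound for the distance between the slope and its model. -/
def slopeError (κ : ℝ) : ℝ :=
  2 * (6 * |meanRatio κ ^ 2 - 1| + 3 * meanRatio κ ^ 2 * modelScale κ ^ 2
    + 3 * |meanRatio κ ^ 3 - 1| + 3 * (meanRatio κ ^ 2 + meanRatio κ ^ 3) * modelScale κ ^ 2)

theorem abs_slope_sub_modelCos_le (h : κ ∈ Ioo (1 / 2 : ℝ) 1) (x : ℝ) :
    |cosMean 1 κ ^ (-(2 : ℝ)) * cosSlope 1 (datumSlope x) κ - 3 * modelCos κ x|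
      ≤ slopeError κ := by
  have hI : κ ∈ Ico (0 : ℝ) 1 := ⟨by linarith [h.1], h.2⟩
  have hP := cosMean_pos (abs_lt_one_of_mem hI) 1
  have hq := modelScale_pos hI
  have hκ : 0 < κ := by linarith [h.1]
  have hD := one_sub_mul_pos' hI x
  have hE := modelDensity_pos hI x
  have hr : 0 < meanRatio κ := inv_pos.2 (mul_pos hq hP)
  have h1 := abs_inv_sub_inv_modelDensity_le h x
  have h2 := abs_integral_inv_sq_sub_le h
  have h3 := sq_modelScale_mul_integral_inv_sq hI
  rw [eq_inv_of_mul_eq_one_right (modelScale_mul_integral_inv hI)] at h2 h3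
  set M := ∫ x in (0 : ℝ)..1, (modelDensity κ x)⁻¹ ^ 2
  set P := cosMean 1 κ
  set S := cosMean (1 + 1) κ
  set q := modelScale κ
  set D := (1 - κ * datumSlope x)⁻¹ with hDdef
  set E := (modelDensity κ x)⁻¹ with hEdef
  set r := meanRatio κ with hrdef
  have hPr : P⁻¹ = r * q := by
    change P⁻¹ = (q * P)⁻¹ * q
    field_simp
  have hqM : q ^ 3 * M = 1 + 2 * κ := by
    rw [pow_succ, mul_right_comm, h3]
    field_simp
  have hqE : q ^ 2 * E ≤ 6 := by
    rw [hEdef, ← div_eq_mul_inv, div_le_iff₀ hE, sq_modelScale hI]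
    have := one_sub_le_modelDensity hI x
    nlinarith [h.2]
  -- With `P⁻¹ = r * q` the true slope and its model have the same form, `q ^ 2` times a reciprocal
  -- density minus `q ^ 3` times the mean of its square; the true one carries extra powers of `r`,
  -- which tends to 1.
  have e1 : κ * (P ^ (-(2 : ℝ)) * cosSlope 1 (datumSlope x) κ) =
      r ^ 2 * q ^ 2 * D - r ^ 3 * q ^ 3 * S := by
    have : datumSlope x / (1 - κ * datumSlope x) = (D - 1) / κ := by
      have := inv_mul_cancel₀ hD.ne'
      rw [eq_div_iff hκ.ne', div_eq_mul_inv]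
      linear_combination -this
    rw [cosSlope_eq ⟨hκ, h.2⟩, this, Real.rpow_neg hP.le, Real.rpow_two, ← inv_pow,
      div_eq_mul_inv S, show cosMean 1 κ = P from rfl, hPr]
    field_simp
    ring
  have e2 : κ * (3 * modelCos κ x) = q ^ 2 * E - q ^ 3 * M := by
    rw [hqM, sq_modelScale hI, modelCos, hEdef]
    field_simp
    rw [modelDensity]
    ring
  have e3 : κ * (P ^ (-(2 : ℝ)) * cosSlope 1 (datumSlope x) κ - 3 * modelCos κ x) =
      (r ^ 2 - 1) * (q ^ 2 * E) + r ^ 2 * q ^ 2 * (D - E) - (r ^ 3 - 1) * (q ^ 3 * M)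
        - r ^ 3 * q ^ 3 * (S - M) := by
    rw [mul_sub, e1, e2]
    ring
  have hE0 : 0 ≤ E := (inv_pos.2 hE).le
  have b1 : |(r ^ 2 - 1) * (q ^ 2 * E)| ≤ |r ^ 2 - 1| * 6 := by
    rw [abs_mul, abs_of_nonneg (show 0 ≤ q ^ 2 * E by positivity)]
    exact mul_le_mul_of_nonneg_left hqE (abs_nonneg _)
  have b2 : |r ^ 2 * q ^ 2 * (D - E)| ≤ r ^ 2 * q ^ 2 * 3 := by
    rw [abs_mul, abs_of_nonneg (show 0 ≤ r ^ 2 * q ^ 2 by positivity)]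
    exact mul_le_mul_of_nonneg_left h1 (by positivity)
  have b3 : |(r ^ 3 - 1) * (q ^ 3 * M)| ≤ |r ^ 3 - 1| * 3 := by
    rw [abs_mul, hqM, abs_of_nonneg (show 0 ≤ 1 + 2 * κ by positivity)]
    exact mul_le_mul_of_nonneg_left (by linarith [h.2]) (abs_nonneg _)
  have b4 : |r ^ 3 * q ^ 3 * (S - M)| ≤ 3 * (r ^ 2 + r ^ 3) * q ^ 2 := by
    rw [abs_mul, abs_of_nonneg (show 0 ≤ r ^ 3 * q ^ 3 by positivity)]
    refine (mul_le_mul_of_nonneg_left h2 (by positivity)).trans_eq ?_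
    rw [← inv_inv P, hPr]
    field_simp
  have b5 := abs_le.1 b1
  have b6 := abs_le.1 b2
  have b7 := abs_le.1 b3
  have b8 := abs_le.1 b4
  have e4 : κ * |P ^ (-(2 : ℝ)) * cosSlope 1 (datumSlope x) κ - 3 * modelCos κ x| ≤
      slopeError κ / 2 := by
    rw [← abs_of_pos hκ, ← abs_mul, abs_of_pos hκ, e3, slopeError]
    refine abs_le.2 ⟨?_, ?_⟩ <;> linarith
  nlinarith [abs_nonneg (P ^ (-(2 : ℝ)) * cosSlope 1 (datumSlope x) κ - 3 * modelCos κ x), h.1]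

theorem tendsto_inv_cosMean_one : Tendsto (fun κ => (cosMean 1 κ)⁻¹) (𝓝[<] 1) (𝓝 0) :=
  (tendsto_cosMean_of_half_le (by norm_num)).inv_tendsto_atTop

theorem tendsto_meanRatio : Tendsto meanRatio (𝓝[<] 1) (𝓝 1) := by
  rw [← tendsto_sub_nhds_zero_iff]
  have h := tendsto_inv_cosMean_one.const_mul 3
  rw [mul_zero] at h
  refine squeeze_zero_norm' ?_ h
  filter_upwards [eventually_half_lt] with κ hκ using abs_meanRatio_sub_one_le hκ

theorem tendsto_modelScale : Tendsto modelScale (𝓝[<] 1) (𝓝 0) := by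
  have : Continuous modelScale := by
    unfold modelScale
    fun_prop
  simpa [modelScale] using (this.tendsto 1).mono_left nhdsWithin_le_nhds

theorem tendsto_slopeError : Tendsto slopeError (𝓝[<] 1) (𝓝 0) := by
  have hg : Continuous fun y : ℝ × ℝ => 2 * (6 * |y.1 ^ 2 - 1| + 3 * y.1 ^ 2 * y.2 ^ 2
      + 3 * |y.1 ^ 3 - 1| + 3 * (y.1 ^ 2 + y.1 ^ 3) * y.2 ^ 2) := by fun_prop
  have := (hg.tendsto (1, 0)).comp (tendsto_meanRatio.prodMk_nhds tendsto_modelScale)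
  norm_num at this
  exact this

theorem tendsto_modelCos {x : ℝ} (hx : Real.cos (2 * Real.pi * x) ≠ 1) :
    Tendsto (fun κ => modelCos κ x) (𝓝[<] 1) (𝓝 (-1)) := by
  have hne : modelDensity 1 x ≠ 0 := fun h => hx (by rw [modelDensity] at h; linarith)
  have h1 : ContinuousAt (fun κ => modelCos κ x) 1 := by
    unfold modelCos
    refine ContinuousAt.div (by fun_prop) ?_ hne
    unfold modelDensity
    fun_prop
  have h2 : modelCos 1 x = -1 := by
    rw [modelCos, div_eq_iff hne, modelDensity]
    ring
  simpa only [h2] using h1.tendsto.mono_left nhdsWithin_le_nhds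

end Comparison


/-! ### The steady state 3 sin(2πx)/(2π) -/

section SteadyState

/-- The limit profile for `lam = 1`. -/
def steadyProfile (x : ℝ) : ℝ := 3 * Real.sin (2 * Real.pi * x) / (2 * Real.pi)

/-- The derivative of the limit profile. -/
def steadySlope (x : ℝ) : ℝ := 3 * Real.cos (2 * Real.pi * x)

theorem hasDerivAt_steadyProfile (x : ℝ) : HasDerivAt steadyProfile (steadySlope x) x := by
  refine (((hasDerivAt_two_pi_mul x).sin.const_mul 3).div_const (2 * Real.pi)).congr_deriv ?_
  rw [steadySlope]
  field_simp

theorem hasDerivAt_steadySlope (x : ℝ) :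
    HasDerivAt steadySlope (-(6 * Real.pi) * Real.sin (2 * Real.pi * x)) x := by
  refine ((hasDerivAt_two_pi_mul x).cos.const_mul 3).congr_deriv ?_
  ring

theorem steadyProfile_periodic : Function.Periodic steadyProfile 1 := fun x => by
  simp only [steadyProfile]
  rw [mul_add, mul_one, Real.sin_add_two_pi]

theorem steadySlope_periodic : Function.Periodic steadySlope 1 := fun x => by
  simp only [steadySlope]
  rw [mul_add, mul_one, Real.cos_add_two_pi]

theorem contDiff_steadyProfile : ContDiff ℝ 2 steadyProfile := by
  unfold steadyProfile
  fun_prop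

theorem continuous_steadySlope : Continuous steadySlope := by
  unfold steadySlope
  fun_prop

theorem integral_steadySlope_sq : ∫ x in (0 : ℝ)..1, steadySlope x ^ 2 = 9 / 2 := by
  have hd : ∀ x ∈ uIcc (0 : ℝ) 1,
      HasDerivAt (fun x => (steadyProfile x * steadySlope x + 9 * x) / 2) (steadySlope x ^ 2) x :=
    fun x _ => by
      refine ((((hasDerivAt_steadyProfile x).mul (hasDerivAt_steadySlope x)).add
        ((hasDerivAt_id x).const_mul 9)).div_const 2).congr_deriv ?_
      have := Real.sin_sq_add_cos_sq (2 * Real.pi * x)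
      rw [steadyProfile, steadySlope]
      field_simp
      linarith
  rw [intervalIntegral.integral_eq_sub_of_hasDerivAt hd
    ((continuous_steadySlope.pow 2).intervalIntegrable _ _)]
  simp [steadyProfile]

theorem isClassicalSolution_steadyProfile :
    IsClassicalSolution 1 steadyProfile (Ici 0) (fun x _ => steadyProfile x) := by
  have hux : ∀ x t, ux (fun x _ => steadyProfile x) x t = steadySlope x := fun x _ =>
    (hasDerivAt_steadyProfile x).deriv
  have huxx : ∀ x t, uxx (fun x _ => steadyProfile x) x t =
      -(6 * Real.pi) * Real.sin (2 * Real.pi * x) := fun x t => by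
    simp only [uxx, hux]
    exact (hasDerivAt_steadySlope x).deriv
  refine ⟨fun _ _ => steadyProfile_periodic, fun _ _ => contDiff_steadyProfile,
    (contDiff_steadyProfile.continuous.comp continuous_fst).continuousOn, ?_, ?_, fun _ => rfl,
    fun t _ _ x => ?_⟩
  · simp only [hux]
    exact (continuous_steadySlope.comp continuous_fst).continuousOn
  · simp only [huxx]
    fun_prop
  · simp only [nonlocalTerm, hux, huxx, integral_steadySlope_sq]
    refine (hasDerivAt_const t (steadySlope x)).congr_deriv ?_
    have := Real.sin_sq_add_cos_sq (2 * Real.pi * x)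
    rw [steadyProfile, steadySlope]
    field_simp
    linarith

theorem integral_steadyProfile : ∫ x in (0 : ℝ)..1, steadyProfile x = 0 := by
  have hd : ∀ x ∈ uIcc (0 : ℝ) 1,
      HasDerivAt (fun x => -steadySlope x / (2 * Real.pi) ^ 2) (steadyProfile x) x := fun x _ => by
    refine ((hasDerivAt_steadySlope x).neg.div_const _).congr_deriv ?_
    rw [steadyProfile]
    field_simp
    ring
  rw [intervalIntegral.integral_eq_sub_of_hasDerivAt hd
    (contDiff_steadyProfile.continuous.intervalIntegrable _ _)]
  simp [steadySlope]

theorem integral_datum : ∫ x in (0 : ℝ)..1, datum x = 0 := by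
  have h1 := intervalIntegral.integral_comp_sub_left (a := 0) (b := 1) datum 1
  have h2 : ∀ x, datum (1 - x) = -datum x := fun x => by
    have : 2 * Real.pi * (1 - x) = 2 * Real.pi - 2 * Real.pi * x := by ring
    rw [datum, this, Real.sin_two_pi_sub, datum]
    ring
  simp only [h2, intervalIntegral.integral_neg, sub_self, sub_zero] at h1
  linarith

end SteadyState

/-! ### Convergence of global solutions -/

namespace IsClassicalSolution

variable {u γ : ℝ → ℝ → ℝ}

section Convergence

variable (hu : IsClassicalSolution 1 datum (Ici 0) u) (hγ : IsCharacteristicFlow (Ici 0) u γ)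
include hu hγ

theorem tendsto_timeChange_one : Tendsto (timeChange 1 u γ) atTop (𝓝[<] 1) := by
  have := tendsto_timeChange (Or.inl rfl) hu hγ one_ne_zero (l := atTop)
    (by rw [image_timeScale_of_mem ⟨one_pos, le_rfl⟩]; exact eventually_lt_of_Ici)
  simpa only [abs_one, one_mul] using this

theorem eventually_abs_ux_flow_sub_le : ∀ᶠ t in atTop, ∀ α ∈ Icc (0 : ℝ) 1,
    |ux u (γ α t) t - 3 * modelCos (timeChange 1 u γ t) α| ≤ slopeError (timeChange 1 u γ t) := by
  filter_upwards [(tendsto_timeChange_one hu hγ).eventually eventually_half_lt,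
    eventually_gt_atTop 0] with t h1 ht α hα
  have h := abs_slope_sub_modelCos_le h1 α
  rw [ux_flow_eq_cosSlope (Or.inl rfl) hu hγ one_ne_zero hα ht.le ht, sgn_of_pos one_pos]
  simpa only [abs_one, one_mul, div_one] using h

theorem tendsto_slopeError_timeChange :
    Tendsto (fun t => slopeError (timeChange 1 u γ t)) atTop (𝓝 0) :=
  tendsto_slopeError.comp (tendsto_timeChange_one hu hγ)

theorem tendsto_ux_flow_of_tendsto {α c : ℝ} (hα : α ∈ Icc (0 : ℝ) 1)
    (h : Tendsto (fun κ => modelCos κ α) (𝓝[<] 1) (𝓝 c)) :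
    Tendsto (fun t => ux u (γ α t) t) atTop (𝓝 (3 * c)) := by
  have h1 : Tendsto (fun t => ux u (γ α t) t - 3 * modelCos (timeChange 1 u γ t) α) atTop
      (𝓝 0) := by
    refine squeeze_zero_norm' ?_ (tendsto_slopeError_timeChange hu hγ)
    filter_upwards [eventually_abs_ux_flow_sub_le hu hγ] with t ht using ht α hα
  have h2 := h1.add ((h.comp (tendsto_timeChange_one hu hγ)).const_mul 3)
  rw [zero_add] at h2
  exact h2.congr fun t => sub_add_cancel _ _

theorem tendsto_maxSlope : Tendsto (maxSlope u γ) atTop (𝓝 3) := by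
  have hz : (0 : ℝ) ∈ Icc (0 : ℝ) 1 := left_mem_Icc.2 zero_le_one
  have h1 : Tendsto (fun κ => modelCos κ 0) (𝓝[<] 1) (𝓝 1) := by
    refine tendsto_const_nhds.congr' ?_
    filter_upwards [Ico_mem_nhdsLT (zero_lt_one' ℝ)] with κ hκ using (modelCos_zero hκ).symm
  have h2 := tendsto_ux_flow_of_tendsto hu hγ hz h1
  have h3 := (tendsto_slopeError_timeChange hu hγ).const_add 3
  rw [mul_one] at h2
  rw [add_zero] at h3
  refine tendsto_of_tendsto_of_tendsto_of_le_of_le' h2 h3 ?_ ?_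
  · filter_upwards [eventually_ge_atTop 0] with t ht using le_maxSlope (Or.inl rfl) hu hz ht
  · filter_upwards [eventually_abs_ux_flow_sub_le hu hγ,
      (tendsto_timeChange_one hu hγ).eventually eventually_half_lt] with t ht hκ
    refine maxSlope_le fun α hα => ?_
    have h4 := (abs_le.1 (ht α hα)).2
    have h5 := Real.cos_le_one (2 * Real.pi * modelFlow (timeChange 1 u γ t) α)
    rw [cos_modelFlow ⟨by linarith [hκ.1], hκ.2⟩] at h5
    linarith

theorem tendsto_ux_flow_of_notMem {α : ℝ} (hα : α ∈ Icc (0 : ℝ) 1) (hne : α ∉ maxPoints datum) :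
    Tendsto (fun t => ux u (γ α t) t) atTop (𝓝 (-3)) := by
  have h := tendsto_ux_flow_of_tendsto hu hγ hα (tendsto_modelCos fun h =>
    hne (mem_maxPoints_datum.2 ⟨hα, datumSlope_eq_one_iff.2 h⟩))
  rwa [mul_neg_one] at h

/-- Uniqueness identifies `u` with the constructed solution, for which the origin is at rest; this
fixes the translation left open by the flow formula. -/
theorem flow_zero_eq_zero (hum : HasZeroMean (Ici 0) u) {t : ℝ} (ht : 0 ≤ t) : γ 0 t = 0 := by
  have hJ : IsTimeInterval (Ici 0) := Or.inl rfl
  obtain ⟨v, hv, hvm, hv0⟩ := exists_solution_of_image one_ne_zero hJ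
    (image_timeScale_of_mem ⟨one_pos, le_rfl⟩)
  have h0 : IsCharacteristic (Ici 0) u fun _ => 0 := fun s hs => by
    rw [eq_of_hasZeroMean one_ne_zero hJ hu hv hum hvm hs, hv0 s hs]
    exact hasDerivWithinAt_const _ _ _
  have hz : (0 : ℝ) ∈ Icc (0 : ℝ) 1 := left_mem_Icc.2 zero_le_one
  obtain ⟨L, -, hL⟩ := hu.dist_characteristic_le hJ ht
  have := hL _ _ (hγ.isCharacteristic hz) h0 t ⟨ht, le_rfl⟩
  rw [(hγ 0 hz).1, sub_self, abs_zero, mul_zero, sub_zero] at this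
  exact abs_nonpos_iff.1 this

/-- The slope follows the cosine of the model flow, and the true flow is within `6 * (cosMean 1
κ)⁻¹` of it; the constant 36π is 3 · 2π · 6. -/
theorem eventually_abs_ux_sub_steadySlope_le (hum : HasZeroMean (Ici 0) u) :
    ∀ᶠ t in atTop, ∀ x, |ux u x t - steadySlope x| ≤
      slopeError (timeChange 1 u γ t) + 36 * Real.pi * (cosMean 1 (timeChange 1 u γ t))⁻¹ := by
  filter_upwards [eventually_abs_ux_flow_sub_le hu hγ, eventually_ge_atTop 0,
      (tendsto_timeChange_one hu hγ).eventually eventually_half_lt] with t h1 ht hκ x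
  obtain ⟨α, hα, hx⟩ := exists_flow_eq (Or.inl rfl) hu hγ one_ne_zero ht
    ((hu.periodic_ux ht).sub steadySlope_periodic) x
  simp only [Pi.sub_apply] at hx
  rw [hx]
  have h2 := flow_sub_eq_flowMap (Or.inl rfl) hu hγ one_ne_zero hα ht
  rw [flow_zero_eq_zero hu hγ hum ht, sub_zero] at h2
  set κ := timeChange 1 u γ t
  have hI : κ ∈ Ico (0 : ℝ) 1 := ⟨by linarith [hκ.1], hκ.2⟩
  have h3 : γ α t = (cosMean 1 κ)⁻¹ * ∫ x in (0 : ℝ)..α, (1 - κ * datumSlope x)⁻¹ := by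
    rw [h2, flowMap, ← intervalIntegral.integral_const_mul]
    refine intervalIntegral.integral_congr fun y _ => ?_
    simp only [jacobian, meanWeight_eq one_ne_zero, labelWeight_eq one_ne_zero, one_mul, div_one,
      Real.rpow_neg_one]
    rw [div_eq_inv_mul]
  have h4 := abs_flow_sub_modelFlow_le hκ hα
  rw [← h3] at h4
  have h5 := Real.abs_cos_sub_cos_le (2 * Real.pi * modelFlow κ α) (2 * Real.pi * γ α t)
  rw [cos_modelFlow hI, ← mul_sub, abs_mul, abs_sub_comm (modelFlow κ α),
    abs_of_pos Real.two_pi_pos] at h5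
  have h6 := mul_le_mul_of_nonneg_left h4 Real.two_pi_pos.le
  calc _ = |(ux u (γ α t) t - 3 * modelCos κ α)
          + 3 * (modelCos κ α - Real.cos (2 * Real.pi * γ α t))| := by
        rw [steadySlope]
        congr 1
        ring
    _ ≤ slopeError κ + 3 * (2 * Real.pi * (6 * (cosMean 1 κ)⁻¹)) := by
        refine (abs_add_le _ _).trans (add_le_add (h1 α hα) ?_)
        rw [abs_mul, abs_of_pos (by norm_num : (0 : ℝ) < 3)]
        linarith
    _ = _ := by ring

end Convergence

theorem eventually_abs_ux_sub_le (hu : IsClassicalSolution 1 datum (Ici 0) u)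
    (hum : HasZeroMean (Ici 0) u) {ε : ℝ} (hε : 0 < ε) :
    ∀ᶠ t in atTop, ∀ x, |ux u x t - steadySlope x| ≤ ε := by
  obtain ⟨γ, hγ⟩ := hu.exists_characteristicFlow (Or.inl rfl)
  have h := (tendsto_slopeError_timeChange hu hγ).add
    ((tendsto_inv_cosMean_one.comp (tendsto_timeChange_one hu hγ)).const_mul (36 * Real.pi))
  rw [mul_zero, add_zero] at h
  filter_upwards [eventually_abs_ux_sub_steadySlope_le hu hγ hum, h.eventually_lt_const hε]
    with t h1 h2 x
  exact (h1 x).trans h2.le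

theorem tendstoUniformly_ux_steady (hu : IsClassicalSolution 1 datum (Ici 0) u)
    (hum : HasZeroMean (Ici 0) u) :
    TendstoUniformly (fun t x => ux u x t) (deriv steadyProfile) atTop := by
  rw [Metric.tendstoUniformly_iff]
  intro ε hε
  filter_upwards [hu.eventually_abs_ux_sub_le hum (half_pos hε)] with t h x
  rw [(hasDerivAt_steadyProfile x).deriv, dist_comm, Real.dist_eq]
  linarith [h x]

theorem tendstoUniformly_steady (hu : IsClassicalSolution 1 datum (Ici 0) u)
    (hum : HasZeroMean (Ici 0) u) :
    TendstoUniformly (fun t x => u x t) steadyProfile atTop := by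
  rw [Metric.tendstoUniformly_iff]
  intro ε hε
  filter_upwards [hu.eventually_abs_ux_sub_le hum (half_pos hε), eventually_ge_atTop 0]
    with t h ht x
  have h0 : ∫ y in (0 : ℝ)..1, (u y t - steadyProfile y) = 0 := by
    rw [intervalIntegral.integral_sub ((hu.contDiff t ht).continuous.intervalIntegrable _ _)
      (contDiff_steadyProfile.continuous.intervalIntegrable _ _), hum t ht, integral_steadyProfile,
      sub_zero]
  have := abs_le_of_integral_eq_zero
    (fun y => (hu.hasDerivAt_ux ht y).sub (hasDerivAt_steadyProfile y))
    ((hu.periodic t ht).sub steadyProfile_periodic) h0 h x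
  rw [dist_comm, Real.dist_eq]
  simp only [Pi.sub_apply] at this
  linarith

theorem tendstoUniformly_ux_zero {lam : ℝ} (hlam : lam ∈ Ioo (0 : ℝ) 1)
    (hu : IsClassicalSolution lam datum (Ici 0) u) :
    TendstoUniformly (fun t x => ux u x t) (fun _ => 0) atTop := by
  rw [Metric.tendstoUniformly_iff]
  intro ε hε
  filter_upwards [exists_ux_le hlam hu ε hε] with t h x
  simpa using h.2 x

theorem tendstoUniformly_zero {lam : ℝ} (hlam : lam ∈ Ioo (0 : ℝ) 1)
    (hu : IsClassicalSolution lam datum (Ici 0) u) (hum : HasZeroMean (Ici 0) u) :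
    TendstoUniformly (fun t x => u x t) (fun _ => 0) atTop := by
  rw [Metric.tendstoUniformly_iff]
  intro ε hε
  filter_upwards [exists_ux_le hlam hu (ε / 2) (half_pos hε)] with t h x
  have := abs_le_of_integral_eq_zero (hu.hasDerivAt_ux h.1) (hu.periodic t h.1) (hum t h.1)
    (fun x => (h.2 x).le) x
  rw [dist_comm, dist_zero_right, Real.norm_eq_abs]
  linarith

end IsClassicalSolution

theorem exists_global_solution {lam : ℝ} (h : lam ∈ Icc (0 : ℝ) 1) :
    ∃ u, IsClassicalSolution lam datum (Ici 0) u ∧ HasZeroMean (Ici 0) u := by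
  rcases h.1.eq_or_lt with rfl | h0
  · exact exists_solution_zero
  · obtain ⟨u, hu, hum, -⟩ := exists_solution_of_image h0.ne' (Or.inl rfl)
      (image_timeScale_of_mem ⟨h0, h.2⟩)
    exact ⟨u, hu, hum⟩

theorem exists_blowup_time {lam : ℝ} (h : lam ∉ Icc (0 : ℝ) 1) :
    ∃ τ, 0 < τ ∧ timeScale lam '' Ico 0 (1 / |lam|) = Ico 0 τ ∧
      (∃ u, IsClassicalSolution lam datum (Ico 0 τ) u ∧ HasZeroMean (Ico 0 τ) u) ∧
      ∀ u, IsClassicalSolution lam datum (Ico 0 τ) u →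
        ∃ γ, IsCharacteristicFlow (Ico 0 τ) u γ := by
  have h0 : lam ≠ 0 := by
    rintro rfl
    exact h ⟨le_rfl, zero_le_one⟩
  obtain ⟨τ, hτ, himg⟩ := exists_image_timeScale h0 h
  have hJ : IsTimeInterval (Ico 0 τ) := Or.inr ⟨τ, hτ, rfl⟩
  obtain ⟨u, hu, hum, -⟩ := exists_solution_of_image h0 hJ himg
  exact ⟨τ, hτ, himg, ⟨u, hu, hum⟩, fun u hu => hu.exists_characteristicFlow hJ⟩

end

end ProudmanJohnson

/-! ### Assembly of the theorem -/

open ProudmanJohnson in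
theorem mainTheorem2 :
    ∃ u₀ : ℝ → ℝ,
      ContDiff ℝ ∞ u₀ ∧ Function.Periodic u₀ 1 ∧ (∫ x in (0 : ℝ)..1, u₀ x = 0) ∧
      (maxPoints u₀).Finite ∧ (minPoints u₀).Finite ∧
      -- global existence
      (∀ lam ∈ Icc (0 : ℝ) 1, ∃ u : ℝ → ℝ → ℝ,
        IsClassicalSolution lam u₀ (Ici 0) u ∧ HasZeroMean (Ici 0) u) ∧
      -- solutions vanish
      (∀ lam ∈ Ioo (0 : ℝ) 1, ∀ u : ℝ → ℝ → ℝ, IsClassicalSolution lam u₀ (Ici 0) u →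
        TendstoUniformly (fun t x => ux u x t) (fun _ => 0) atTop ∧
        (HasZeroMean (Ici 0) u → TendstoUniformly (fun t x => u x t) (fun _ => 0) atTop)) ∧
      -- convergence to a nontrivial steady state
      (∃ (U : ℝ → ℝ) (c : ℝ),
        IsClassicalSolution 1 U (Ici 0) (fun x _ => U x) ∧ (∃ x y, U x ≠ U y) ∧ 0 < c ∧
        ∀ u : ℝ → ℝ → ℝ, IsClassicalSolution 1 u₀ (Ici 0) u →
          (HasZeroMean (Ici 0) u →
            TendstoUniformly (fun t x => u x t) U atTop ∧
            TendstoUniformly (fun t x => ux u x t) (deriv U) atTop) ∧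
          (∃ γ, IsCharacteristicFlow (Ici 0) u γ) ∧
          ∀ γ, IsCharacteristicFlow (Ici 0) u γ →
            Tendsto (maxSlope u γ) atTop (𝓝 c) ∧
            ∀ α ∈ Icc (0 : ℝ) 1, α ∉ maxPoints u₀ →
              Tendsto (fun t => ux u (γ α t) t) atTop (𝓝 (-c))) ∧
      -- two-sided, everywhere blow-up
      (∀ lam : ℝ, lam ∉ Ioc (-2 : ℝ) 1 → ∃ T : ℝ, 0 < T ∧
        (∃ u, IsClassicalSolution lam u₀ (Ico 0 T) u ∧ HasZeroMean (Ico 0 T) u) ∧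
        ∀ u : ℝ → ℝ → ℝ, IsClassicalSolution lam u₀ (Ico 0 T) u →
          (∃ γ, IsCharacteristicFlow (Ico 0 T) u γ) ∧
          ∀ γ, IsCharacteristicFlow (Ico 0 T) u γ → TwoSidedEverywhereBlowup u₀ T u γ) ∧
      -- one-sided, discrete blow-up
      (∀ lam ∈ Ioo (-2 : ℝ) 0, ∃ T : ℝ, 0 < T ∧
        (∃ u, IsClassicalSolution lam u₀ (Ico 0 T) u ∧ HasZeroMean (Ico 0 T) u) ∧
        ∀ u : ℝ → ℝ → ℝ, IsClassicalSolution lam u₀ (Ico 0 T) u →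
          (∃ γ, IsCharacteristicFlow (Ico 0 T) u γ) ∧
          ∀ γ, IsCharacteristicFlow (Ico 0 T) u γ → OneSidedDiscreteBlowup u₀ T u γ) := by
  refine ⟨datum, contDiff_datum, datum_periodic, integral_datum, finite_maxPoints_datum,
    finite_minPoints_datum, fun _ => exists_global_solution, fun lam hlam u hu =>
      ⟨hu.tendstoUniformly_ux_zero hlam, hu.tendstoUniformly_zero hlam⟩,
    ⟨steadyProfile, 3, isClassicalSolution_steadyProfile, ⟨1 / 4, 0, ?_⟩, three_pos, fun u hu =>
      ⟨fun hum => ⟨hu.tendstoUniformly_steady hum, hu.tendstoUniformly_ux_steady hum⟩,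
        hu.exists_characteristicFlow (Or.inl rfl), fun γ hγ => ⟨hu.tendsto_maxSlope hγ,
          fun α hα => hu.tendsto_ux_flow_of_notMem hγ hα⟩⟩⟩, fun lam hlam => ?_, fun lam hlam => ?_⟩
  · have h : 2 * Real.pi * (1 / 4) = Real.pi / 2 := by ring
    rw [steadyProfile, steadyProfile, h, Real.sin_pi_div_two, mul_zero, Real.sin_zero, mul_zero,
      zero_div]
    positivity
  -- The blow-up time is the finite total length of the time scale, the same for every solution with
  -- this `lam`.
  · obtain ⟨τ, hτ, himg, hex, hγ⟩ := exists_blowup_time (lam := lam) fun h =>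
      hlam ⟨by linarith [h.1], h.2⟩
    exact ⟨τ, hτ, hex, fun u hu => ⟨hγ u hu, fun γ => hu.twoSidedEverywhereBlowup hlam hτ himg⟩⟩
  · obtain ⟨τ, hτ, himg, hex, hγ⟩ := exists_blowup_time (lam := lam) fun h =>
      absurd h.1 (not_le.2 hlam.2)
    exact ⟨τ, hτ, hex, fun u hu => ⟨hγ u hu, fun γ => hu.oneSidedDiscreteBlowup hlam hτ himg⟩⟩
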